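/- **Setting.** Work over $\mathbb C$, with summation over repeated Greek indices $1\le\alpha,\beta,\dots\le N$. A (formal) *flat F-manifold* at $t_{\rm orig}\in\mathbb C^N$ is given by a vector potential $F^1,\dots,F^N\in\mathbb C[[t^1-t^1_{\rm orig},\dots,t^N-t^N_{\rm orig}]]$ and constants $A^\alpha$ (the unit $A^\alpha\partial_{t^\alpha}$) such that, with $c^\alpha_{\beta\gamma}=\partial^2F^\alpha/\partial t^\beta\partial t^\gamma$, one has $A^\mu c^\alpha_{\mu\beta}=\delta^\alpha_\beta$ and $c^\alpha_{\beta\mu}c^\mu_{\gamma\delta}=c^\alpha_{\gamma\mu}c^\mu_{\beta\delta}$. It is *semisimple at* $t_{\rm orig}$ if the algebra with structure constants $c^\alpha_{\beta\gamma}(t_{\rm orig})$ has a basis $\pi_1,\dots,\pi_N$ with $\pi_k\pi_l=\delta_{kl}\pi_k$. A *calibration* is a sequence of matrices $\Omega^d_0=(\Omega^{\alpha,d}_{\beta,0})$, $d\ge-1$, of formal functions with $\Omega^{-1}_0=\mathrm{Id}$ and $\partial_{t^\gamma}\Omega^{\alpha,d}_{\beta,0}=c^\mu_{\gamma\beta}\Omega^{\alpha,d-1}_{\mu,0}$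 for $d\ge0$. Define $\Omega^0_d$ by $\Omega^0_{-1}=\mathrm{Id}$ and $\big(\sum_{d\ge0}(-1)^d\Omega^0_{d-1}z^d\big)\big(\sum_{d\ge0}\Omega^{d-1}_0z^d\big)=\mathrm{Id}$, and put $\Omega^p_q=\sum_{i=0}^q(-1)^{q-i}\Omega^{p+q-i}_0\Omega^0_{i-1}$ for $p,q\ge0$. Then $A^\beta\Omega^{\alpha,0}_{\beta,0}=t^\alpha+c^\alpha$ with $c^\alpha$ constant; let $\Omega^{\bar c}$ denote $\Omega$ with $t$ replaced by $t-c$, a formal function at $t_{\rm orig}+c$. In variables $t^\beta_b$, $b\ge0$, formal at $t_0=t_{\rm orig}+c$, $t_{\ge1}=0$, let $v^\alpha$ be the solution of the principal hierarchy $\partial v^\alpha/\partial t^\beta_d=A^\gamma\frac{\partial}{\partial t^\gamma_0}\big((\Omega^{\bar c})^{\alpha,0}_{\beta,d}(v)\big)$ with $v^\alpha|_{t_{\ge1}=0}=t^\alpha_0$. Put $q^\beta_b=t^\beta_b-\delta_{b,1}A^\beta$. The descendant vector potentials are $\mathcal F^{\alpha,a}=\sum_{b\ge0}(\Omega^{\bar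 c})^{\alpha,a}_{\beta,b}(v)\,q^\beta_b$, $a\ge0$. Let $\phi_1,\dots,\phi_N$ be the standard basis of $\mathbb C^N$ and write points of $\mathcal H=\mathbb C^N[[z,z^{-1}]]$ as $\sum_{d\ge0}(-1)^{d+1}p^\alpha_d\phi_\alpha z^{-d-1}+\sum_{d\ge0}q^\alpha_d\phi_\alpha z^d$. The *generalized Givental cone* $\mathcal C\subset\mathcal H$ of the calibrated flat F-manifold is the formal germ, over the point $(t^\alpha_{\rm orig}+c^\alpha-zA^\alpha)\phi_\alpha$, of the graph $p^\alpha_a=\mathcal F^{\alpha,a}(q)$. It is an *ancestor cone* if $t_{\rm orig}+c=0$ and $\partial\mathcal F^{\alpha,a}/\partial t^\beta_b=0$ at $t^*_*=0$ for all $\alpha,\beta$ and $a,b\ge0$. Let $\mathcal C^{\rm triv}_N$ be the ancestor cone of the flat F-manifold at $0$ with potential $F^\alpha=(t^\alpha)^2/2$ and unit $\sum_\alpha\partial_{t^\alpha}$. Let $G_+=\{R(z)=\mathrm{Id}+\sum_{i\ge1}R_iz^i\}$ and $G_-=\{S(z)=\mathrm{Id}+\sum_{i\ge1}S_iz^{-i}\}$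 with $R_i,S_i\in\mathrm{End}(\mathbb C^N)$. The groups $G_-$ and $\mathrm{GL}(\mathbb C^N)$ act on generalized Givental cones, and $G_+$ acts on ancestor cones, by left multiplication in $\mathcal H$: for $T=S(z)$, $R(z)$ or $M$, $\mathcal C'=T\mathcal C$ means that $T$ maps the general point of the graph $\mathcal C$ to a point of the graph $\mathcal C'$ (for $T=R(z)$ the potentials being re-expanded at the base point $-zA^\alpha\phi_\alpha$), all the infinite sums involved being well defined coefficient by coefficient. **Theorem.** The cone $\mathcal C^{\rm triv}_N$ exists, and: 1. Let $\mathcal C$ be the generalized Givental cone of a calibrated flat F-manifold of dimension $N$ that is semisimple at $t_{\rm orig}$. Then there are $S(z)\in G_-$, $R(z)\in G_+$ and $M\in\mathrm{GL}(\mathbb C^N)$ with $$\mathcal C=S(z)R(z)M\,\mathcal C^{\rm triv}_N,$$ where $M\mathcal C^{\rm triv}_N$ and $R(z)M\mathcal C^{\rm triv}_N$ are ancestor cones of flat F-manifolds that are semisimple at the base point. 2. Consequently the combined action of $G_-$, $G_+$ and $\mathrm{GL}(\mathbb C^N)$ is transitive on semisimple calibrated flat F-manifolds of dimension $N$, represented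 by their generalized Givental cones: for any two cones $\mathcal C,\mathcal C'$ as in part 1 there are $S,S'\in G_-$, $R\in G_+$ and $M\in\mathrm{GL}(\mathbb C^N)$ with $\mathcal C'=S'(z)R(z)M\,S(z)\,\mathcal C$, where $S\mathcal C$, $MS\mathcal C$ and $RMS\mathcal C$ are ancestor cones of flat F-manifolds that are semisimple at the base point. -/

import Mathlib

noncomputable section

namespace FlatF

open MvPowerSeries

/-! ### Formal flat F-manifolds and calibrations -/

/-- Formal power series in the shifted coordinates `t^α - t^α_orig`, `1 ≤ α ≤ N`. -/
abbrev Fun (N : ℕ) := MvPowerSeries (Fin N) ℂ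

/-- A flat F-manifold on the formal neighbourhood of a point `orig` of `ℂ^N`, given in flat
coordinates by a vector potential `F` and a unit `A^α ∂/∂t^α`. Every power series is written in
the shifted coordinates `t^α - t^α_orig`. -/
structure FlatFManifold (N : ℕ) where
  orig : Fin N → ℂ
  unit : Fin N → ℂ
  F : Fin N → Fun N
  unit_axiom : ∀ α β, ∑ μ, C (unit μ) * pderiv ℂ μ (pderiv ℂ β (F α)) = if α = β then 1 else 0
  assoc_axiom : ∀ α β γ δ,
    ∑ μ, pderiv ℂ β (pderiv ℂ μ (F α)) * pderiv ℂ γ (pderiv ℂ δ (F μ)) =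
      ∑ μ, pderiv ℂ γ (pderiv ℂ μ (F α)) * pderiv ℂ β (pderiv ℂ δ (F μ))

/-- The structure constants `c^α_{βγ} = ∂²F^α / ∂t^β ∂t^γ`. -/
def FlatFManifold.c {N : ℕ} (X : FlatFManifold N) (α β γ : Fin N) : Fun N :=
  pderiv ℂ β (pderiv ℂ γ (X.F α))

/-- The product on the tangent space at the point `orig`. -/
def FlatFManifold.mulOrig {N : ℕ} (X : FlatFManifold N) (v w : Fin N → ℂ) : Fin N → ℂ :=
  fun α => ∑ β, ∑ γ, constantCoeff (X.c α β γ) * v β * w γ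

/-- The tangent space at `orig` has a basis `π` with `π_k ∘ π_l = δ_{kl} π_k`. -/
def FlatFManifold.IsSemisimple {N : ℕ} (X : FlatFManifold N) : Prop :=
  ∃ π : Module.Basis (Fin N) ℂ (Fin N → ℂ),
    ∀ k l, X.mulOrig (π k) (π l) = if k = l then π k else 0

/-- A calibration. `Ω.mat d` is the matrix usually written `Ω^{d-1}_0`, `d ≥ 0`, whose entry in
row `α` and column `β` is `Ω^{α,d-1}_{β,0}`. -/
structure FlatFManifold.Calibration {N : ℕ} (X : FlatFManifold N) where
  mat : ℕ → Matrix (Fin N) (Fin N) (Fun N)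
  mat_zero : mat 0 = 1
  deriv : ∀ d α β γ, pderiv ℂ γ (mat (d + 1) α β) = ∑ μ, X.c μ γ β * mat d α μ

namespace FlatFManifold.Calibration

variable {N : ℕ} {X : FlatFManifold N} (Ω : X.Calibration)

/-- The series `Id + ∑_{d ≥ 1} Ω^{d-1}_0 z^d`. -/
def series : PowerSeries (Matrix (Fin N) (Fin N) (Fun N)) := PowerSeries.mk Ω.mat

/-- `Ω.lower d` is the matrix `Ω^0_{d-1}`, `d ≥ 0`, defined by the equation
`(∑_d (-1)^d Ω^0_{d-1} z^d) (∑_d Ω^{d-1}_0 z^d) = Id`. -/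
def lower (d : ℕ) : Matrix (Fin N) (Fin N) (Fun N) :=
  (-1) ^ d * PowerSeries.coeff d (PowerSeries.invOfUnit Ω.series 1)

theorem lower_mul_series :
    PowerSeries.mk (fun d => (-1) ^ d * Ω.lower d) * Ω.series = 1 := by
  have h : PowerSeries.mk (fun d => (-1) ^ d * Ω.lower d) =
      PowerSeries.invOfUnit Ω.series 1 := by
    ext1 d
    rw [PowerSeries.coeff_mk, lower, ← mul_assoc, ← pow_add, ← two_mul]
    simp
  rw [h]
  apply PowerSeries.invOfUnit_mul
  simp [series, Ω.mat_zero, ← PowerSeries.coeff_zero_eq_constantCoeff_apply]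

/-- The two-index matrices `Ω^p_q = ∑_{i=0}^q (-1)^{q-i} Ω^{p+q-i}_0 Ω^0_{i-1}`, `p, q ≥ 0`. -/
def two (p q : ℕ) : Matrix (Fin N) (Fin N) (Fun N) :=
  ∑ i ∈ Finset.range (q + 1), (-1) ^ (q - i) * (Ω.mat (p + (q - i) + 1) * Ω.lower i)

/-- The function `Ω^{α,0}_{𝟙,0} = A^β Ω^{α,0}_{β,0}`, which equals `t^α + c^α` for a constant
`c^α`; its value at `orig` is `t^α_orig + c^α`. -/
def shiftedOrig (α : Fin N) : ℂ := constantCoeff (∑ β, Ω.mat 1 α β * C (X.unit β))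

end FlatFManifold.Calibration

/-! ### Formal germs of graphs in `ℂ^N[[z, z⁻¹]]` -/

/-- Formal power series in the variables `x^β_b`, `1 ≤ β ≤ N`, `b ≥ 0`. -/
abbrev BigFun (N : ℕ) := MvPowerSeries (Fin N × ℕ) ℂ

/-- A collection of formal functions `F^{α,a}` on `H_+ = ℂ^N[[z]]` at the point
`base - z · unit`, that is, the formal germ of the graph `p^α_a = F^{α,a}` in
`H = ℂ^N[[z, z⁻¹]]`. The series `pot a α = F^{α,a}` is written in the variables
`x^β_0 = t^β_0 - base^β` and `x^β_b = t^β_b` for `b ≥ 1`, where `q^β_b = t^β_b - δ_{b,1} A^β`. -/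
@[ext]
structure GraphGerm (N : ℕ) where
  base : Fin N → ℂ
  unit : Fin N → ℂ
  pot : ℕ → Fin N → BigFun N

/-- The coordinates `q^β_b` of the base point `base - z · unit`. -/
def GraphGerm.basePoint {N : ℕ} (G : GraphGerm N) (b : ℕ) (β : Fin N) : ℂ :=
  if b = 0 then G.base β else if b = 1 then -G.unit β else 0

/-- The coordinate `q^β_b` on `H_+` as a function of the variables `x`. -/
def GraphGerm.q {N : ℕ} (G : GraphGerm N) (b : ℕ) (β : Fin N) : BigFun N :=
  X (β, b) + C (G.basePoint b β)

/-! ### Descendant potentials and generalized Givental cones -/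

/-- The family `f` of power series is summable: each coefficient is nonzero for only finitely
many members of the family. -/
def LocallyFinite {ι σ : Type*} (f : ι → MvPowerSeries σ ℂ) : Prop :=
  ∀ d : σ →₀ ℕ, {i | coeff d (f i) ≠ 0}.Finite

/-- The sum of a family of power series, coefficient by coefficient. -/
def formalSum {ι σ : Type*} (f : ι → MvPowerSeries σ ℂ) : MvPowerSeries σ ℂ :=
  fun d => ∑ᶠ i, coeff d (f i)

namespace FlatFManifold.Calibration

variable {N : ℕ} {X : FlatFManifold N} (Ω : X.Calibration)

/-- `w` is the topological solution `v^α = w^α + t^α_orig + c^α` of the principal hierarchy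
`∂v^α / ∂t^β_d = ∂_x (Ω^{α,0}_{β,d}(v))`, where `∂_x = A^γ ∂/∂t^γ_0`: it satisfies all the
equations of the hierarchy and the initial condition `v^α = t^α_0` at `t^*_{≥ 1} = 0`. The
power series are in the variables `x^α_0 = t^α_0 - (t^α_orig + c^α)`, `x^α_b = t^α_b`. -/
def IsTopologicalSolution (w : Fin N → BigFun N) : Prop :=
  (∀ α, ∀ m : Fin N × ℕ →₀ ℕ, (∀ p ∈ m.support, p.2 = 0) →
    coeff m (w α) = coeff m (MvPowerSeries.X (α, 0) : BigFun N)) ∧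
  ∀ α β d, pderiv ℂ (β, d) (w α) =
    ∑ γ, C (X.unit γ) * pderiv ℂ (γ, 0) (subst w (Ω.two 0 d α β))

/-- `G` is the generalized Givental cone of the calibrated flat F-manifold: the germ over the
point `t_orig + c - z A` of the graph of the descendant vector potentials
`F^{α,a} = ∑_{b ≥ 0} Ω^{α,a}_{β,b}(v) q^β_b`. -/
def IsConeOf (G : GraphGerm N) : Prop :=
  G.base = Ω.shiftedOrig ∧ G.unit = X.unit ∧
  ∃ w : Fin N → BigFun N, Ω.IsTopologicalSolution w ∧
    ∀ a α, G.pot a α =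
      formalSum fun p : Fin N × ℕ => subst w (Ω.two a p.2 α p.1) * G.q p.2 p.1

end FlatFManifold.Calibration

/-- The vector potentials are ancestor: the base point is `- z A`, and all the first derivatives
`∂F^{α,a} / ∂t^β_b` vanish there. -/
def GraphGerm.IsAncestor {N : ℕ} (G : GraphGerm N) : Prop :=
  G.base = 0 ∧ ∀ a α p, constantCoeff (pderiv ℂ p (G.pot a α)) = 0

/-- `G` is the generalized Givental cone of a calibrated flat F-manifold that is semisimple at
its base point. -/
def GraphGerm.IsSemisimpleCone {N : ℕ} (G : GraphGerm N) : Prop :=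
  ∃ (X : FlatFManifold N) (Ω : X.Calibration), X.IsSemisimple ∧ Ω.IsConeOf G

theorem pderiv_pderiv_half_sq {N : ℕ} (α β γ : Fin N) :
    pderiv ℂ β (pderiv ℂ γ (C (1 / 2 : ℂ) * X α ^ 2 : Fun N)) =
      if β = α ∧ γ = α then 1 else 0 := by
  have h2 : (C (1 / 2 : ℂ) : Fun N) * 2 = 1 := by
    rw [show (2 : Fun N) = C (2 : ℂ) from (map_ofNat C 2).symm, ← map_mul]
    norm_num
  have h1 : pderiv ℂ γ (C (1 / 2 : ℂ) * X α ^ 2 : Fun N) = X α * pderiv ℂ γ (X α) := by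
    rw [Derivation.leibniz, pderiv_C, pderiv_pow]
    simp only [smul_eq_mul, Nat.cast_ofNat, mul_zero, add_zero]
    linear_combination (X α * pderiv ℂ γ (X α)) * h2
  rw [h1]
  by_cases hγ : γ = α
  · subst hγ
    by_cases hβ : β = γ
    · subst hβ
      simp
    · simp [hβ, pderiv_X_of_ne (Ne.symm hβ)]
  · simp [hγ, pderiv_X_of_ne (Ne.symm hγ)]

/-- The trivial flat F-manifold of dimension `N`, with vector potential `F^α = (t^α)² / 2` and
unit `∑_α ∂/∂t^α`. -/
def trivialFlatFManifold (N : ℕ) : FlatFManifold N where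
  orig := 0
  unit := 1
  F := fun α => C (1 / 2 : ℂ) * X α ^ 2
  unit_axiom := by
    intro α β
    simp only [pderiv_pderiv_half_sq, ite_and]
    simp [eq_comm]
  assoc_axiom := by
    intro α β γ δ
    simp only [pderiv_pderiv_half_sq, ite_and]
    by_cases h1 : β = α <;> by_cases h2 : γ = α <;> by_cases h3 : δ = α <;>
      simp [h1, h2, h3]

/-- `G` is the ancestor cone of the trivial flat F-manifold of dimension `N`. -/
def GraphGerm.IsTrivialCone {N : ℕ} (G : GraphGerm N) : Prop :=
  G.IsAncestor ∧ ∃ Ω : (trivialFlatFManifold N).Calibration, Ω.IsConeOf G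

/-! ### The action of matrix Laurent series -/

/-- A formal point of `H`: `f n` is the coefficient of `z^n`, a vector whose entries are formal
functions of the variables `x`. -/
abbrev Pt (N : ℕ) := ℤ → Fin N → BigFun N

/-- The coordinate `q^α_b` of a point of `H`. -/
def Pt.q {N : ℕ} (f : Pt N) (b : ℕ) (α : Fin N) : BigFun N := f b α

/-- The coordinate `p^α_d` of a point of `H`: the coefficient of `φ_α z^{-d-1}` is
`(-1)^{d+1} p^α_d`. -/
def Pt.p {N : ℕ} (f : Pt N) (d : ℕ) (α : Fin N) : BigFun N := (-1) ^ (d + 1) * f (-(d : ℤ) - 1) α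

/-- The general point of the graph `G`: its coordinates are `q^α_b` and `p^α_a = F^{α,a}`. -/
def GraphGerm.genericPoint {N : ℕ} (G : GraphGerm N) : Pt N
  | Int.ofNat b => G.q b
  | Int.negSucc d => fun α => (-1) ^ (d + 1) * G.pot d α

/-- The family of terms `T_i f_{n-i}` in the coefficient of `φ_α z^n` in `T(z) f(z)`. -/
def actTerm {N : ℕ} (T : ℤ → Matrix (Fin N) (Fin N) ℂ) (f : Pt N) (n : ℤ) (α : Fin N) (i : ℤ) :
    BigFun N :=
  ∑ μ, C (T i α μ) * f (n - i) μ

/-- The product `T(z) f(z)`, where `T(z) = ∑_{i ∈ ℤ} T_i z^i`. -/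
def act {N : ℕ} (T : ℤ → Matrix (Fin N) (Fin N) ℂ) (f : Pt N) : Pt N :=
  fun n α => formalSum (actTerm T f n α)

/-- The family of terms of the series `F(y)`, indexed by the monomials of `F`. -/
def substTerm {σ τ : Type*} (F : MvPowerSeries σ ℂ) (y : σ → MvPowerSeries τ ℂ) (m : σ →₀ ℕ) :
    MvPowerSeries τ ℂ :=
  C (coeff m F) * m.prod fun s k => y s ^ k

/-- The formal point `f` lies on the germ `G`. After the displacement `y` of the `q`-coordinates
of `f` from the base point of `G` is put in place of the variables of `F^{α,a}`, the resulting
series are summable and their sums are the `p`-coordinates of `f`. For `b ≥ 2` the displacement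
may contain constants (the series `F^{α,a}` is then expanded at a point moved in the direction of
`t^*_{≥ 2}`). -/
def GraphGerm.Contains {N : ℕ} (G : GraphGerm N) (f : Pt N) : Prop :=
  let y : Fin N × ℕ → BigFun N := fun s => f.q s.2 s.1 - C (G.basePoint s.2 s.1)
  (∀ β, constantCoeff (y (β, 0)) = 0 ∧ constantCoeff (y (β, 1)) = 0) ∧
  ∀ a α, LocallyFinite (substTerm (G.pot a α) y) ∧
    f.p a α = formalSum (substTerm (G.pot a α) y)

/-- `G' = T(z) G`: the operator `T(z)` is well defined on the general point of the graph `G` and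
sends it to a point of the graph `G'`. -/
def IsImage {N : ℕ} (T : ℤ → Matrix (Fin N) (Fin N) ℂ) (G G' : GraphGerm N) : Prop :=
  (∀ n α, LocallyFinite (actTerm T G.genericPoint n α)) ∧ G'.Contains (act T G.genericPoint)

/-- The upper triangular group `G_+` of series `R(z) = Id + ∑_{i ≥ 1} R_i z^i`. -/
def GPlus (N : ℕ) : Set (PowerSeries (Matrix (Fin N) (Fin N) ℂ)) :=
  {R | PowerSeries.coeff 0 R = 1}

/-- The lower triangular group `G_-` of series `S(z) = Id + ∑_{i ≥ 1} S_i z^{-i}`; its elements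
are stored as power series in the variable `z⁻¹`. -/
def GMinus (N : ℕ) : Set (PowerSeries (Matrix (Fin N) (Fin N) ℂ)) :=
  {S | PowerSeries.coeff 0 S = 1}

/-- The coefficients, indexed by powers of `z`, of a power series in `z`. -/
def upper {N : ℕ} (R : PowerSeries (Matrix (Fin N) (Fin N) ℂ)) (i : ℤ) :
    Matrix (Fin N) (Fin N) ℂ :=
  if 0 ≤ i then PowerSeries.coeff i.toNat R else 0

/-- The coefficients, indexed by powers of `z`, of a power series in `z⁻¹`. -/
def lower {N : ℕ} (S : PowerSeries (Matrix (Fin N) (Fin N) ℂ)) (i : ℤ) :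
    Matrix (Fin N) (Fin N) ℂ :=
  if i ≤ 0 then PowerSeries.coeff (-i).toNat S else 0

/-- The operator on `H` induced by a linear automorphism of `ℂ^N`. -/
def const {N : ℕ} (M : GL (Fin N) ℂ) (i : ℤ) : Matrix (Fin N) (Fin N) ℂ :=
  if i = 0 then (M : Matrix (Fin N) (Fin N) ℂ) else 0

end FlatF

end

/-! For a calibrated flat F-manifold let S_w = Σ (-1)^k Ω^{k-1}_0(w) z^{-k} (`hat`), with inverse Σ
Ω^0_{k-1}(w) z^{-k} (`lhat`). As in Givental's theory, the cone is ruled: its general point is S_w h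
with h in z H_+. The parameter w of a point with coordinates q is the unique solution of the
Euler–Lagrange equation, the vanishing of the z^0 coefficient of S_w^{-1} q. This w is the
topological solution of the principal hierarchy (`IsEulerLagrange.isTopologicalSolution`,
`IsTopologicalSolution.unique`). The matrices Ω^a_b are the blocks of S_w [S_w^{-1} ·]_+, so the
descendant potentials are the negative part of S_w h (`point_eq`, with converse `conv_hat_spec`).

Consequently T maps one cone into another as soon as T S¹_w = S²_{w'} B for some w' and some B with
only nonnegative powers of z that matches the units at the base point: then T S¹_w h = S²_{w'} (B
h), and B h is again in z H_+ (`act_spec`, `contains_of`). With B constant this covers changes of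
calibration by constant series (G_-) and linear changes of coordinates (`isImage_of_lower`); with B
a power series in z it covers G_+ (`isImage_of_upper`).

Semisimplicity supplies B. Idempotents extend to the formal neighbourhood and yield canonical
coordinates u_j and a solution P(z) e^{U/z} of the flatness equations, where P is a power series in
z and U = diag(u) (`exists_canonicalSolution`). For two manifolds with the same idempotents at the
base point, choose v with u²(v) = u¹. The exponentials cancel in B = P₂(v) P₁^{-1}, which
intertwines the two flat connections. If both calibrations are normalized, that is S = Id at the
base point, and R is the value of B there, then R S¹ and S²_v B solve the same linear system with
the same initial value, so they agree (`conv_intertwiner`).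

For transitivity, a constant series normalizes the calibration, a linear map aligns the idempotents,
and R is the intertwiner. Ancestor cones are exactly those of normalized calibrations, so the
trivial cone may serve as the starting point.

The remaining work is summability. It is delicate only for G_+, which may displace the variables t_b
with b ≥ 2 by constants; there a weight estimate on the topological solution
(`IsEulerLagrange.wtGE`) leaves finitely many contributing terms. -/

noncomputable section

namespace FlatF

open MvPowerSeries

/-! ### Locally finite families of power series -/

section FormalSums

variable {ι κ σ : Type*}

theorem coeff_formalSum (f : ι → MvPowerSeries σ ℂ) (d : σ →₀ ℕ) :
    coeff d (formalSum f) = ∑ᶠ i, coeff d (f i) := rfl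

theorem LocallyFinite.of_finite [Finite ι] (f : ι → MvPowerSeries σ ℂ) : LocallyFinite f :=
  fun _ => Set.toFinite _

theorem LocallyFinite.comp_injective {f : ι → MvPowerSeries σ ℂ} (hf : LocallyFinite f)
    {e : κ → ι} (he : Function.Injective e) : LocallyFinite fun k => f (e k) :=
  fun d => (hf d).preimage he.injOn

theorem LocallyFinite.of_support {f : ι → MvPowerSeries σ ℂ} (s : Set ι) (hs : s.Finite)
    (h : ∀ i ∉ s, f i = 0) : LocallyFinite f := fun d =>
  hs.subset fun i hi => by
    by_contra h'
    exact hi (by rw [h i h', map_zero])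

theorem LocallyFinite.add {f g : ι → MvPowerSeries σ ℂ} (hf : LocallyFinite f)
    (hg : LocallyFinite g) : LocallyFinite fun i => f i + g i := fun d =>
  ((hf d).union (hg d)).subset fun i hi => by
    by_contra h
    simp only [Set.mem_union, Set.mem_ofPred_eq, not_or, not_not] at h
    exact hi (by rw [map_add, h.1, h.2, add_zero])

theorem LocallyFinite.sum {α : Type*} (s : Finset α) {f : α → ι → MvPowerSeries σ ℂ}
    (hf : ∀ a ∈ s, LocallyFinite (f a)) : LocallyFinite fun i => ∑ a ∈ s, f a i := by
  classical
  induction s using Finset.induction_on with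
  | empty => exact fun d => by simp
  | insert a s ha ih =>
    simp only [Finset.sum_insert ha]
    exact (hf a (by simp)).add (ih fun b hb => hf b (by simp [hb]))

/-- Every finiteness, order and weight estimate for products below reduces to this inclusion of
supports. -/
theorem exists_coeff_ne_zero_of_mul {f g : MvPowerSeries σ ℂ} {d : σ →₀ ℕ}
    (h : coeff d (f * g) ≠ 0) : ∃ a b, a + b = d ∧ coeff a f ≠ 0 ∧ coeff b g ≠ 0 := by
  classical
  rw [coeff_mul] at h
  obtain ⟨p, hp, h⟩ := Finset.exists_ne_zero_of_sum_ne_zero h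
  exact ⟨p.1, p.2, Finset.HasAntidiagonal.mem_antidiagonal.1 hp, left_ne_zero_of_mul h, right_ne_zero_of_mul h⟩

/-- If `f` is locally finite and so is `g i` for each `i`, then the family `f i * g i j` is
locally finite. -/
theorem LocallyFinite.mul_sigma {f : ι → MvPowerSeries σ ℂ} {g : ι → κ → MvPowerSeries σ ℂ}
    (hf : LocallyFinite f) (hg : ∀ i, LocallyFinite (g i)) :
    LocallyFinite fun p : ι × κ => f p.1 * g p.1 p.2 := by
  classical
  intro d
  refine Set.Finite.subset (s := ⋃ q ∈ Finset.HasAntidiagonal.antidiagonal d,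
    ⋃ i ∈ {i | coeff q.1 (f i) ≠ 0}, (fun j => (i, j)) '' {j | coeff q.2 (g i j) ≠ 0}) ?_ ?_
  · exact (Finset.finite_toSet _).biUnion fun q _ => (hf q.1).biUnion fun i _ => (hg i q.2).image _
  · rintro ⟨i, j⟩ h
    obtain ⟨a, b, hab, h1, h2⟩ := exists_coeff_ne_zero_of_mul h
    simp only [Set.mem_iUnion]
    exact ⟨(a, b), by simpa using hab, i, h1, j, h2, rfl⟩

theorem LocallyFinite.mul {f : ι → MvPowerSeries σ ℂ} {g : κ → MvPowerSeries σ ℂ}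
    (hf : LocallyFinite f) (hg : LocallyFinite g) :
    LocallyFinite fun p : ι × κ => f p.1 * g p.2 :=
  LocallyFinite.mul_sigma (g := fun _ => g) hf fun _ => hg

theorem LocallyFinite.mul_right {f : ι → MvPowerSeries σ ℂ} (hf : LocallyFinite f)
    (g : ι → MvPowerSeries σ ℂ) : LocallyFinite fun i => f i * g i := by
  have h := hf.mul_sigma (κ := Unit) (g := fun i _ => g i) fun _ => LocallyFinite.of_finite _
  exact h.comp_injective (e := fun i => (i, ())) fun a b hab => by simpa using hab

theorem LocallyFinite.mul_left {f : ι → MvPowerSeries σ ℂ} (hf : LocallyFinite f)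
    (g : ι → MvPowerSeries σ ℂ) : LocallyFinite fun i => g i * f i := by
  simpa only [mul_comm] using hf.mul_right g

theorem formalSum_add {f g : ι → MvPowerSeries σ ℂ} (hf : LocallyFinite f)
    (hg : LocallyFinite g) : formalSum (fun i => f i + g i) = formalSum f + formalSum g := by
  ext d
  simp only [coeff_formalSum, map_add]
  exact finsum_add_distrib (hf d) (hg d)

theorem formalSum_zero : formalSum (fun _ : ι => (0 : MvPowerSeries σ ℂ)) = 0 := by
  ext d
  simp [coeff_formalSum]

theorem formalSum_neg (f : ι → MvPowerSeries σ ℂ) :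
    formalSum (fun i => - f i) = - formalSum f := by
  ext d
  simp only [coeff_formalSum, map_neg]
  exact finsum_neg_distrib _

theorem formalSum_of_fintype [Fintype ι] (f : ι → MvPowerSeries σ ℂ) :
    formalSum f = ∑ i, f i := by
  ext d
  rw [coeff_formalSum, finsum_eq_sum_of_fintype, map_sum]

theorem formalSum_of_support (f : ι → MvPowerSeries σ ℂ) (s : Finset ι)
    (h : ∀ i ∉ s, f i = 0) : formalSum f = ∑ i ∈ s, f i := by
  ext d
  rw [coeff_formalSum, map_sum]
  refine finsum_eq_sum_of_support_subset _ fun i hi => ?_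
  by_contra h'
  exact hi (by simp only [h i h', map_zero])

theorem formalSum_eq_single (f : ι → MvPowerSeries σ ℂ) (i : ι) (h : ∀ j, j ≠ i → f j = 0) :
    formalSum f = f i := by
  rw [formalSum_of_support f {i} fun j hj => h j (by simpa using hj), Finset.sum_singleton]

theorem formalSum_sum {α : Type*} (s : Finset α) {f : α → ι → MvPowerSeries σ ℂ}
    (hf : ∀ a ∈ s, LocallyFinite (f a)) :
    formalSum (fun i => ∑ a ∈ s, f a i) = ∑ a ∈ s, formalSum (f a) := by
  ext d
  simp only [coeff_formalSum, map_sum]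
  exact finsum_sum_comm s (fun i a => coeff d (f a i)) fun a ha => hf a ha d

theorem formalSum_equiv (e : κ ≃ ι) (f : ι → MvPowerSeries σ ℂ) :
    formalSum (fun k => f (e k)) = formalSum f := by
  ext d
  exact finsum_comp_equiv e (f := fun i => coeff d (f i))

theorem formalSum_mul_left (g : MvPowerSeries σ ℂ) {f : ι → MvPowerSeries σ ℂ}
    (hf : LocallyFinite f) : formalSum (fun i => g * f i) = g * formalSum f := by
  classical
  ext d
  simp only [coeff_formalSum, coeff_mul]
  rw [finsum_sum_comm]
  · refine Finset.sum_congr rfl fun p _ => ?_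
    rw [mul_finsum' _ _ (hf p.2)]
  · exact fun p _ => (hf p.2).subset fun i hi => right_ne_zero_of_mul hi

theorem formalSum_mul_right (g : MvPowerSeries σ ℂ) {f : ι → MvPowerSeries σ ℂ}
    (hf : LocallyFinite f) : formalSum (fun i => f i * g) = formalSum f * g := by
  simp only [mul_comm _ g]
  exact formalSum_mul_left g hf

theorem LocallyFinite.formalSum_fst {f : ι × κ → MvPowerSeries σ ℂ} (hf : LocallyFinite f) :
    LocallyFinite fun i => formalSum fun k => f (i, k) := by
  intro d
  refine ((hf d).image Prod.fst).subset fun i hi => ?_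
  obtain ⟨k, hk⟩ : ∃ k, coeff d (f (i, k)) ≠ 0 := by
    by_contra! h
    exact hi (finsum_eq_zero_of_forall_eq_zero h)
  exact ⟨(i, k), hk, rfl⟩

theorem LocallyFinite.fst {f : ι × κ → MvPowerSeries σ ℂ} (hf : LocallyFinite f) (i : ι) :
    LocallyFinite fun k => f (i, k) :=
  hf.comp_injective (e := fun k => (i, k)) fun a b h => by simpa using h

theorem formalSum_prod {f : ι × κ → MvPowerSeries σ ℂ} (hf : LocallyFinite f) :
    formalSum f = formalSum fun i => formalSum fun k => f (i, k) := by
  ext d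
  simp only [coeff_formalSum]
  exact finsum_curry _ (hf d)

theorem formalSum_mul_formalSum {f : ι → MvPowerSeries σ ℂ} {g : κ → MvPowerSeries σ ℂ}
    (hf : LocallyFinite f) (hg : LocallyFinite g) :
    formalSum f * formalSum g = formalSum fun p : ι × κ => f p.1 * g p.2 := by
  rw [formalSum_prod (hf.mul hg), ← formalSum_mul_right _ hf]
  congr 1
  funext i
  exact (formalSum_mul_left _ hg).symm

theorem pderiv_formalSum (s : σ) {f : ι → MvPowerSeries σ ℂ} (hf : LocallyFinite f) :
    pderiv ℂ s (formalSum f) = formalSum fun i => pderiv ℂ s (f i) := by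
  ext d
  simp only [coeff_pderiv, coeff_formalSum]
  rw [finsum_mul' _ _ (hf _)]

theorem LocallyFinite.pderiv (s : σ) {f : ι → MvPowerSeries σ ℂ} (hf : LocallyFinite f) :
    LocallyFinite fun i => MvPowerSeries.pderiv ℂ s (f i) := fun d =>
  (hf (d + Finsupp.single s 1)).subset fun i hi => by
    simp only [Set.mem_ofPred_eq, coeff_pderiv] at hi
    exact left_ne_zero_of_mul hi

theorem pderiv_comm (s t : σ) (f : MvPowerSeries σ ℂ) :
    MvPowerSeries.pderiv ℂ s (MvPowerSeries.pderiv ℂ t f) =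
      MvPowerSeries.pderiv ℂ t (MvPowerSeries.pderiv ℂ s f) := by
  classical
  ext d
  simp only [coeff_pderiv, Finsupp.add_apply, Nat.cast_add]
  rw [add_right_comm]
  by_cases h : s = t
  · subst h; rfl
  · rw [Finsupp.single_eq_of_ne h, Finsupp.single_eq_of_ne (Ne.symm h)]
    ring

end FormalSums

/-! ### Locally finite families of matrices of power series -/

section MatrixSums

variable {ι κ σ l m n : Type*}

/-- A family of matrices of power series all of whose entries form locally finite families. -/
def MLF (f : ι → Matrix l m (MvPowerSeries σ ℂ)) : Prop :=
  ∀ a b, LocallyFinite fun i => f i a b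

/-- The entrywise formal sum of a family of matrices of power series. -/
def msum (f : ι → Matrix l m (MvPowerSeries σ ℂ)) : Matrix l m (MvPowerSeries σ ℂ) :=
  Matrix.of fun a b => formalSum fun i => f i a b

theorem msum_apply (f : ι → Matrix l m (MvPowerSeries σ ℂ)) (a : l) (b : m) :
    msum f a b = formalSum fun i => f i a b := rfl

theorem MLF.of_support {f : ι → Matrix l m (MvPowerSeries σ ℂ)} (s : Set ι) (hs : s.Finite)
    (h : ∀ i ∉ s, f i = 0) : MLF f := fun a b =>
  LocallyFinite.of_support s hs fun i hi => by rw [h i hi]; rfl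

theorem MLF.comp_injective {f : ι → Matrix l m (MvPowerSeries σ ℂ)} (hf : MLF f) {e : κ → ι}
    (he : Function.Injective e) : MLF fun k => f (e k) :=
  fun a b => (hf a b).comp_injective he

theorem MLF.add {f g : ι → Matrix l m (MvPowerSeries σ ℂ)} (hf : MLF f) (hg : MLF g) :
    MLF fun i => f i + g i :=
  fun a b => (hf a b).add (hg a b)

theorem MLF.mul_sigma [Fintype m] {f : ι → Matrix l m (MvPowerSeries σ ℂ)}
    {g : ι → κ → Matrix m n (MvPowerSeries σ ℂ)} (hf : MLF f) (hg : ∀ i, MLF (g i)) :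
    MLF fun p : ι × κ => f p.1 * g p.1 p.2 := fun a b => by
  simp only [Matrix.mul_apply]
  refine LocallyFinite.sum _ fun c _ => ?_
  exact LocallyFinite.mul_sigma (f := fun i => f i a c) (g := fun i k => g i k c b) (hf a c)
    fun i => hg i c b

theorem MLF.mul_sigma_right [Fintype m] {f : κ → ι → Matrix l m (MvPowerSeries σ ℂ)}
    {g : κ → Matrix m n (MvPowerSeries σ ℂ)} (hf : ∀ k, MLF (f k)) (hg : MLF g) :
    MLF fun p : κ × ι => f p.1 p.2 * g p.1 := fun a b => by
  simp only [Matrix.mul_apply]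
  refine LocallyFinite.sum _ fun c _ => ?_
  simpa only [mul_comm] using
    LocallyFinite.mul_sigma (g := fun k i => f k i a c) (hg c b) fun k => hf k a c

theorem MLF.mul_right [Fintype m] {f : ι → Matrix l m (MvPowerSeries σ ℂ)} (hf : MLF f)
    (g : ι → Matrix m n (MvPowerSeries σ ℂ)) : MLF fun i => f i * g i := fun a b => by
  simp only [Matrix.mul_apply]
  exact LocallyFinite.sum _ fun c _ => (hf a c).mul_right _

theorem MLF.mul_left [Fintype l] {f : ι → Matrix l m (MvPowerSeries σ ℂ)} (hf : MLF f)
    (g : ι → Matrix n l (MvPowerSeries σ ℂ)) : MLF fun i => g i * f i := fun a b => by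
  simp only [Matrix.mul_apply]
  exact LocallyFinite.sum _ fun c _ => (hf c b).mul_left _

theorem msum_add {f g : ι → Matrix l m (MvPowerSeries σ ℂ)} (hf : MLF f) (hg : MLF g) :
    msum (fun i => f i + g i) = msum f + msum g := by
  ext1 a b
  exact formalSum_add (hf a b) (hg a b)

theorem msum_neg (f : ι → Matrix l m (MvPowerSeries σ ℂ)) :
    msum (fun i => - f i) = - msum f := by
  ext1 a b
  exact formalSum_neg _

theorem msum_zero : msum (fun _ : ι => (0 : Matrix l m (MvPowerSeries σ ℂ))) = 0 := by
  ext1 a b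
  exact formalSum_zero

theorem msum_of_support (f : ι → Matrix l m (MvPowerSeries σ ℂ)) (s : Finset ι)
    (h : ∀ i ∉ s, f i = 0) : msum f = ∑ i ∈ s, f i := by
  ext1 a b
  rw [msum_apply, Matrix.sum_apply]
  exact formalSum_of_support _ s fun i hi => by rw [h i hi]; rfl

theorem msum_eq_single (f : ι → Matrix l m (MvPowerSeries σ ℂ)) (i : ι)
    (h : ∀ j, j ≠ i → f j = 0) : msum f = f i := by
  ext1 a b
  exact formalSum_eq_single _ i fun j hj => by rw [h j hj]; rfl

theorem msum_equiv (e : κ ≃ ι) (f : ι → Matrix l m (MvPowerSeries σ ℂ)) :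
    msum (fun k => f (e k)) = msum f := by
  ext1 a b
  exact formalSum_equiv e fun i => f i a b

theorem msum_mul_left [Fintype l] (g : Matrix n l (MvPowerSeries σ ℂ))
    {f : ι → Matrix l m (MvPowerSeries σ ℂ)} (hf : MLF f) :
    msum (fun i => g * f i) = g * msum f := by
  ext1 a b
  simp only [msum_apply, Matrix.mul_apply]
  rw [formalSum_sum _ fun c _ => (hf c b).mul_left _]
  exact Finset.sum_congr rfl fun c _ => formalSum_mul_left _ (hf c b)

theorem msum_mul_right [Fintype m] (g : Matrix m n (MvPowerSeries σ ℂ))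
    {f : ι → Matrix l m (MvPowerSeries σ ℂ)} (hf : MLF f) :
    msum (fun i => f i * g) = msum f * g := by
  ext1 a b
  simp only [msum_apply, Matrix.mul_apply]
  rw [formalSum_sum _ fun c _ => (hf a c).mul_right _]
  exact Finset.sum_congr rfl fun c _ => formalSum_mul_right _ (hf a c)

theorem MLF.msum_fst {f : ι × κ → Matrix l m (MvPowerSeries σ ℂ)} (hf : MLF f) :
    MLF fun i => msum fun k => f (i, k) :=
  fun a b => (hf a b).formalSum_fst

theorem msum_prod {f : ι × κ → Matrix l m (MvPowerSeries σ ℂ)} (hf : MLF f) :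
    msum f = msum fun i => msum fun k => f (i, k) := by
  ext1 a b
  exact formalSum_prod (hf a b)

theorem msum_comm {f : ι × κ → Matrix l m (MvPowerSeries σ ℂ)} (hf : MLF f) :
    (msum fun i => msum fun k => f (i, k)) = msum fun k => msum fun i => f (i, k) := by
  rw [← msum_prod hf, ← msum_equiv (Equiv.prodComm κ ι) f]
  exact msum_prod (hf.comp_injective (Equiv.prodComm κ ι).injective)

/-! ### Convolution of sequences indexed by the integers -/

/-- The coefficients of the product of `∑ A_i z^i` and `∑ B_i z^i`. -/
def conv [Fintype m] (A : ℤ → Matrix l m (MvPowerSeries σ ℂ))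
    (B : ℤ → Matrix m n (MvPowerSeries σ ℂ)) (k : ℤ) : Matrix l n (MvPowerSeries σ ℂ) :=
  msum fun i => A i * B (k - i)

variable {r : Type*}

/-- The triple product of `∑ A_i z^i`, `∑ B_i z^i` and `∑ D_i z^i` is well defined. -/
def JLF [Fintype m] [Fintype n] (A : ℤ → Matrix l m (MvPowerSeries σ ℂ))
    (B : ℤ → Matrix m n (MvPowerSeries σ ℂ)) (D : ℤ → Matrix n r (MvPowerSeries σ ℂ)) : Prop :=
  ∀ k, MLF fun p : ℤ × ℤ => A p.1 * (B p.2 * D (k - p.1 - p.2))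

/-- Two-sided sequences do not multiply associatively in general. Joint local finiteness makes both
bracketings rearrangements of one double sum. -/
theorem conv_assoc [Fintype m] [Fintype n] {A : ℤ → Matrix l m (MvPowerSeries σ ℂ)}
    {B : ℤ → Matrix m n (MvPowerSeries σ ℂ)} {D : ℤ → Matrix n r (MvPowerSeries σ ℂ)}
    (h : JLF A B D) (hAB : ∀ k, MLF fun i => A i * B (k - i))
    (hBD : ∀ k, MLF fun i => B i * D (k - i)) :
    conv (conv A B) D = conv A (conv B D) := by
  funext k
  have h1 : conv A (conv B D) k = msum fun i => msum fun j => A i * (B j * D (k - i - j)) := by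
    unfold conv
    congr 1
    funext i
    rw [msum_mul_left _ (hBD _)]
  -- A pair (s, i), with s the index in the product of `A` and `B`, corresponds to (i, s - i).
  let e : ℤ × ℤ ≃ ℤ × ℤ :=
    { toFun := fun p => (p.2, p.1 - p.2)
      invFun := fun p => (p.1 + p.2, p.1)
      left_inv := fun p => by ext <;> simp
      right_inv := fun p => by ext <;> simp }
  have h2 : conv (conv A B) D k =
      msum fun s => msum fun i => A i * (B (s - i) * D (k - i - (s - i))) := by
    unfold conv
    congr 1
    funext s
    rw [← msum_mul_right _ (hAB _)]
    congr 1
    funext i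
    rw [Matrix.mul_assoc, sub_sub_sub_cancel_right]
  rw [h1, h2, ← msum_prod (h k), ← msum_equiv e]
  exact (msum_prod ((h k).comp_injective e.injective)).symm

theorem conv_const_left [Fintype m] [DecidableEq m] (M : Matrix l m (MvPowerSeries σ ℂ))
    (B : ℤ → Matrix m n (MvPowerSeries σ ℂ)) :
    conv (fun i => if i = 0 then M else 0) B = fun k => M * B k := by
  funext k
  unfold conv
  rw [msum_eq_single _ 0 fun j hj => by simp [hj]]
  simp

theorem conv_const_right [Fintype m] (A : ℤ → Matrix l m (MvPowerSeries σ ℂ))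
    (M : Matrix m n (MvPowerSeries σ ℂ)) :
    conv A (fun i => if i = 0 then M else 0) = fun k => A k * M := by
  funext k
  unfold conv
  rw [msum_eq_single _ k fun j hj => by simp [sub_ne_zero.2 (Ne.symm hj)]]
  simp

end MatrixSums

/-! ### Ideals of power series with vanishing coefficients -/

section Ideals

variable {σ : Type*}

/-- The ideal of power series whose coefficients vanish on a lower set of exponents. -/
def vanishIdeal (D : LowerSet (σ →₀ ℕ)) : Ideal (MvPowerSeries σ ℂ) where
  carrier := {f | ∀ d ∈ D, coeff d f = 0}
  zero_mem' := fun d _ => map_zero _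
  add_mem' := fun {f g} hf hg d hd => by rw [map_add, hf d hd, hg d hd, add_zero]
  smul_mem' := fun c f hf d hd => by
    by_contra h
    obtain ⟨a, b, hab, -, hb⟩ := exists_coeff_ne_zero_of_mul h
    exact hb (hf b (D.lower (hab ▸ le_add_self) hd))

theorem formalSum_mem_vanishIdeal {ι : Type*} {D : LowerSet (σ →₀ ℕ)}
    {f : ι → MvPowerSeries σ ℂ} (hf : ∀ i, f i ∈ vanishIdeal D) :
    formalSum f ∈ vanishIdeal D := fun d hd => by
  rw [coeff_formalSum, finsum_eq_zero_of_forall_eq_zero fun i => hf i d hd]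

/-- The ideal of power series of order at least `k`. -/
def orderIdeal (k : ℕ) : Ideal (MvPowerSeries σ ℂ) :=
  vanishIdeal ⟨{d | d.degree < k}, fun _ _ h hd => lt_of_le_of_lt (Finsupp.degree_mono h) hd⟩

theorem mem_orderIdeal {k : ℕ} {f : MvPowerSeries σ ℂ} :
    f ∈ orderIdeal k ↔ ∀ d : σ →₀ ℕ, d.degree < k → coeff d f = 0 := Iff.rfl

theorem le_degree_of_mem_orderIdeal {k : ℕ} {f : MvPowerSeries σ ℂ} (hf : f ∈ orderIdeal k)
    {d : σ →₀ ℕ} (hd : coeff d f ≠ 0) : k ≤ d.degree := by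
  by_contra h
  exact hd (hf d (not_le.1 h))

theorem formalSum_mem_orderIdeal {ι : Type*} {k : ℕ} {f : ι → MvPowerSeries σ ℂ}
    (hf : ∀ i, f i ∈ orderIdeal k) : formalSum f ∈ orderIdeal k :=
  formalSum_mem_vanishIdeal hf

theorem orderIdeal_anti {j k : ℕ} (h : j ≤ k) {f : MvPowerSeries σ ℂ} (hf : f ∈ orderIdeal k) :
    f ∈ orderIdeal j := fun d hd => hf d (lt_of_lt_of_le hd h)

theorem mem_orderIdeal_zero (f : MvPowerSeries σ ℂ) : f ∈ orderIdeal 0 :=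
  fun _ hd => absurd hd (Nat.not_lt_zero _)

theorem mem_orderIdeal_one {f : MvPowerSeries σ ℂ} :
    f ∈ orderIdeal 1 ↔ constantCoeff f = 0 := by
  rw [mem_orderIdeal]
  refine ⟨fun h => by simpa using h 0 (by simp), fun h d hd => ?_⟩
  rw [Nat.lt_one_iff, Finsupp.degree_eq_zero_iff] at hd
  simpa [hd] using h

theorem mul_mem_orderIdeal {j k : ℕ} {f g : MvPowerSeries σ ℂ} (hf : f ∈ orderIdeal j)
    (hg : g ∈ orderIdeal k) : f * g ∈ orderIdeal (j + k) := fun d hd => by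
  by_contra h
  obtain ⟨a, b, hab, ha, hb⟩ := exists_coeff_ne_zero_of_mul h
  have h1 := le_degree_of_mem_orderIdeal hf ha
  have h2 := le_degree_of_mem_orderIdeal hg hb
  have h3 : d.degree = a.degree + b.degree := by rw [← hab, map_add]
  have h4 : d.degree < j + k := hd
  omega

theorem eq_zero_of_forall_mem_orderIdeal {f : MvPowerSeries σ ℂ}
    (hf : ∀ k, f ∈ orderIdeal k) : f = 0 := by
  ext d
  exact hf (d.degree + 1) d (Nat.lt_succ_self _)

theorem X_mem_orderIdeal (s : σ) : (X s : MvPowerSeries σ ℂ) ∈ orderIdeal 1 := by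
  rw [mem_orderIdeal_one, constantCoeff_X]

theorem pderiv_mem_orderIdeal {k : ℕ} {f : MvPowerSeries σ ℂ} (hf : f ∈ orderIdeal (k + 1))
    (s : σ) : pderiv ℂ s f ∈ orderIdeal k := fun d hd => by
  rw [coeff_pderiv, hf _ (by
    show (d + Finsupp.single s 1).degree < k + 1
    rw [map_add, Finsupp.degree_single]
    exact Nat.succ_lt_succ hd), zero_mul]

theorem exists_eq_add_single {d : σ →₀ ℕ} (h : d ≠ 0) :
    ∃ (e : σ →₀ ℕ) (s : σ), d = e + Finsupp.single s 1 := by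
  obtain ⟨s, hs⟩ : ∃ s, d s ≠ 0 := by
    by_contra! h1
    exact h (Finsupp.ext h1)
  refine ⟨d - Finsupp.single s 1, s, (tsub_add_cancel_of_le ?_).symm⟩
  rw [Finsupp.single_le_iff]
  omega

theorem exponent_induction {p : (σ →₀ ℕ) → Prop} (h0 : p 0)
    (h1 : ∀ d s, p d → p (d + Finsupp.single s 1)) (d : σ →₀ ℕ) : p d := by
  induction hn : d.degree using Nat.strong_induction_on generalizing d with
  | _ n ih =>
    by_cases hd : d = 0
    · exact hd ▸ h0
    · obtain ⟨e, s, rfl⟩ := exists_eq_add_single hd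
      rw [map_add, Finsupp.degree_single] at hn
      exact h1 _ _ (ih _ (by omega) e rfl)

theorem mem_orderIdeal_of_pderiv {k : ℕ} {f : MvPowerSeries σ ℂ} (h0 : constantCoeff f = 0)
    (hf : ∀ s, pderiv ℂ s f ∈ orderIdeal k) : f ∈ orderIdeal (k + 1) := fun d hd => by
  by_cases h : d = 0
  · subst h
    simpa using h0
  · obtain ⟨e, s, rfl⟩ := exists_eq_add_single h
    have h1 := hf s e (by
      have h3 : (e + Finsupp.single s 1).degree < k + 1 := hd
      rw [map_add, Finsupp.degree_single] at h3
      exact Nat.lt_of_succ_lt_succ h3)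
    rw [coeff_pderiv] at h1
    exact (mul_eq_zero.1 h1).resolve_right (Nat.cast_add_one_ne_zero _)

/-- A map on families of power series with prescribed constant terms that increases the order of
differences has a fixed point. -/
theorem exists_fixed_point {ι : Type*} (c : ι → ℂ)
    (Φ : (ι → MvPowerSeries σ ℂ) → ι → MvPowerSeries σ ℂ)
    (h0 : ∀ a, (∀ i, constantCoeff (a i) = c i) → ∀ i, constantCoeff (Φ a i) = c i)
    (h : ∀ k a b, (∀ i, constantCoeff (a i) = c i) → (∀ i, constantCoeff (b i) = c i) →
      (∀ i, a i - b i ∈ orderIdeal k) → ∀ i, Φ a i - Φ b i ∈ orderIdeal (k + 1)) :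
    ∃ a, (∀ i, constantCoeff (a i) = c i) ∧ Φ a = a := by
  let s : ℕ → ι → MvPowerSeries σ ℂ := fun n => Φ^[n] fun i => C (c i)
  have hs : ∀ n, s (n + 1) = Φ (s n) := fun n => Function.iterate_succ_apply' Φ n _
  have hs0 : ∀ n i, constantCoeff (s n i) = c i := by
    intro n
    induction n with
    | zero => exact fun i => by simp [s]
    | succ n ih => rw [hs]; exact h0 _ ih
  have hstep : ∀ n i, s (n + 1) i - s n i ∈ orderIdeal (n + 1) := by
    intro n
    induction n with
    | zero => exact fun i => by rw [mem_orderIdeal_one, map_sub, hs0, hs0, sub_self]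
    | succ n ih => rw [hs (n + 1)]; nth_rewrite 2 [hs n]; exact h _ _ _ (hs0 _) (hs0 _) ih
  have hle : ∀ n j i, s (n + j) i - s n i ∈ orderIdeal (n + 1) := by
    intro n j i
    induction j with
    | zero => simp
    | succ j ih =>
      have := Ideal.add_mem _ (orderIdeal_anti (by omega) (hstep (n + j) i)) ih
      rwa [sub_add_sub_cancel] at this
  -- The n-th iterate is final through degree n, so each coefficient of the limit is read off the
  -- iterate numbered by its degree.
  let a : ι → MvPowerSeries σ ℂ := fun i d => coeff d (s d.degree i)
  have ha : ∀ n i, a i - s n i ∈ orderIdeal (n + 1) := by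
    intro n i d hd
    have hd' : d.degree ≤ n := Nat.lt_succ_iff.1 hd
    obtain ⟨j, rfl⟩ := Nat.exists_eq_add_of_le hd'
    have h1 := hle d.degree j i d (Nat.lt_succ_self _)
    rw [map_sub, sub_eq_zero] at h1 ⊢
    rw [h1]
    rfl
  have ha0 : ∀ i, constantCoeff (a i) = c i := fun i => by
    have h1 := orderIdeal_anti (j := 1) (by omega) (ha 0 i)
    rwa [mem_orderIdeal_one, map_sub, hs0, sub_eq_zero] at h1
  refine ⟨a, ha0, ?_⟩
  funext i
  rw [← sub_eq_zero]
  refine eq_zero_of_forall_mem_orderIdeal fun k => ?_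
  have h1 := h _ _ _ ha0 (hs0 k) (ha k) i
  rw [← hs] at h1
  have h2 := Ideal.sub_mem _ h1 (ha (k + 1) i)
  rw [sub_sub_sub_cancel_right] at h2
  exact orderIdeal_anti (by omega) h2

/-- Two fixed points of a map that increases the order of differences agree. -/
theorem eq_of_forall_orderIdeal {ι : Type*} {a b : ι → MvPowerSeries σ ℂ}
    (h : ∀ k, (∀ i, a i - b i ∈ orderIdeal k) → ∀ i, a i - b i ∈ orderIdeal (k + 1)) : a = b := by
  have h1 : ∀ k i, a i - b i ∈ orderIdeal k := by
    intro k
    induction k with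
    | zero => exact fun i => mem_orderIdeal_zero _
    | succ k ih => exact h k ih
  funext i
  exact sub_eq_zero.1 (eq_zero_of_forall_mem_orderIdeal fun k => h1 k i)

end Ideals

/-! ### Evaluation of power series at families of power series -/

section Evaluation

variable {σ τ ι κ : Type*}

/-- The monomial with exponents `m` in the entries of `y`. -/
def ypow (y : σ → MvPowerSeries τ ℂ) (m : σ →₀ ℕ) : MvPowerSeries τ ℂ :=
  m.prod fun s k => y s ^ k

theorem ypow_zero (y : σ → MvPowerSeries τ ℂ) : ypow y 0 = 1 := Finsupp.prod_zero_index

theorem ypow_add (y : σ → MvPowerSeries τ ℂ) (m n : σ →₀ ℕ) :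
    ypow y (m + n) = ypow y m * ypow y n := by
  classical
  exact Finsupp.prod_add_index' (fun s => pow_zero _) fun s a b => pow_add _ _ _

theorem ypow_single (y : σ → MvPowerSeries τ ℂ) (s : σ) : ypow y (Finsupp.single s 1) = y s := by
  simp [ypow]

theorem ypow_add_single (y : σ → MvPowerSeries τ ℂ) (m : σ →₀ ℕ) (s : σ) :
    ypow y (m + Finsupp.single s 1) = ypow y m * y s := by
  rw [ypow_add, ypow_single]

theorem ypow_mem_orderIdeal {y : σ → MvPowerSeries τ ℂ} (hy : ∀ s, y s ∈ orderIdeal 1)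
    (m : σ →₀ ℕ) : ypow y m ∈ orderIdeal m.degree := by
  induction m using exponent_induction with
  | h0 => simpa using mem_orderIdeal_zero _
  | h1 m s ih =>
    rw [ypow_add_single, map_add, Finsupp.degree_single]
    exact mul_mem_orderIdeal ih (hy s)

theorem ypow_sub_mem (J : Ideal (MvPowerSeries τ ℂ)) {y y' : σ → MvPowerSeries τ ℂ}
    (h : ∀ s, y s - y' s ∈ J) (m : σ →₀ ℕ) : ypow y m - ypow y' m ∈ J := by
  induction m using exponent_induction with
  | h0 => simp [ypow_zero]
  | h1 m s ih =>
    rw [ypow_add_single, ypow_add_single]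
    have := J.add_mem (J.mul_mem_right (y s) ih) (J.mul_mem_left (ypow y' m) (h s))
    rwa [sub_mul, mul_sub, sub_add_sub_cancel] at this

/-- Factors are exchanged one at a time: one factor becomes a difference of order k and each of the
others contributes order one. For m = 0 the difference is zero, so the truncated subtraction does no
harm. -/
theorem ypow_sub_mem_orderIdeal {k : ℕ} {y y' : σ → MvPowerSeries τ ℂ}
    (hy : ∀ s, y s ∈ orderIdeal 1) (hy' : ∀ s, y' s ∈ orderIdeal 1)
    (h : ∀ s, y s - y' s ∈ orderIdeal k) (m : σ →₀ ℕ) :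
    ypow y m - ypow y' m ∈ orderIdeal (k + m.degree - 1) := by
  induction m using exponent_induction with
  | h0 => simp [ypow_zero]
  | h1 m s ih =>
    rw [ypow_add_single, ypow_add_single, map_add, Finsupp.degree_single]
    have h1 := mul_mem_orderIdeal ih (hy s)
    have h2 := mul_mem_orderIdeal (ypow_mem_orderIdeal hy' m) (h s)
    have := Ideal.add_mem _ (orderIdeal_anti (j := k + (m.degree + 1) - 1) (by omega) h1)
      (orderIdeal_anti (j := k + (m.degree + 1) - 1) (by omega) h2)
    rwa [sub_mul, mul_sub, sub_add_sub_cancel] at this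

/-- The exponents `m` such that `y^m` has a nonzero coefficient at some exponent `≤ d`. -/
def Reach (y : σ → MvPowerSeries τ ℂ) (d : τ →₀ ℕ) : Set (σ →₀ ℕ) :=
  {m | ∃ e ≤ d, coeff e (ypow y m) ≠ 0}

/-- This is why `Reach` looks at all exponents below d: the set is then closed under passing to
divisors of a monomial, and admissibility survives products. -/
theorem Reach.of_add {y : σ → MvPowerSeries τ ℂ} {d : τ →₀ ℕ} {m n : σ →₀ ℕ}
    (h : m + n ∈ Reach y d) : m ∈ Reach y d ∧ n ∈ Reach y d := by
  obtain ⟨e, he, h⟩ := h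
  rw [ypow_add] at h
  obtain ⟨a, b, hab, ha, hb⟩ := exists_coeff_ne_zero_of_mul h
  exact ⟨⟨a, le_trans (hab ▸ le_self_add) he, ha⟩, ⟨b, le_trans (hab ▸ le_add_self) he, hb⟩⟩

/-- A family of power series in which only finitely many terms contribute to each coefficient
after evaluation at `y`. -/
def FAdm (y : σ → MvPowerSeries τ ℂ) (f : ι → MvPowerSeries σ ℂ) : Prop :=
  ∀ d, {p : ι × (σ →₀ ℕ) | p.2 ∈ Reach y d ∧ coeff p.2 (f p.1) ≠ 0}.Finite

/-- A power series that can be evaluated at `y`. -/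
def Adm (y : σ → MvPowerSeries τ ℂ) (F : MvPowerSeries σ ℂ) : Prop :=
  ∀ d, {m | m ∈ Reach y d ∧ coeff m F ≠ 0}.Finite

/-- The value of a power series at `y`. -/
def ev (y : σ → MvPowerSeries τ ℂ) (F : MvPowerSeries σ ℂ) : MvPowerSeries τ ℂ :=
  formalSum (substTerm F y)

variable {y : σ → MvPowerSeries τ ℂ}

theorem substTerm_eq (F : MvPowerSeries σ ℂ) (m : σ →₀ ℕ) :
    substTerm F y m = C (coeff m F) * ypow y m := rfl

theorem coeff_substTerm (F : MvPowerSeries σ ℂ) (m : σ →₀ ℕ) (d : τ →₀ ℕ) :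
    coeff d (substTerm F y m) = coeff m F * coeff d (ypow y m) := by
  rw [substTerm_eq, coeff_C_mul]

theorem FAdm.adm {f : ι → MvPowerSeries σ ℂ} (hf : FAdm y f) (i : ι) : Adm y (f i) := fun d =>
  ((hf d).preimage (f := fun m => (i, m)) fun a _ b _ h => by simpa using h).subset
    fun m hm => hm

theorem FAdm.of_adm [Finite ι] {f : ι → MvPowerSeries σ ℂ} (hf : ∀ i, Adm y (f i)) :
    FAdm y f := fun d =>
  (Set.finite_iUnion fun i => (hf i d).image fun m => (i, m)).subset fun p hp =>
    Set.mem_iUnion.2 ⟨p.1, p.2, hp, rfl⟩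

theorem FAdm.comp_injective {f : ι → MvPowerSeries σ ℂ} (hf : FAdm y f) {e : κ → ι}
    (he : Function.Injective e) : FAdm y fun k => f (e k) := fun d =>
  ((hf d).preimage (f := fun p : κ × (σ →₀ ℕ) => (e p.1, p.2)) (by
    rintro ⟨a, b⟩ - ⟨a', b'⟩ - h
    simp only [Prod.mk.injEq] at h
    rw [he h.1, h.2])).subset fun p hp => hp

theorem Adm.add {F G : MvPowerSeries σ ℂ} (hF : Adm y F) (hG : Adm y G) : Adm y (F + G) :=
  fun d => ((hF d).union (hG d)).subset fun m ⟨hm, h⟩ => by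
    by_contra h1
    simp only [Set.mem_union, Set.mem_ofPred_eq, hm, true_and, not_or, not_not] at h1
    exact h (by rw [map_add, h1.1, h1.2, add_zero])

theorem adm_monomial (m : σ →₀ ℕ) (c : ℂ) : Adm y (monomial m c) := fun d =>
  (Set.finite_singleton m).subset fun n hn => by
    classical
    by_contra h
    exact hn.2 (by rw [coeff_monomial, if_neg (by simpa using h)])

theorem adm_X (s : σ) : Adm y (X s) := adm_monomial _ _

theorem adm_C (c : ℂ) : Adm y (C c : MvPowerSeries σ ℂ) := adm_monomial _ _

theorem FAdm.mul_sigma {f : ι → MvPowerSeries σ ℂ} {g : ι → κ → MvPowerSeries σ ℂ}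
    (hf : FAdm y f) (hg : ∀ i, FAdm y (g i)) :
    FAdm y fun p : ι × κ => f p.1 * g p.1 p.2 := fun d => by
  refine Set.Finite.subset ((hf d).biUnion fun p _ => ((hg p.1 d).image
    fun q : κ × (σ →₀ ℕ) => ((p.1, q.1), p.2 + q.2))) ?_
  rintro ⟨⟨i, j⟩, m⟩ ⟨hm, h⟩
  obtain ⟨a, b, rfl, h1, h2⟩ := exists_coeff_ne_zero_of_mul h
  have hab := Reach.of_add hm
  simp only [Set.mem_iUnion]
  exact ⟨(i, a), ⟨hab.1, h1⟩, (j, b), ⟨hab.2, h2⟩, rfl⟩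

theorem FAdm.mul_right {f g : ι → MvPowerSeries σ ℂ} (hf : FAdm y f)
    (hg : ∀ i, Adm y (g i)) : FAdm y fun i => f i * g i :=
  (FAdm.mul_sigma (κ := Unit) (g := fun i _ => g i) hf
    fun i => FAdm.of_adm fun _ => hg i).comp_injective (e := fun i => (i, ()))
    fun a b hab => by simpa using hab

theorem FAdm.mul_left {f g : ι → MvPowerSeries σ ℂ} (hf : FAdm y f)
    (hg : ∀ i, Adm y (g i)) : FAdm y fun i => g i * f i := by
  simpa only [mul_comm] using hf.mul_right hg

theorem Adm.mul {F G : MvPowerSeries σ ℂ} (hF : Adm y F) (hG : Adm y G) : Adm y (F * G) :=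
  (FAdm.mul_right (ι := Unit) (f := fun _ => F) (g := fun _ => G) (FAdm.of_adm fun _ => hF)
    fun _ => hG).adm ()

theorem FAdm.substTerm_locallyFinite {f : ι → MvPowerSeries σ ℂ} (hf : FAdm y f) :
    LocallyFinite fun p : ι × (σ →₀ ℕ) => substTerm (f p.1) y p.2 := fun d =>
  (hf d).subset fun p hp => by
    simp only [Set.mem_ofPred_eq, coeff_substTerm] at hp
    exact ⟨⟨d, le_rfl, right_ne_zero_of_mul hp⟩, left_ne_zero_of_mul hp⟩

theorem Adm.substTerm_locallyFinite {F : MvPowerSeries σ ℂ} (hF : Adm y F) :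
    LocallyFinite (substTerm F y) :=
  (FAdm.of_adm (ι := Unit) (f := fun _ => F) fun _ => hF).substTerm_locallyFinite.fst ()

theorem FAdm.ev_locallyFinite {f : ι → MvPowerSeries σ ℂ} (hf : FAdm y f) :
    LocallyFinite fun i => ev y (f i) :=
  hf.substTerm_locallyFinite.formalSum_fst

theorem FAdm.adm_formalSum {f : ι → MvPowerSeries σ ℂ} (hf : FAdm y f) :
    Adm y (formalSum f) := fun d =>
  ((hf d).image Prod.snd).subset fun m ⟨hm, h⟩ => by
    obtain ⟨i, hi⟩ : ∃ i, coeff m (f i) ≠ 0 := by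
      by_contra! h1
      exact h (finsum_eq_zero_of_forall_eq_zero h1)
    exact ⟨(i, m), ⟨hm, hi⟩, rfl⟩

/-- Evaluation at series with constant terms need not commute with infinite sums; `FAdm` is the
finiteness of the double family that allows the interchange. -/
theorem ev_formalSum {f : ι → MvPowerSeries σ ℂ} (hf : FAdm y f) (hl : LocallyFinite f) :
    ev y (formalSum f) = formalSum fun i => ev y (f i) := by
  have h1 := hf.substTerm_locallyFinite
  have h2 : (formalSum fun i => ev y (f i)) =
      formalSum fun m => formalSum fun i => substTerm (f i) y m := by
    have h3 := formalSum_equiv (Equiv.prodComm (σ →₀ ℕ) ι) fun p => substTerm (f p.1) y p.2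
    rw [formalSum_prod h1, formalSum_prod (h1.comp_injective (Equiv.injective _))] at h3
    exact h3.symm
  rw [h2]
  unfold ev
  congr 1
  funext m
  ext d
  simp only [coeff_formalSum, coeff_substTerm]
  rw [finsum_mul' _ _ (hl m)]

theorem ev_monomial (m : σ →₀ ℕ) (c : ℂ) : ev y (monomial m c) = C c * ypow y m := by
  classical
  unfold ev
  rw [formalSum_eq_single _ m fun n hn => ?_, substTerm_eq, coeff_monomial_same]
  rw [substTerm_eq, coeff_monomial_ne hn, map_zero, zero_mul]

theorem ev_X (s : σ) : ev y (X s) = y s := by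
  rw [X_def, ev_monomial, ypow_single, map_one, one_mul]

theorem ev_C (c : ℂ) : ev y (C c : MvPowerSeries σ ℂ) = C c := by
  rw [← monomial_zero_eq_C_apply, ev_monomial, ypow_zero, mul_one]

theorem ev_one : ev y (1 : MvPowerSeries σ ℂ) = 1 := by
  simpa using ev_C (y := y) 1

theorem ev_sum [Fintype ι] {f : ι → MvPowerSeries σ ℂ} (hf : ∀ i, Adm y (f i)) :
    ev y (∑ i, f i) = ∑ i, ev y (f i) := by
  rw [← formalSum_of_fintype, ← formalSum_of_fintype]
  exact ev_formalSum (FAdm.of_adm hf) (LocallyFinite.of_finite _)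

theorem ev_add {F G : MvPowerSeries σ ℂ} (hF : Adm y F) (hG : Adm y G) :
    ev y (F + G) = ev y F + ev y G := by
  have := ev_sum (y := y) (ι := Bool) (f := fun b => if b then F else G)
    fun b => by cases b <;> simpa
  simpa using this

theorem formalSum_monomial (F : MvPowerSeries σ ℂ) :
    (LocallyFinite fun m => monomial m (coeff m F)) ∧
      formalSum (fun m => monomial m (coeff m F)) = F := by
  classical
  refine ⟨fun d => (Set.finite_singleton d).subset fun m hm => ?_, ?_⟩
  · by_contra h
    exact hm (coeff_monomial_ne (Ne.symm h) _)
  · ext d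
    rw [coeff_formalSum, finsum_eq_single _ d fun m hm => coeff_monomial_ne (Ne.symm hm) _,
      coeff_monomial_same]

theorem Adm.monomials {F : MvPowerSeries σ ℂ} (hF : Adm y F) :
    FAdm y fun m => monomial m (coeff m F) := fun d =>
  ((hF d).image fun m => (m, m)).subset fun ⟨m, n⟩ ⟨hn, h⟩ => by
    classical
    simp only [coeff_monomial] at h hn
    obtain ⟨rfl, h⟩ := ite_ne_right_iff.1 h
    exact ⟨n, ⟨hn, h⟩, rfl⟩

theorem ev_mul_formalSum {f : ι → MvPowerSeries σ ℂ} {g : κ → MvPowerSeries σ ℂ}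
    (hf : FAdm y f) (hg : FAdm y g) (hf1 : LocallyFinite f) (hg1 : LocallyFinite g)
    (h : ∀ i j, ev y (f i * g j) = ev y (f i) * ev y (g j)) :
    ev y (formalSum f * formalSum g) = ev y (formalSum f) * ev y (formalSum g) := by
  rw [formalSum_mul_formalSum hf1 hg1,
    ev_formalSum (FAdm.mul_sigma (g := fun _ => g) hf fun _ => hg) (hf1.mul hg1),
    ev_formalSum hf hf1, ev_formalSum hg hg1,
    formalSum_mul_formalSum hf.ev_locallyFinite hg.ev_locallyFinite]
  congr 1
  funext p
  exact h p.1 p.2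

/-- Both factors are expanded into monomials, for which multiplicativity is additivity of exponents.
-/
theorem ev_mul {F G : MvPowerSeries σ ℂ} (hF : Adm y F) (hG : Adm y G) :
    ev y (F * G) = ev y F * ev y G := by
  have h := ev_mul_formalSum hF.monomials hG.monomials (formalSum_monomial F).1
    (formalSum_monomial G).1 fun i j => by
      rw [monomial_mul_monomial, ev_monomial, ev_monomial, ev_monomial, ypow_add, map_mul]
      ring
  rwa [(formalSum_monomial F).2, (formalSum_monomial G).2] at h

theorem ev_ypow {w : ι → MvPowerSeries σ ℂ} (hw : ∀ i, Adm y (w i)) (m : ι →₀ ℕ) :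
    Adm y (ypow w m) ∧ ev y (ypow w m) = ypow (fun i => ev y (w i)) m := by
  induction m using exponent_induction with
  | h0 => simp only [ypow_zero]; exact ⟨by simpa using adm_C (y := y) 1, ev_one⟩
  | h1 m s ih =>
    simp only [ypow_add_single]
    exact ⟨ih.1.mul (hw s), by rw [ev_mul ih.1 (hw s), ih.2]⟩

/-- Without constant terms y^m has order at least |m|, which bounds |m| by |d|; local finiteness of
`y` then leaves finitely many variables that can occur in m. -/
theorem reach_finite (h0 : ∀ s, constantCoeff (y s) = 0) (hl : LocallyFinite y) (d : τ →₀ ℕ) :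
    (Reach y d).Finite := by
  classical
  have hS : (⋃ e ∈ Set.Iic d, {s | coeff e (y s) ≠ 0}).Finite :=
    (Set.finite_Iic d).biUnion fun e _ => hl e
  refine (Set.finite_Iic (∑ s ∈ hS.toFinset, Finsupp.single s d.degree)).subset ?_
  rintro m ⟨e, he, h⟩
  have h1 : m.degree ≤ d.degree :=
    (le_degree_of_mem_orderIdeal (ypow_mem_orderIdeal (fun s => mem_orderIdeal_one.2 (h0 s)) m)
      h).trans (Finsupp.degree_mono he)
  intro s
  by_cases hs : m s = 0
  · simp [hs]
  · have hle : Finsupp.single s 1 ≤ m := by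
      rw [Finsupp.single_le_iff]
      omega
    have hm : m ∈ Reach y d := ⟨e, he, h⟩
    rw [← tsub_add_cancel_of_le hle] at hm
    obtain ⟨e', he', h'⟩ := (Reach.of_add hm).2
    rw [ypow_single] at h'
    have hs' : s ∈ hS.toFinset := by
      rw [Set.Finite.mem_toFinset]
      exact Set.mem_biUnion he' h'
    rw [Finsupp.finsetSum_apply, Finset.sum_eq_single_of_mem s hs' fun t _ ht => by
      simp [ht], Finsupp.single_eq_same]
    exact (Finsupp.le_degree s m).trans h1

theorem FAdm.of_reach_finite (h : ∀ d, (Reach y d).Finite) {f : ι → MvPowerSeries σ ℂ}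
    (hf : LocallyFinite f) : FAdm y f := fun d =>
  ((h d).biUnion fun m _ => (hf m).image fun i => (i, m)).subset fun p ⟨h1, h2⟩ =>
    Set.mem_biUnion h1 ⟨p.1, h2, rfl⟩

theorem Adm.of_reach_finite (h : ∀ d, (Reach y d).Finite) (F : MvPowerSeries σ ℂ) : Adm y F :=
  fun d => (h d).subset fun _ hm => hm.1

end Evaluation

/-! ### Substitution of finitely many power series without constant terms -/

section Substitution

variable {ν σ τ ι : Type*} [Finite ν] {w : ν → MvPowerSeries σ ℂ}

theorem subst_eq_ev (hw : ∀ i, constantCoeff (w i) = 0) (f : MvPowerSeries ν ℂ) :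
    subst w f = ev w f := by
  ext d
  rw [coeff_subst (hasSubst_of_constantCoeff_zero hw)]
  unfold ev
  rw [coeff_formalSum]
  simp only [coeff_substTerm, smul_eq_mul]
  rfl

theorem fadm_of_locallyFinite (hw : ∀ i, constantCoeff (w i) = 0) {f : ι → MvPowerSeries ν ℂ}
    (hf : LocallyFinite f) : FAdm w f :=
  FAdm.of_reach_finite (reach_finite hw (LocallyFinite.of_finite w)) hf

theorem subst_locallyFinite (hw : ∀ i, constantCoeff (w i) = 0) {f : ι → MvPowerSeries ν ℂ}
    (hf : LocallyFinite f) : LocallyFinite fun i => subst w (f i) := by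
  simp only [subst_eq_ev hw]
  exact (fadm_of_locallyFinite hw hf).ev_locallyFinite

theorem subst_formalSum (hw : ∀ i, constantCoeff (w i) = 0) {f : ι → MvPowerSeries ν ℂ}
    (hf : LocallyFinite f) : subst w (formalSum f) = formalSum fun i => subst w (f i) := by
  simp only [subst_eq_ev hw]
  exact ev_formalSum (fadm_of_locallyFinite hw hf) hf

theorem subst_eq_formalSum (hw : ∀ i, constantCoeff (w i) = 0) (f : MvPowerSeries ν ℂ) :
    subst w f = formalSum fun m => C (coeff m f) * ypow w m := subst_eq_ev hw f

theorem locallyFinite_subst_terms (hw : ∀ i, constantCoeff (w i) = 0) (f : MvPowerSeries ν ℂ) :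
    LocallyFinite fun m => C (coeff m f) * ypow w m :=
  (Adm.of_reach_finite (reach_finite hw (LocallyFinite.of_finite w)) f).substTerm_locallyFinite

theorem subst_mem_orderIdeal (hw : ∀ i, constantCoeff (w i) = 0) {n : ℕ} {f : MvPowerSeries ν ℂ}
    (hf : f ∈ orderIdeal n) : subst w f ∈ orderIdeal n := by
  rw [subst_eq_formalSum hw]
  refine formalSum_mem_orderIdeal fun m => ?_
  by_cases h : m.degree < n
  · rw [hf m h, map_zero, zero_mul]
    exact zero_mem _
  · exact Ideal.mul_mem_left _ _ (orderIdeal_anti (not_lt.1 h)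
      (ypow_mem_orderIdeal (fun s => mem_orderIdeal_one.2 (hw s)) m))

theorem formalSum_sub {f g : ι → MvPowerSeries σ ℂ} (hf : LocallyFinite f)
    (hg : LocallyFinite g) : formalSum f - formalSum g = formalSum fun i => f i - g i := by
  ext d
  simp only [coeff_formalSum, map_sub]
  exact (finsum_sub_distrib (hf d) (hg d)).symm

theorem subst_sub_subst_mem {w' : ν → MvPowerSeries σ ℂ} (hw : ∀ i, constantCoeff (w i) = 0)
    (hw' : ∀ i, constantCoeff (w' i) = 0) (D : LowerSet (σ →₀ ℕ))
    (h : ∀ i, w i - w' i ∈ vanishIdeal D) (f : MvPowerSeries ν ℂ) :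
    subst w f - subst w' f ∈ vanishIdeal D := by
  rw [subst_eq_formalSum hw, subst_eq_formalSum hw',
    formalSum_sub (locallyFinite_subst_terms hw f) (locallyFinite_subst_terms hw' f)]
  refine formalSum_mem_vanishIdeal fun m => ?_
  rw [← mul_sub]
  exact Ideal.mul_mem_left _ _ (ypow_sub_mem _ h m)

/-- The gain of n orders makes substitution into a series of order at least two a contraction. -/
theorem subst_sub_subst_mem_orderIdeal {w' : ν → MvPowerSeries σ ℂ}
    (hw : ∀ i, constantCoeff (w i) = 0) (hw' : ∀ i, constantCoeff (w' i) = 0) {k n : ℕ}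
    (h : ∀ i, w i - w' i ∈ orderIdeal k) {f : MvPowerSeries ν ℂ} (hf : f ∈ orderIdeal (n + 1)) :
    subst w f - subst w' f ∈ orderIdeal (k + n) := by
  rw [subst_eq_formalSum hw, subst_eq_formalSum hw',
    formalSum_sub (locallyFinite_subst_terms hw f) (locallyFinite_subst_terms hw' f)]
  refine formalSum_mem_orderIdeal fun m => ?_
  rw [← mul_sub]
  by_cases hm : m.degree < n + 1
  · rw [hf m hm, map_zero, zero_mul]
    exact zero_mem _
  · exact Ideal.mul_mem_left _ _ (orderIdeal_anti (by omega)
      (ypow_sub_mem_orderIdeal (fun s => mem_orderIdeal_one.2 (hw s))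
        (fun s => mem_orderIdeal_one.2 (hw' s)) h m))

/-- Here `y` may have constant terms. Admissibility of the monomials in `w` alone suffices for every
substituted series f(w). -/
theorem ev_subst (hw : ∀ i, constantCoeff (w i) = 0) {y : σ → MvPowerSeries τ ℂ}
    (hy : FAdm y fun m => ypow w m) (h0 : ∀ i, constantCoeff (ev y (w i)) = 0)
    (f : MvPowerSeries ν ℂ) :
    Adm y (subst w f) ∧ ev y (subst w f) = subst (fun i => ev y (w i)) f := by
  have hf : FAdm y fun m => C (coeff m f) * ypow w m := hy.mul_left fun m => adm_C _
  have hwa : ∀ i, Adm y (w i) := fun i => by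
    simpa only [ypow_single] using hy.adm (Finsupp.single i 1)
  rw [subst_eq_formalSum hw]
  refine ⟨hf.adm_formalSum, ?_⟩
  rw [ev_formalSum hf (locallyFinite_subst_terms hw f), subst_eq_formalSum h0]
  congr 1
  funext m
  rw [ev_mul (adm_C _) (hy.adm m), ev_C, (ev_ypow hwa m).2]

theorem subst_zero (hs : HasSubst w) : subst w (0 : MvPowerSeries ν ℂ) = 0 := by
  rw [← coe_substAlgHom hs, map_zero]

theorem subst_one (hs : HasSubst w) : subst w (1 : MvPowerSeries ν ℂ) = 1 := by
  rw [← coe_substAlgHom hs, map_one]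

/-- The chain rule. -/
theorem pderiv_subst [Fintype ν] (hw : ∀ i, constantCoeff (w i) = 0) (f : MvPowerSeries ν ℂ)
    (s : σ) : pderiv ℂ s (subst w f) = ∑ i, subst w (pderiv ℂ i f) * pderiv ℂ s (w i) := by
  classical
  have hs := hasSubst_of_constantCoeff_zero hw
  -- The Leibniz rule settles polynomials; a general series is the locally finite sum of its
  -- monomials.
  have hpoly : ∀ p : MvPolynomial ν ℂ, pderiv ℂ s (subst w (p : MvPowerSeries ν ℂ)) =
      ∑ i, subst w (pderiv ℂ i (p : MvPowerSeries ν ℂ)) * pderiv ℂ s (w i) := by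
    intro p
    induction p using MvPolynomial.induction_on with
    | C a => simp [subst_C, subst_zero hs]
    | add p q hp hq =>
      simp only [MvPolynomial.coe_add, subst_add hs, map_add, hp, hq, add_mul,
        Finset.sum_add_distrib]
    | mul_X p j hp =>
      simp only [MvPolynomial.coe_mul, MvPolynomial.coe_X, subst_mul hs, subst_X hs,
        Derivation.leibniz, hp, smul_eq_mul, subst_add hs, add_mul, Finset.sum_add_distrib,
        pderiv_X]
      congr 1
      · rw [Finset.sum_eq_single j]
        · simp [subst_one hs]
        · intro i _ hi
          simp [subst_zero hs, Pi.single_eq_of_ne (Ne.symm hi)]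
        · simp
      · rw [Finset.mul_sum]
        exact Finset.sum_congr rfl fun i _ => by ring
  obtain ⟨hf1, hf2⟩ := formalSum_monomial f
  have hf1' := fun i => LocallyFinite.pderiv i hf1
  rw [← hf2, subst_formalSum hw hf1, pderiv_formalSum s (subst_locallyFinite hw hf1)]
  have h2 : ∀ i, subst w (pderiv ℂ i (formalSum fun m => monomial m (coeff m f))) *
      pderiv ℂ s (w i) = formalSum fun m => subst w (pderiv ℂ i (monomial m (coeff m f))) *
        pderiv ℂ s (w i) := fun i => by
    rw [pderiv_formalSum i hf1, subst_formalSum hw (hf1' i),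
      formalSum_mul_right _ (subst_locallyFinite hw (hf1' i))]
  simp only [h2]
  rw [← formalSum_sum _ fun i _ => (subst_locallyFinite hw (hf1' i)).mul_right _]
  congr 1
  funext m
  have := hpoly (MvPolynomial.monomial m (coeff m f))
  rwa [MvPolynomial.coe_monomial] at this

end Substitution

/-! ### Reindexing of formal sums -/

section MoreSums

variable {ι κ σ l m n : Type*}

theorem formalSum_injective {e : κ → ι} (he : Function.Injective e)
    (f : ι → MvPowerSeries σ ℂ) (h : ∀ i ∉ Set.range e, f i = 0) :
    formalSum (fun k => f (e k)) = formalSum f := by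
  classical
  ext d
  simp only [coeff_formalSum]
  rw [← finsum_mem_range (f := fun i => coeff d (f i)) he]
  refine finsum_congr fun i => ?_
  by_cases hi : i ∈ Set.range e
  · rw [finsum_eq_if, if_pos hi]
  · rw [finsum_eq_if, if_neg hi, h i hi, map_zero]

theorem msum_injective {e : κ → ι} (he : Function.Injective e)
    (f : ι → Matrix l m (MvPowerSeries σ ℂ)) (h : ∀ i ∉ Set.range e, f i = 0) :
    msum (fun k => f (e k)) = msum f := by
  ext1 a b
  exact formalSum_injective he (fun i => f i a b) fun i hi => by rw [h i hi]; rfl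

theorem msum_of_nonneg (f : ℤ → Matrix l m (MvPowerSeries σ ℂ)) (h : ∀ i < 0, f i = 0) :
    msum f = msum fun k : ℕ => f k := by
  refine (msum_injective Nat.cast_injective f fun i hi => h i ?_).symm
  by_contra h1
  exact hi ⟨i.toNat, Int.toNat_of_nonneg (not_lt.1 h1)⟩

theorem msum_of_nonpos (f : ℤ → Matrix l m (MvPowerSeries σ ℂ)) (h : ∀ i, 0 < i → f i = 0) :
    msum f = msum fun k : ℕ => f (-k) := by
  rw [← msum_equiv (Equiv.neg ℤ) f]
  exact msum_of_nonneg (fun i => f (-i)) fun i hi => h _ (by omega)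

theorem msum_nat_succ (f : ℕ → Matrix l m (MvPowerSeries σ ℂ)) (hf : MLF f) :
    msum f = f 0 + msum fun k => f (k + 1) := by
  have h0 : msum (fun k : ℕ => if k = 0 then f 0 else 0) = f 0 := by
    rw [msum_eq_single _ 0 fun j hj => if_neg hj, if_pos rfl]
  have h1 : msum (fun k : ℕ => if k = 0 then 0 else f k) = msum fun k => f (k + 1) := by
    rw [← msum_injective (e := Nat.succ) Nat.succ_injective]
    · rfl
    · intro i hi
      rcases i with _ | i
      · rfl
      · exact absurd ⟨i, rfl⟩ hi
  have h2 : MLF fun k : ℕ => if k = 0 then 0 else f k := fun a b d =>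
    (hf a b d).subset fun k hk => by
      by_cases h : k = 0
      · simp [h] at hk
      · simpa [h] using hk
  rw [← h1]
  nth_rewrite 1 [← h0]
  have h3 : MLF fun k : ℕ => if k = 0 then f 0 else 0 :=
    MLF.of_support {0} (Set.finite_singleton 0) fun i hi => if_neg hi
  rw [← msum_add h3 h2]
  congr 1
  funext k
  by_cases h : k = 0 <;> simp [h]

theorem MLF.ite {f : ι → Matrix l m (MvPowerSeries σ ℂ)} (hf : MLF f) (p : ι → Prop)
    [DecidablePred p] : MLF fun i => if p i then f i else 0 := fun a b d =>
  (hf a b d).subset fun i hi => by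
    by_cases h : p i
    · simpa [h] using hi
    · simp [h] at hi

end MoreSums

/-! ### Entrywise derivatives and substitutions -/

section Calculus

variable {σ ν l m n ι : Type*}

/-- The entrywise partial derivative of a matrix of power series. -/
def pdM (s : σ) (A : Matrix l m (MvPowerSeries σ ℂ)) : Matrix l m (MvPowerSeries σ ℂ) :=
  A.map (pderiv ℂ s)

theorem pdM_apply (s : σ) (A : Matrix l m (MvPowerSeries σ ℂ)) (a : l) (b : m) :
    pdM s A a b = pderiv ℂ s (A a b) := rfl

theorem pdM_mul [Fintype m] (s : σ) (A : Matrix l m (MvPowerSeries σ ℂ))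
    (B : Matrix m n (MvPowerSeries σ ℂ)) : pdM s (A * B) = pdM s A * B + A * pdM s B := by
  ext1 a b
  simp only [pdM_apply, Matrix.add_apply, Matrix.mul_apply, map_sum, Derivation.leibniz,
    smul_eq_mul, ← Finset.sum_add_distrib]
  exact Finset.sum_congr rfl fun c _ => by ring

theorem pdM_add (s : σ) (A B : Matrix l m (MvPowerSeries σ ℂ)) :
    pdM s (A + B) = pdM s A + pdM s B := by
  ext1 a b
  simp [pdM_apply]

theorem pdM_sub (s : σ) (A B : Matrix l m (MvPowerSeries σ ℂ)) :
    pdM s (A - B) = pdM s A - pdM s B := by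
  ext1 a b
  simp [pdM_apply]

theorem pdM_neg (s : σ) (A : Matrix l m (MvPowerSeries σ ℂ)) : pdM s (-A) = - pdM s A := by
  ext1 a b
  simp [pdM_apply]

theorem pdM_zero (s : σ) : pdM s (0 : Matrix l m (MvPowerSeries σ ℂ)) = 0 := by
  ext1 a b
  simp [pdM_apply]

theorem pdM_one [DecidableEq m] (s : σ) : pdM s (1 : Matrix m m (MvPowerSeries σ ℂ)) = 0 := by
  ext1 a b
  rw [pdM_apply, Matrix.one_apply]
  split <;> simp

theorem pdM_sum (s : σ) (t : Finset ι) (A : ι → Matrix l m (MvPowerSeries σ ℂ)) :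
    pdM s (∑ i ∈ t, A i) = ∑ i ∈ t, pdM s (A i) := by
  ext1 a b
  simp [pdM_apply, Matrix.sum_apply]

theorem pdM_msum (s : σ) {f : ι → Matrix l m (MvPowerSeries σ ℂ)} (hf : MLF f) :
    pdM s (msum f) = msum fun i => pdM s (f i) := by
  ext1 a b
  exact pderiv_formalSum s (hf a b)

theorem MLF.pdM (s : σ) {f : ι → Matrix l m (MvPowerSeries σ ℂ)} (hf : MLF f) :
    MLF fun i => FlatF.pdM s (f i) := fun a b => (hf a b).pderiv s

theorem pdM_comm (s t : σ) (A : Matrix l m (MvPowerSeries σ ℂ)) :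
    pdM s (pdM t A) = pdM t (pdM s A) := by
  ext1 a b
  exact pderiv_comm s t _

theorem neg_one_pow_mul_eq_smul [Fintype m] [DecidableEq m] {R : Type*} [CommRing R] (k : ℕ)
    (A : Matrix m l R) : (-1 : Matrix m m R) ^ k * A = (-1 : R) ^ k • A := by
  rcases Nat.even_or_odd k with h | h <;> simp [h.neg_one_pow]

theorem pdM_neg_one_pow_smul (s : σ) (k : ℕ) (A : Matrix l m (MvPowerSeries σ ℂ)) :
    pdM s ((-1 : MvPowerSeries σ ℂ) ^ k • A) = (-1 : MvPowerSeries σ ℂ) ^ k • pdM s A := by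
  rcases Nat.even_or_odd k with h | h <;> simp [h.neg_one_pow, pdM_neg]

/-- Entrywise substitution in a matrix of power series. -/
def substM (w : ν → MvPowerSeries σ ℂ) (A : Matrix l m (MvPowerSeries ν ℂ)) :
    Matrix l m (MvPowerSeries σ ℂ) := A.map (subst w)

theorem substM_apply (w : ν → MvPowerSeries σ ℂ) (A : Matrix l m (MvPowerSeries ν ℂ)) (a : l)
    (b : m) : substM w A a b = subst w (A a b) := rfl

variable [Finite ν] {w : ν → MvPowerSeries σ ℂ}

theorem substM_eq (hw : ∀ i, constantCoeff (w i) = 0) (A : Matrix l m (MvPowerSeries ν ℂ)) :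
    substM w A = A.map (substAlgHom (hasSubst_of_constantCoeff_zero hw) : _ →ₐ[ℂ] _) := by
  ext1 a b
  simp [substM_apply, coe_substAlgHom]

theorem substM_mul [Fintype m] (hw : ∀ i, constantCoeff (w i) = 0)
    (A : Matrix l m (MvPowerSeries ν ℂ)) (B : Matrix m n (MvPowerSeries ν ℂ)) :
    substM w (A * B) = substM w A * substM w B := by
  simp only [substM_eq hw]
  exact Matrix.map_mul

theorem substM_add (hw : ∀ i, constantCoeff (w i) = 0) (A B : Matrix l m (MvPowerSeries ν ℂ)) :
    substM w (A + B) = substM w A + substM w B := by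
  ext1 a b
  exact subst_add (hasSubst_of_constantCoeff_zero hw) _ _

theorem substM_zero (hw : ∀ i, constantCoeff (w i) = 0) :
    substM w (0 : Matrix l m (MvPowerSeries ν ℂ)) = 0 := by
  ext1 a b
  exact subst_zero (hasSubst_of_constantCoeff_zero hw)

theorem substM_one [DecidableEq m] (hw : ∀ i, constantCoeff (w i) = 0) :
    substM w (1 : Matrix m m (MvPowerSeries ν ℂ)) = 1 := by
  rw [substM_eq hw]
  exact Matrix.map_one _ (map_zero _) (map_one _)

theorem substM_sum (hw : ∀ i, constantCoeff (w i) = 0) (t : Finset ι)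
    (A : ι → Matrix l m (MvPowerSeries ν ℂ)) :
    substM w (∑ i ∈ t, A i) = ∑ i ∈ t, substM w (A i) := by
  simp only [substM_eq hw]
  ext1 a b
  simp only [Matrix.map_apply, Matrix.sum_apply, map_sum]

theorem substM_neg_one_pow_smul (hw : ∀ i, constantCoeff (w i) = 0) (k : ℕ)
    (A : Matrix l m (MvPowerSeries ν ℂ)) :
    substM w ((-1 : MvPowerSeries ν ℂ) ^ k • A) = (-1 : MvPowerSeries σ ℂ) ^ k • substM w A := by
  simp only [substM_eq hw]
  ext1 a b
  simp only [Matrix.map_apply, Matrix.smul_apply, smul_eq_mul, map_mul, map_pow, map_neg, map_one]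

theorem substM_mapC (A : Matrix l m ℂ) :
    substM w (A.map C : Matrix l m (MvPowerSeries ν ℂ)) = A.map C := by
  ext1 a b
  exact subst_C _

theorem substM_msum (hw : ∀ i, constantCoeff (w i) = 0)
    {f : ι → Matrix l m (MvPowerSeries ν ℂ)} (hf : MLF f) :
    (MLF fun i => substM w (f i)) ∧ substM w (msum f) = msum fun i => substM w (f i) :=
  ⟨fun a b => subst_locallyFinite hw (hf a b), by
    ext1 a b
    exact subst_formalSum hw (hf a b)⟩

theorem pdM_substM [Fintype ν] (hw : ∀ i, constantCoeff (w i) = 0)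
    (A : Matrix l m (MvPowerSeries ν ℂ)) (s : σ) :
    pdM s (substM w A) = ∑ i, pderiv ℂ s (w i) • substM w (pdM i A) := by
  ext1 a b
  simp only [pdM_apply, substM_apply, Matrix.sum_apply, Matrix.smul_apply, smul_eq_mul]
  rw [pderiv_subst hw]
  exact Finset.sum_congr rfl fun i _ => mul_comm _ _

theorem pdM_mapC (s : σ) (A : Matrix l m ℂ) :
    pdM s (A.map C : Matrix l m (MvPowerSeries σ ℂ)) = 0 := by
  ext1 a b
  exact pderiv_C

end Calculus

/-! ### Power series with matrix coefficients -/

section MatrixSeries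

variable {σ ν n : Type*} [Fintype n] [DecidableEq n]

/-- The coefficientwise partial derivative of a power series in `z`. -/
def pdS (s : σ) (P : PowerSeries (Matrix n n (MvPowerSeries σ ℂ))) :
    PowerSeries (Matrix n n (MvPowerSeries σ ℂ)) :=
  PowerSeries.mk fun k => pdM s (PowerSeries.coeff k P)

theorem coeff_pdS (s : σ) (P : PowerSeries (Matrix n n (MvPowerSeries σ ℂ))) (k : ℕ) :
    PowerSeries.coeff k (pdS s P) = pdM s (PowerSeries.coeff k P) := PowerSeries.coeff_mk _ _

theorem pdS_mul (s : σ) (P Q : PowerSeries (Matrix n n (MvPowerSeries σ ℂ))) :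
    pdS s (P * Q) = pdS s P * Q + P * pdS s Q := by
  ext1 k
  simp only [coeff_pdS, PowerSeries.coeff_mul, map_add, pdM_sum, pdM_mul,
    Finset.sum_add_distrib]

theorem pdS_one (s : σ) : pdS s (1 : PowerSeries (Matrix n n (MvPowerSeries σ ℂ))) = 0 := by
  ext1 k
  rw [coeff_pdS, PowerSeries.coeff_one]
  split <;> simp [pdM_one, pdM_zero]

/-- Coefficientwise substitution in a power series in `z`. -/
def smap (w : ν → MvPowerSeries σ ℂ) (P : PowerSeries (Matrix n n (MvPowerSeries ν ℂ))) :
    PowerSeries (Matrix n n (MvPowerSeries σ ℂ)) :=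
  PowerSeries.mk fun k => substM w (PowerSeries.coeff k P)

theorem coeff_smap (w : ν → MvPowerSeries σ ℂ)
    (P : PowerSeries (Matrix n n (MvPowerSeries ν ℂ))) (k : ℕ) :
    PowerSeries.coeff k (smap w P) = substM w (PowerSeries.coeff k P) := PowerSeries.coeff_mk _ _

theorem smap_mul [Finite ν] {w : ν → MvPowerSeries σ ℂ} (hw : ∀ i, constantCoeff (w i) = 0)
    (P Q : PowerSeries (Matrix n n (MvPowerSeries ν ℂ))) :
    smap w (P * Q) = smap w P * smap w Q := by
  ext1 k
  simp only [coeff_smap, PowerSeries.coeff_mul, substM_sum hw, substM_mul hw]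

theorem smap_one [Finite ν] {w : ν → MvPowerSeries σ ℂ} (hw : ∀ i, constantCoeff (w i) = 0) :
    smap w (1 : PowerSeries (Matrix n n (MvPowerSeries ν ℂ))) = 1 := by
  ext1 k
  rw [coeff_smap, PowerSeries.coeff_one, PowerSeries.coeff_one]
  split <;> simp [substM_one hw, substM_zero hw]

/-- The substitution `z ↦ -z`. -/
def altS {R : Type*} [CommRing R] (P : PowerSeries (Matrix n n R)) :
    PowerSeries (Matrix n n R) :=
  PowerSeries.mk fun k => (-1 : R) ^ k • PowerSeries.coeff k P

theorem coeff_altS {R : Type*} [CommRing R] (P : PowerSeries (Matrix n n R)) (k : ℕ) :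
    PowerSeries.coeff k (altS P) = (-1 : R) ^ k • PowerSeries.coeff k P :=
  PowerSeries.coeff_mk _ _

theorem altS_mul {R : Type*} [CommRing R] (P Q : PowerSeries (Matrix n n R)) :
    altS (P * Q) = altS P * altS Q := by
  ext1 k
  simp only [coeff_altS, PowerSeries.coeff_mul, Finset.smul_sum]
  refine Finset.sum_congr rfl fun p hp => ?_
  rw [← Finset.HasAntidiagonal.mem_antidiagonal.1 hp, pow_add, Matrix.smul_mul, Matrix.mul_smul,
    smul_smul]

theorem altS_one {R : Type*} [CommRing R] : altS (1 : PowerSeries (Matrix n n R)) = 1 := by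
  ext1 k
  rw [coeff_altS, PowerSeries.coeff_one]
  split
  · simp_all
  · simp

/-- A power series in `z` as a sequence indexed by the integers. -/
def posSeq {R : Type*} [CommRing R] (P : PowerSeries (Matrix n n R)) (i : ℤ) : Matrix n n R :=
  if 0 ≤ i then PowerSeries.coeff i.toNat P else 0

/-- A power series in `z⁻¹` as a sequence indexed by the integers. -/
def negSeq {R : Type*} [CommRing R] (P : PowerSeries (Matrix n n R)) (i : ℤ) : Matrix n n R :=
  if i ≤ 0 then PowerSeries.coeff (-i).toNat P else 0

theorem posSeq_of_neg {R : Type*} [CommRing R] (P : PowerSeries (Matrix n n R)) {i : ℤ}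
    (h : i < 0) : posSeq P i = 0 := if_neg (by omega)

theorem negSeq_of_pos {R : Type*} [CommRing R] (P : PowerSeries (Matrix n n R)) {i : ℤ}
    (h : 0 < i) : negSeq P i = 0 := if_neg (by omega)

theorem posSeq_natCast {R : Type*} [CommRing R] (P : PowerSeries (Matrix n n R)) (k : ℕ) :
    posSeq P k = PowerSeries.coeff k P := by
  rw [posSeq, if_pos (by omega), Int.toNat_natCast]

theorem negSeq_neg_natCast {R : Type*} [CommRing R] (P : PowerSeries (Matrix n n R)) (k : ℕ) :
    negSeq P (-k) = PowerSeries.coeff k P := by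
  rw [negSeq, if_pos (by omega), neg_neg, Int.toNat_natCast]

theorem conv_posSeq (P Q : PowerSeries (Matrix n n (MvPowerSeries σ ℂ))) :
    conv (posSeq P) (posSeq Q) = posSeq (P * Q) := by
  funext k
  unfold conv
  by_cases hk : 0 ≤ k
  · obtain ⟨k, rfl⟩ := Int.eq_ofNat_of_zero_le hk
    rw [posSeq_natCast, PowerSeries.coeff_mul, Finset.Nat.sum_antidiagonal_eq_sum_range_succ_mk,
      msum_of_nonneg _ fun i hi => by rw [posSeq_of_neg P hi, zero_mul],
      msum_of_support _ (Finset.range (k + 1))]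
    · refine Finset.sum_congr rfl fun i hi => ?_
      have hi := Finset.mem_range.1 hi
      rw [posSeq_natCast, ← Int.ofNat_sub (by omega), posSeq_natCast]
    · intro i hi
      have hi := mt Finset.mem_range.2 hi
      rw [posSeq_of_neg Q (by omega), mul_zero]
  · rw [posSeq_of_neg _ (not_le.1 hk), ← msum_zero (ι := ℤ)]
    congr 1
    funext i
    by_cases hi : i < 0
    · rw [posSeq_of_neg P hi, zero_mul]
    · rw [posSeq_of_neg Q (by omega), mul_zero]

theorem negSeq_neg {R : Type*} [CommRing R] (P : PowerSeries (Matrix n n R)) (i : ℤ) :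
    negSeq P (-i) = posSeq P i := by
  simp [negSeq, posSeq]

theorem conv_negSeq (P Q : PowerSeries (Matrix n n (MvPowerSeries σ ℂ))) :
    conv (negSeq P) (negSeq Q) = negSeq (P * Q) := by
  funext k
  have h := congrFun (conv_posSeq P Q) (-k)
  rw [← negSeq_neg, neg_neg] at h
  rw [← h]
  unfold conv
  rw [← msum_equiv (Equiv.neg ℤ)]
  congr 1
  funext i
  rw [← negSeq_neg, ← negSeq_neg, Equiv.neg_apply, neg_sub, sub_neg_eq_add, add_comm,
    sub_neg_eq_add, add_comm]

theorem negSeq_one_conv {l : Type*} (B : ℤ → Matrix n l (MvPowerSeries σ ℂ)) :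
    conv (negSeq 1) B = B := by
  have h : negSeq (1 : PowerSeries (Matrix n n (MvPowerSeries σ ℂ))) =
      fun i => if i = 0 then 1 else 0 := by
    funext i
    rw [negSeq, PowerSeries.coeff_one]
    split_ifs <;> first | rfl | omega
  rw [h, conv_const_left]
  simp

end MatrixSeries

/-! ### Column vectors and matrices of multiplication operators -/

/-- The column with the given entries. -/
def col {ι R : Type*} (v : ι → R) : Matrix ι Unit R := Matrix.of fun i _ => v i

theorem col_apply {ι R : Type*} (v : ι → R) (i : ι) (u : Unit) : col v i u = v i := rfl

theorem col_injective {ι R : Type*} {v w : ι → R} (h : col v = col w) : v = w := by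
  funext i
  exact congrFun (congrFun h i) ()

/-- A constant column. -/
def colC {ι : Type*} (σ : Type*) (v : ι → ℂ) : Matrix ι Unit (MvPowerSeries σ ℂ) := col fun i => C (v i)

theorem colC_apply {ι : Type*} (σ : Type*) (v : ι → ℂ) (i : ι) (u : Unit) :
    colC σ v i u = C (v i) := rfl

/-- A coordinate column. -/
def evec {ι : Type*} (σ : Type*) [DecidableEq ι] (i : ι) : Matrix ι Unit (MvPowerSeries σ ℂ) :=
  col (Pi.single i 1)

namespace FlatFManifold

variable {N : ℕ} (X : FlatFManifold N)

theorem c_comm (α β γ : Fin N) : X.c α β γ = X.c α γ β := pderiv_comm _ _ _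

/-- The matrix of multiplication by `∂/∂t^γ`. -/
def Cmat (γ : Fin N) : Matrix (Fin N) (Fin N) (Fun N) := Matrix.of fun μ β => X.c μ γ β

theorem Cmat_apply (γ μ β : Fin N) : X.Cmat γ μ β = X.c μ γ β := rfl

theorem Cmat_comm (β γ : Fin N) : X.Cmat β * X.Cmat γ = X.Cmat γ * X.Cmat β := by
  ext1 α δ
  simp only [Matrix.mul_apply, Cmat_apply]
  exact FlatFManifold.assoc_axiom X α β γ δ

theorem sum_unit_c (α β : Fin N) :
    ∑ μ, C (X.unit μ) * X.c α μ β = if α = β then 1 else 0 := FlatFManifold.unit_axiom X α β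

theorem pdM_Cmat (β γ : Fin N) : pdM β (X.Cmat γ) = pdM γ (X.Cmat β) := by
  ext1 α δ
  simp only [pdM_apply, Cmat_apply, c]
  exact pderiv_comm _ _ _

variable {σ : Type*} (w : Fin N → MvPowerSeries σ ℂ)

/-- The matrix of multiplication by the vector `u`, with the structure constants evaluated
at `w`. -/
def Cw (u : Fin N → MvPowerSeries σ ℂ) : Matrix (Fin N) (Fin N) (MvPowerSeries σ ℂ) :=
  ∑ γ, u γ • substM w (X.Cmat γ)

theorem Cw_apply (u : Fin N → MvPowerSeries σ ℂ) (α β : Fin N) :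
    X.Cw w u α β = ∑ γ, u γ * subst w (X.c α γ β) := by
  simp [Cw, Matrix.sum_apply, substM_apply, Cmat_apply]

theorem Cw_mul_col (u v : Fin N → MvPowerSeries σ ℂ) :
    X.Cw w u * col v = X.Cw w v * col u := by
  ext1 α _
  simp only [Matrix.mul_apply, Cw_apply, col_apply, Finset.sum_mul]
  rw [Finset.sum_comm]
  refine Finset.sum_congr rfl fun β _ => Finset.sum_congr rfl fun γ _ => ?_
  rw [X.c_comm]
  ring

variable {w}

theorem Cw_comm (hw : ∀ i, constantCoeff (w i) = 0) (u v : Fin N → MvPowerSeries σ ℂ) :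
    X.Cw w u * X.Cw w v = X.Cw w v * X.Cw w u := by
  simp only [Cw, Finset.sum_mul, Finset.mul_sum]
  rw [Finset.sum_comm]
  refine Finset.sum_congr rfl fun β _ => Finset.sum_congr rfl fun γ _ => ?_
  simp only [Matrix.smul_mul, Matrix.mul_smul]
  rw [← substM_mul hw, ← substM_mul hw, X.Cmat_comm, smul_comm]

theorem Cw_mul_unit (hw : ∀ i, constantCoeff (w i) = 0) (u : Fin N → MvPowerSeries σ ℂ) :
    X.Cw w u * colC σ X.unit = col u := by
  rw [colC, X.Cw_mul_col w u]
  have h : X.Cw w (fun α => C (X.unit α)) = 1 := by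
    have h1 : X.Cw w (fun α => C (X.unit α)) =
        substM w (Matrix.of fun α β => ∑ μ, C (X.unit μ) * X.c α μ β) := by
      ext1 α β
      have hs := hasSubst_of_constantCoeff_zero hw
      rw [Cw_apply, substM_apply, Matrix.of_apply, ← coe_substAlgHom hs, map_sum]
      refine Finset.sum_congr rfl fun γ _ => ?_
      rw [map_mul, coe_substAlgHom, subst_C]
    rw [h1, ← substM_one hw]
    congr 1
    ext1 α β
    rw [Matrix.of_apply, X.sum_unit_c, Matrix.one_apply]
  rw [h, Matrix.one_mul]

end FlatFManifold

/-! ### Derivatives of the calibration, and the Euler–Lagrange equation -/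

namespace FlatFManifold.Calibration

variable {N : ℕ} {X : FlatFManifold N} (Ω : X.Calibration)

theorem pdM_mat_zero (γ : Fin N) : pdM γ (Ω.mat 0) = 0 := by rw [Ω.mat_zero, pdM_one]

theorem pdM_mat_succ (d : ℕ) (γ : Fin N) : pdM γ (Ω.mat (d + 1)) = Ω.mat d * X.Cmat γ := by
  ext1 α β
  rw [pdM_apply, Ω.deriv, Matrix.mul_apply]
  exact Finset.sum_congr rfl fun μ _ => mul_comm _ _

theorem constantCoeff_series :
    PowerSeries.constantCoeff Ω.series = ((1 : (Matrix (Fin N) (Fin N) (Fun N))ˣ) : _) := by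
  simp [series, Ω.mat_zero, ← PowerSeries.coeff_zero_eq_constantCoeff_apply]

theorem pdS_series (γ : Fin N) :
    pdS γ Ω.series = PowerSeries.X * (Ω.series * PowerSeries.C (X.Cmat γ)) := by
  ext1 k
  rw [coeff_pdS, series, PowerSeries.coeff_mk]
  rcases k with _ | k
  · rw [PowerSeries.coeff_zero_X_mul, pdM_mat_zero]
  · rw [PowerSeries.coeff_succ_X_mul, PowerSeries.coeff_mul_C, PowerSeries.coeff_mk,
      pdM_mat_succ]

/-- Write I for the inverse series. Differentiating I Ω = Id gives ∂I = -I (∂Ω) I, and in I (z Ω C)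
I the factor I Ω cancels. -/
theorem pdS_inv (γ : Fin N) : pdS γ (PowerSeries.invOfUnit Ω.series 1) =
    -(PowerSeries.X * (PowerSeries.C (X.Cmat γ) * PowerSeries.invOfUnit Ω.series 1)) := by
  set I := PowerSeries.invOfUnit Ω.series 1
  have h1 : I * Ω.series = 1 := PowerSeries.invOfUnit_mul _ _ Ω.constantCoeff_series
  have h2 : Ω.series * I = 1 := PowerSeries.mul_invOfUnit _ _ Ω.constantCoeff_series
  have h3 := congrArg (pdS γ) h1
  rw [pdS_mul, pdS_one, pdS_series] at h3
  have h4 := congrArg (· * I) h3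
  simp only [add_mul, mul_assoc, h2, mul_one, zero_mul] at h4
  rw [← mul_assoc, ← PowerSeries.X_mul, mul_assoc, ← mul_assoc I, h1, one_mul] at h4
  exact eq_neg_of_add_eq_zero_left h4

/-- The series `∑_d Ω^0_{d-1} z^d`. -/
def lowerSeries : PowerSeries (Matrix (Fin N) (Fin N) (Fun N)) := PowerSeries.mk Ω.lower

theorem lowerSeries_eq : Ω.lowerSeries = altS (PowerSeries.invOfUnit Ω.series 1) := by
  ext1 d
  rw [lowerSeries, PowerSeries.coeff_mk, coeff_altS, lower, neg_one_pow_mul_eq_smul]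

theorem lowerSeries_mul : Ω.lowerSeries * altS Ω.series = 1 := by
  rw [lowerSeries_eq, ← altS_mul, PowerSeries.invOfUnit_mul _ _ Ω.constantCoeff_series, altS_one]

theorem mul_lowerSeries : altS Ω.series * Ω.lowerSeries = 1 := by
  rw [lowerSeries_eq, ← altS_mul, PowerSeries.mul_invOfUnit _ _ Ω.constantCoeff_series, altS_one]

theorem pdM_lower_succ (d : ℕ) (γ : Fin N) :
    pdM γ (Ω.lower (d + 1)) = X.Cmat γ * Ω.lower d := by
  have h := congrArg (PowerSeries.coeff (d + 1)) (Ω.pdS_inv γ)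
  rw [coeff_pdS, map_neg, PowerSeries.coeff_succ_X_mul, PowerSeries.coeff_C_mul] at h
  simp only [lower, neg_one_pow_mul_eq_smul]
  rw [pdM_neg_one_pow_smul, h, pow_succ]
  simp

theorem lower_zero : Ω.lower 0 = 1 := by
  have h := congrArg (PowerSeries.coeff 0) Ω.lowerSeries_mul
  rw [PowerSeries.coeff_mul] at h
  simpa [lowerSeries, coeff_altS, series, Ω.mat_zero] using h

theorem pdM_lower_zero (γ : Fin N) : pdM γ (Ω.lower 0) = 0 := by rw [lower_zero, pdM_one]

theorem lower_one : Ω.lower 1 = Ω.mat 1 := by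
  have h := congrArg (PowerSeries.coeff 1) Ω.lowerSeries_mul
  rw [PowerSeries.coeff_mul, Finset.Nat.antidiagonal_succ] at h
  simp [lowerSeries, coeff_altS, series, Ω.mat_zero, lower_zero, PowerSeries.coeff_one] at h
  exact (neg_add_eq_zero.1 h).symm

theorem pdM_two (p q : ℕ) (γ : Fin N) :
    pdM γ (Ω.two p q) = Ω.mat p * (X.Cmat γ * Ω.lower q) := by
  -- The Leibniz rule writes the derivative of the i-th summand as g(i+1) - g(i). The sum telescopes
  -- and only g(q+1), where the sign is +1, survives.
  let g : ℕ → Matrix (Fin N) (Fin N) (Fun N) := fun i =>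
    if i = 0 then 0 else (-1 : Fun N) ^ (q - (i - 1)) •
      (Ω.mat (p + (q - (i - 1))) * (X.Cmat γ * Ω.lower (i - 1)))
  have h1 : pdM γ (Ω.two p q) = ∑ i ∈ Finset.range (q + 1), (g (i + 1) - g i) := by
    rw [two, pdM_sum]
    refine Finset.sum_congr rfl fun i hi => ?_
    have hi := Finset.mem_range.1 hi
    rw [neg_one_pow_mul_eq_smul, pdM_neg_one_pow_smul, pdM_mul, pdM_mat_succ]
    rcases i with _ | i
    · simp [g, pdM_lower_zero, mul_assoc]
    · have h2 : q - i = q - (i + 1) + 1 := by omega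
      simp only [g, pdM_lower_succ, if_neg (Nat.succ_ne_zero _), Nat.add_sub_cancel, h2, pow_succ]
      rw [smul_add, mul_assoc]
      simp [← add_assoc]
  rw [h1, Finset.sum_range_sub]
  simp [g]

/-! ### The Euler–Lagrange equation and the principal hierarchy -/

/-- The germ over the base point of the cone with zero potentials. -/
def origin : GraphGerm N := ⟨Ω.shiftedOrig, X.unit, 0⟩

/-- The coordinate vector `q_b`. -/
def qv (b : ℕ) : Matrix (Fin N) Unit (BigFun N) := col (Ω.origin.q b)

/-- The genus-zero Euler–Lagrange equation `∑_k Ω^0_{k-1}(w) q_k = 0`. -/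
def IsEulerLagrange (w : Fin N → BigFun N) : Prop :=
  (∀ α, constantCoeff (w α) = 0) ∧ msum (fun k => substM w (Ω.lower k) * Ω.qv k) = 0

theorem locallyFinite_X {σ : Type*} :
    LocallyFinite fun s : σ => (MvPowerSeries.X s : MvPowerSeries σ ℂ) := fun d => by
  classical
  by_cases h : ∃ s, d = Finsupp.single s 1
  · obtain ⟨s, rfl⟩ := h
    refine (Set.finite_singleton s).subset fun t ht => ?_
    by_contra hts
    refine ht ?_
    rw [coeff_X, if_neg]
    intro h
    exact hts (Finsupp.single_left_injective one_ne_zero h).symm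
  · refine Set.finite_empty.subset fun t ht => ht ?_
    rw [coeff_X, if_neg fun h1 => h ⟨t, h1⟩]

/-- The coordinate vector `t_b`, centred at the base point. -/
def xv (N b : ℕ) : Matrix (Fin N) Unit (BigFun N) := col fun β => MvPowerSeries.X (β, b)

/-- The coordinates of the base point. -/
def bv (σ : Type*) (b : ℕ) : Matrix (Fin N) Unit (MvPowerSeries σ ℂ) :=
  colC σ (Ω.origin.basePoint b)

theorem qv_eq (b : ℕ) : Ω.qv b = xv N b + Ω.bv _ b := rfl

theorem mlf_xv : MLF (xv N) := fun β _ =>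
  locallyFinite_X.comp_injective (e := fun b : ℕ => (β, b)) fun a b h => by simpa using h

theorem bv_eq_zero {σ : Type*} {b : ℕ} (hb : 2 ≤ b) : Ω.bv σ b = 0 := by
  ext1 β _
  simp only [bv, colC_apply, GraphGerm.basePoint]
  rw [if_neg (by omega), if_neg (by omega)]
  simp

theorem mlf_bv {σ : Type*} : MLF (Ω.bv σ) := MLF.of_support (Set.Iio 2) (Set.finite_Iio 2) fun b hb =>
  Ω.bv_eq_zero (not_lt.1 hb)

theorem mlf_qv : MLF Ω.qv := mlf_xv.add Ω.mlf_bv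

/-- The unit axiom gives both sides the same derivatives, and `shiftedOrig` is by definition the
constant term of the left side. -/
theorem mat_one_mul_unit : Ω.mat 1 * colC (Fin N) X.unit =
    (col fun α => MvPowerSeries.X α + C (Ω.shiftedOrig α) :
      Matrix (Fin N) Unit (Fun N)) := by
  ext1 α _
  rw [Matrix.mul_apply, col_apply]
  simp only [colC_apply]
  refine pderiv.ext (fun γ => ?_) ?_
  · rw [map_sum, map_add, pderiv_C, add_zero]
    simp only [Derivation.leibniz, pderiv_C, Ω.deriv 0, Ω.mat_zero,
      smul_eq_mul]
    have h1 : ∀ β, ∑ μ, X.c μ γ β * (1 : Matrix (Fin N) (Fin N) (Fun N)) α μ = X.c α β γ := by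
      intro β
      rw [Finset.sum_eq_single α (fun μ _ h => by rw [Matrix.one_apply_ne h.symm, mul_zero])
        (by simp), Matrix.one_apply_eq, mul_one, X.c_comm]
    simp only [h1, mul_zero, zero_add]
    rw [X.sum_unit_c]
    split_ifs with h
    · rw [h, pderiv_X_self]
    · rw [pderiv_X_of_ne h]
  · rw [map_add, constantCoeff_X, zero_add, constantCoeff_C, shiftedOrig]

variable {w : Fin N → BigFun N}

/-- The base point contributes only at b = 0 and b = 1, by (t_orig + c) - Ω^0_0(w) A = -w. The
Euler–Lagrange equation thereby becomes a fixed-point equation for w. The vectors `x` are arbitrary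
because displaced points need the same formula. -/
theorem lower_sum {σ : Type*} {w : Fin N → MvPowerSeries σ ℂ}
    (hw : ∀ α, constantCoeff (w α) = 0) {x : ℕ → Matrix (Fin N) Unit (MvPowerSeries σ ℂ)}
    (hx : MLF fun k => substM w (Ω.lower k) * x k) :
    msum (fun k => substM w (Ω.lower k) * (x k + Ω.bv σ k)) =
      x 0 + msum (fun k => substM w (Ω.lower (k + 1)) * x (k + 1)) - col w := by
  have hs := hasSubst_of_constantCoeff_zero hw
  have h1 : msum (fun k => substM w (Ω.lower k) * Ω.bv σ k) = - col w := by
    rw [msum_of_support _ (Finset.range 2) fun i hi => by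
      rw [Ω.bv_eq_zero (not_lt.1 (mt Finset.mem_range.2 hi)), Matrix.mul_zero], Finset.sum_range_succ,
      Finset.sum_range_one, lower_zero, lower_one, substM_one hw, Matrix.one_mul]
    have h2 : Ω.bv σ 1 = - substM w (colC (Fin N) X.unit) := by
      ext1 β _
      rw [Matrix.neg_apply, substM_apply, colC_apply, subst_C]
      simp [bv, colC_apply, GraphGerm.basePoint, origin]
    rw [h2, Matrix.mul_neg, ← substM_mul hw, mat_one_mul_unit]
    ext1 β _
    rw [Matrix.add_apply, Matrix.neg_apply, Matrix.neg_apply, substM_apply, col_apply, col_apply,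
      subst_add hs, subst_X hs, subst_C]
    simp [bv, colC_apply, GraphGerm.basePoint, origin]
  simp only [Matrix.mul_add]
  rw [msum_add hx (Ω.mlf_bv.mul_left _), h1, msum_nat_succ _ hx, lower_zero, substM_one hw,
    Matrix.one_mul, sub_eq_add_neg]

theorem eulerLagrange_sum (hw : ∀ α, constantCoeff (w α) = 0) :
    msum (fun k => substM w (Ω.lower k) * Ω.qv k) =
      xv N 0 + msum (fun k => substM w (Ω.lower (k + 1)) * xv N (k + 1)) - col w := by
  simp only [qv_eq]
  exact Ω.lower_sum hw (mlf_xv.mul_left _)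

theorem constantCoeff_msum_mul_xv (A : ℕ → Matrix (Fin N) (Fin N) (BigFun N)) (α : Fin N) :
    constantCoeff (msum (fun k => A k * xv N (k + 1)) α ()) = 0 := by
  rw [← mem_orderIdeal_one]
  refine formalSum_mem_orderIdeal fun k => ?_
  beta_reduce
  rw [Matrix.mul_apply]
  exact sum_mem fun β _ => Ideal.mul_mem_left _ _ (X_mem_orderIdeal _)

/-- On the right side of the fixed-point equation every function of w is multiplied by some variable
t_{k+1}, so the right side is a contraction for the order. -/
theorem exists_isEulerLagrange : ∃ w, Ω.IsEulerLagrange w := by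
  let Φ : (Fin N → BigFun N) → Fin N → BigFun N := fun w α =>
    (xv N 0 + msum fun k => substM w (Ω.lower (k + 1)) * xv N (k + 1)) α ()
  have h0 : ∀ w α, constantCoeff (Φ w α) = 0 := fun w α => by
    simp only [Φ]
    rw [Matrix.add_apply, map_add, constantCoeff_msum_mul_xv, add_zero, xv, col_apply,
      constantCoeff_X]
  have hl : ∀ w : Fin N → BigFun N,
      MLF fun k => substM w (Ω.lower (k + 1)) * xv N (k + 1) := fun w =>
    (mlf_xv.comp_injective Nat.succ_injective).mul_left _
  have hΦ : ∀ k a b, (∀ i, constantCoeff (a i) = 0) → (∀ i, constantCoeff (b i) = 0) →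
      (∀ i, a i - b i ∈ orderIdeal k) → ∀ i, Φ a i - Φ b i ∈ orderIdeal (k + 1) := by
    intro k a b ha hb hab α
    simp only [Φ]
    rw [Matrix.add_apply, Matrix.add_apply, add_sub_add_left_eq_sub, msum_apply, msum_apply,
      formalSum_sub (hl a α ()) (hl b α ())]
    refine formalSum_mem_orderIdeal fun j => ?_
    rw [← Matrix.sub_apply, ← Matrix.sub_mul, Matrix.mul_apply]
    exact sum_mem fun β _ => mul_mem_orderIdeal (subst_sub_subst_mem ha hb _ hab _)
      (X_mem_orderIdeal _)
  obtain ⟨w, hw, h⟩ := exists_fixed_point (fun _ : Fin N => 0) Φ (fun w _ => h0 w) hΦ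
  refine ⟨w, hw, ?_⟩
  rw [Ω.eulerLagrange_sum hw, sub_eq_zero]
  ext1 α _
  exact congrFun h α

/-- Every correction to w = t_0 contains a variable t_{k+1}. -/
theorem IsEulerLagrange.initial {Ω : X.Calibration} (h : Ω.IsEulerLagrange w) (α : Fin N)
    (m : Fin N × ℕ →₀ ℕ) (hm : ∀ p ∈ m.support, p.2 = 0) :
    coeff m (w α) = coeff m (MvPowerSeries.X (α, 0) : BigFun N) := by
  have h1 := h.2
  rw [Ω.eulerLagrange_sum h.1, sub_eq_zero] at h1
  have h2 : w α = _ := (congrFun (congrFun h1 α) ()).symm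
  rw [h2, Matrix.add_apply, map_add]
  refine add_eq_left.2 (finsum_eq_zero_of_forall_eq_zero fun k => ?_)
  beta_reduce
  rw [Matrix.mul_apply, map_sum]
  refine Finset.sum_eq_zero fun β _ => ?_
  by_contra h3
  obtain ⟨a, b, hab, -, hb⟩ := exists_coeff_ne_zero_of_mul h3
  classical
  rw [xv, col_apply, coeff_X] at hb
  have hb := (ite_ne_right_iff.1 hb).1
  have := hm (β, k + 1) (by
    rw [← hab, hb]
    simp)
  simp at this

/-- The vector field `∂w/∂t^β_d` obtained by differentiating the Euler–Lagrange equation. -/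
theorem IsEulerLagrange.pderiv_eq {Ω : X.Calibration} (h : Ω.IsEulerLagrange w)
    (p : Fin N × ℕ) :
    X.Cw w (fun γ => pderiv ℂ p (w γ)) * msum (fun k => substM w (Ω.lower k) * Ω.qv (k + 1)) +
      substM w (Ω.lower p.2) * evec (Fin N × ℕ) p.1 = 0 := by
  have hq : MLF fun k => Ω.qv (k + 1) := Ω.mlf_qv.comp_injective Nat.succ_injective
  have h1 := congrArg (pdM p) h.2
  rw [pdM_zero, pdM_msum p (Ω.mlf_qv.mul_left _)] at h1
  simp only [pdM_mul] at h1
  rw [msum_add (Ω.mlf_qv.mul_left _) ((Ω.mlf_qv.pdM p).mul_left _),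
    msum_nat_succ _ (Ω.mlf_qv.mul_left _), lower_zero, substM_one h.1, pdM_one, Matrix.zero_mul,
    zero_add] at h1
  rw [← h1]
  congr 1
  · rw [← msum_mul_left _ (hq.mul_left _)]
    congr 1
    funext k
    rw [pdM_substM h.1, ← Matrix.mul_assoc]
    congr 1
    rw [FlatFManifold.Cw, Finset.sum_mul]
    refine Finset.sum_congr rfl fun γ _ => ?_
    rw [pdM_lower_succ, substM_mul h.1, Matrix.smul_mul]
  · have h2 : ∀ k, pdM p (Ω.qv k) = if k = p.2 then evec (Fin N × ℕ) p.1 else 0 := by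
      intro k
      ext1 β _
      classical
      rw [pdM_apply, qv, col_apply, GraphGerm.q, map_add, pderiv_C, add_zero, pderiv_X,
        Pi.single_apply]
      split_ifs with h3 h4 h4
      · rw [← h3, evec, col_apply, Pi.single_eq_same]
      · exact absurd (by rw [← h3]) h4
      · rw [evec, col_apply, Pi.single_eq_of_ne]
        intro h5
        exact h3 (Prod.ext h5 h4)
      · rfl
    rw [msum_eq_single _ p.2 fun j hj => by rw [h2, if_neg hj, Matrix.mul_zero], h2, if_pos rfl]

/-- Write C(u) for multiplication by u and B = Σ Ω^0_{k-1}(w) q_{k+1}. The differentiated equation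
reads C(∂_p w) B = -Ω^0_{d-1}(w) e_β for p = (β, d); contracted with the unit at d = 0 it gives
C(∂_x w) B = -A. Since multiplications commute, C(∂_x w) Ω^0_{d-1} e_β = -C(∂_p w) C(∂_x w) B =
C(∂_p w) A = ∂_p w. By `pdM_two` the left side is the β-th column of ∂_x Ω^0_d(w). -/
theorem IsEulerLagrange.isTopologicalSolution {Ω : X.Calibration} (h : Ω.IsEulerLagrange w) :
    Ω.IsTopologicalSolution w := by
  refine ⟨h.initial, fun α β d => ?_⟩
  set B := msum (fun k => substM w (Ω.lower k) * Ω.qv (k + 1))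
  let V : Fin N → BigFun N := fun δ => ∑ γ, C (X.unit γ) * pderiv ℂ (γ, 0) (w δ)
  have hV : X.Cw w V * B = - colC (Fin N × ℕ) X.unit := by
    have h1 : X.Cw w V = ∑ γ, (C (X.unit γ) : BigFun N) • X.Cw w (fun δ => pderiv ℂ (γ, 0) (w δ)) := by
      simp only [FlatFManifold.Cw, V, Finset.sum_smul, Finset.smul_sum]
      rw [Finset.sum_comm]
      simp only [smul_smul]
    rw [h1, Matrix.sum_mul]
    ext1 α _
    have h2 : ∀ γ, X.Cw w (fun δ => pderiv ℂ (γ, 0) (w δ)) * B = - evec (Fin N × ℕ) γ := by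
      intro γ
      have := h.pderiv_eq (γ, 0)
      rw [lower_zero, substM_one h.1, Matrix.one_mul] at this
      exact eq_neg_of_add_eq_zero_left this
    simp only [Matrix.smul_mul, h2]
    rw [Matrix.sum_apply, Finset.sum_eq_single α]
    · simp [evec, colC, col_apply]
    · intro γ _ hγ
      simp [evec, col_apply, Pi.single_eq_of_ne (Ne.symm hγ)]
    · simp
  have hr : X.Cw w V * (substM w (Ω.lower d) * evec (Fin N × ℕ) β) =
      (col fun α => pderiv ℂ (β, d) (w α) : Matrix (Fin N) Unit (BigFun N)) := by
    have h1 : substM w (Ω.lower d) * evec (Fin N × ℕ) β = _ :=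
      eq_neg_of_add_eq_zero_right (h.pderiv_eq (β, d))
    rw [h1, Matrix.mul_neg, ← Matrix.mul_assoc, X.Cw_comm h.1, Matrix.mul_assoc, hV,
      Matrix.mul_neg, neg_neg,
      X.Cw_mul_unit h.1]
  have h2 := congrFun (congrFun hr α) ()
  rw [col_apply] at h2
  rw [← h2]
  have h3 : ∀ γ, pderiv ℂ (γ, 0) (subst w (Ω.two 0 d α β)) =
      ∑ δ, pderiv ℂ (γ, 0) (w δ) * (substM w (X.Cmat δ) * substM w (Ω.lower d)) α β := by
    intro γ
    rw [pderiv_subst h.1]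
    refine Finset.sum_congr rfl fun δ _ => ?_
    rw [← substM_mul h.1, ← pdM_apply, pdM_two, Ω.mat_zero, one_mul, mul_comm, substM_apply]
  simp only [h3]
  rw [← Matrix.mul_assoc, Matrix.mul_apply, Finset.sum_eq_single β, evec, col_apply, Pi.single_eq_same,
    mul_one, FlatFManifold.Cw, Finset.sum_mul, Matrix.sum_apply]
  · simp only [Matrix.smul_mul, Matrix.smul_apply, smul_eq_mul, V, Finset.sum_mul, Finset.mul_sum]
    rw [Finset.sum_comm]
    exact Finset.sum_congr rfl fun γ _ => Finset.sum_congr rfl fun δ _ => by ring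
  · intro γ _ hγ
    rw [evec, col_apply, Pi.single_eq_of_ne hγ, mul_zero]
  · simp

theorem IsTopologicalSolution.constantCoeff_eq_zero {Ω : X.Calibration}
    (h : Ω.IsTopologicalSolution w) (α : Fin N) : constantCoeff (w α) = 0 := by
  have h1 := h.1 α 0 (by simp)
  rw [coeff_zero_eq_constantCoeff_apply, coeff_zero_eq_constantCoeff_apply] at h1
  rw [h1, constantCoeff_X]

/-- The number of variables `t_b`, `b ≥ 1`, in a monomial. -/
def descDegree : (Fin N × ℕ →₀ ℕ) →+ ℕ :=
  Finsupp.liftAddHom fun p => if p.2 = 0 then 0 else AddMonoidHom.id ℕ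

theorem descDegree_single (p : Fin N × ℕ) :
    descDegree (Finsupp.single p 1) = if p.2 = 0 then 0 else 1 := by
  rw [descDegree, Finsupp.liftAddHom_apply_single]
  split_ifs <;> rfl

/-- The flow in t^β_d with d ≥ 1 expresses a coefficient through coefficients with one descendant
variable fewer, at the cost of derivatives in t_0 only. Induction on `descDegree` starts at the
initial condition. -/
theorem IsTopologicalSolution.unique {Ω : X.Calibration} {w' : Fin N → BigFun N}
    (h : Ω.IsTopologicalSolution w) (h' : Ω.IsTopologicalSolution w') : w = w' := by
  have key : ∀ n, ∀ m : Fin N × ℕ →₀ ℕ, descDegree m < n →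
      ∀ α, coeff m (w α) = coeff m (w' α) := by
    intro n
    induction n with
    | zero => exact fun m hm => absurd hm (Nat.not_lt_zero _)
    | succ n ih =>
      intro m hm α
      by_cases hs : ∀ p ∈ m.support, p.2 = 0
      · rw [h.1 α m hs, h'.1 α m hs]
      · push Not at hs
        obtain ⟨p, hp, hp0⟩ := hs
        have hle : Finsupp.single p 1 ≤ m := by
          rw [Finsupp.single_le_iff]
          exact Nat.one_le_iff_ne_zero.2 (Finsupp.mem_support_iff.1 hp)
        obtain ⟨e, rfl⟩ : ∃ e, m = e + Finsupp.single p 1 := ⟨_, (tsub_add_cancel_of_le hle).symm⟩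
        rw [map_add, descDegree_single, if_neg hp0] at hm
        let D : LowerSet (Fin N × ℕ →₀ ℕ) := ⟨{m | descDegree m < n}, fun a b hab ha => by
          obtain ⟨c, rfl⟩ := exists_add_of_le hab
          have ha : descDegree (b + c) < n := ha
          rw [map_add] at ha
          exact lt_of_le_of_lt (Nat.le_add_right _ _) ha⟩
        have hD : ∀ i, w i - w' i ∈ vanishIdeal D := fun i d hd => by
          rw [map_sub, ih d hd, sub_self]
        have h1 : ∀ γ, coeff e (pderiv ℂ (γ, 0) (subst w (Ω.two 0 p.2 α p.1))) =
            coeff e (pderiv ℂ (γ, 0) (subst w' (Ω.two 0 p.2 α p.1))) := by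
          intro γ
          rw [coeff_pderiv, coeff_pderiv]
          congr 1
          rw [← sub_eq_zero, ← map_sub]
          refine subst_sub_subst_mem h.constantCoeff_eq_zero h'.constantCoeff_eq_zero D hD _ _ ?_
          show descDegree _ < n
          rw [map_add, descDegree_single, if_pos rfl]
          omega
        have h2 := congrArg (coeff e) (h.2 α p.1 p.2)
        have h2' := congrArg (coeff e) (h'.2 α p.1 p.2)
        simp only [map_sum, coeff_C_mul, h1] at h2 h2'
        rw [← h2', coeff_pderiv, coeff_pderiv] at h2
        exact mul_right_cancel₀ (Nat.cast_add_one_ne_zero _) h2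
  funext α
  ext m
  exact key (descDegree m + 1) m (Nat.lt_succ_self _) α

theorem IsTopologicalSolution.isEulerLagrange {Ω : X.Calibration}
    (h : Ω.IsTopologicalSolution w) : Ω.IsEulerLagrange w := by
  obtain ⟨w', hw'⟩ := Ω.exists_isEulerLagrange
  rwa [h.unique hw'.isTopologicalSolution]

/-- Every calibrated flat F-manifold has a generalized Givental cone. -/
theorem exists_isConeOf : ∃ G, Ω.IsConeOf G := by
  obtain ⟨w, hw⟩ := Ω.exists_isEulerLagrange
  exact ⟨⟨Ω.shiftedOrig, X.unit, fun a α => formalSum fun p : Fin N × ℕ =>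
    subst w (Ω.two a p.2 α p.1) * Ω.origin.q p.2 p.1⟩, rfl, rfl, w, hw.isTopologicalSolution,
    fun a α => rfl⟩

end FlatFManifold.Calibration

/-! ### Well-defined triple products -/

section Triple

variable {σ l m n r : Type*} [Fintype m]
  {A : ℤ → Matrix l m (MvPowerSeries σ ℂ)} {B : ℤ → Matrix m n (MvPowerSeries σ ℂ)}
  {D : ℤ → Matrix n r (MvPowerSeries σ ℂ)}

theorem sub_left_injective_int (k : ℤ) : Function.Injective fun i : ℤ => k - i :=
  fun a b h => by simpa using h

theorem MLF.conv_left (hA : MLF A) (k : ℤ) : MLF fun i => A i * B (k - i) := hA.mul_right _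

theorem MLF.conv_right (hB : MLF B) (k : ℤ) : MLF fun i => A i * B (k - i) :=
  (hB.comp_injective (sub_left_injective_int k)).mul_left _

theorem MLF.conv_pos (hA : ∀ i < 0, A i = 0) (hB : ∀ i < 0, B i = 0) (k : ℤ) :
    MLF fun i => A i * B (k - i) :=
  MLF.of_support (Set.Icc 0 k) (Set.finite_Icc 0 k) fun i hi => by
    rw [Set.mem_Icc, not_and_or, not_le, not_le] at hi
    rcases hi with hi | hi
    · rw [hA i hi, Matrix.zero_mul]
    · rw [hB _ (by omega), Matrix.mul_zero]

theorem MLF.conv_neg (hA : ∀ i, 0 < i → A i = 0) (hB : ∀ i, 0 < i → B i = 0) (k : ℤ) :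
    MLF fun i => A i * B (k - i) :=
  MLF.of_support (Set.Icc k 0) (Set.finite_Icc k 0) fun i hi => by
    rw [Set.mem_Icc, not_and_or, not_le, not_le] at hi
    rcases hi with hi | hi
    · rw [hB _ (by omega), Matrix.mul_zero]
    · rw [hA i hi, Matrix.zero_mul]

variable [Fintype n]

/-- Of the four criteria, lower triangular and linear operators use `JLF.of_right`, where powers of
z are bounded above; upper triangular ones use the other three. -/
theorem JLF.of_left (hA : MLF A) (hB : MLF B) : JLF A B D := fun k => by
  have h := MLF.mul_sigma (g := fun i j => B j * D (k - i - j)) hA fun i =>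
    MLF.conv_left (B := D) hB (k - i)
  exact h

theorem JLF.of_first (hA : MLF A) (hB : ∀ i < 0, B i = 0) (hD : ∀ i < 0, D i = 0) :
    JLF A B D := fun k =>
  MLF.mul_sigma (g := fun i j => B j * D (k - i - j)) hA fun _ => MLF.conv_pos hB hD _

theorem JLF.of_right (hA : ∀ i, 0 < i → A i = 0) (hB : ∀ i, 0 < i → B i = 0) (hD : MLF D) :
    JLF A B D := fun k => by
  have h1 : MLF fun p : ℤ × ℤ => A p.2 * B (k - p.1 - p.2) * D p.1 :=
    MLF.mul_sigma_right (f := fun s i => A i * B (k - s - i))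
      (fun s => MLF.conv_neg hA hB _) hD
  have h2 : Function.Injective fun p : ℤ × ℤ => (k - p.1 - p.2, p.1) := by
    rintro ⟨a, b⟩ ⟨a', b'⟩ h
    simp only [Prod.mk.injEq] at h ⊢
    omega
  have h3 := h1.comp_injective h2
  beta_reduce at h3
  dsimp only at h3
  have h4 : (fun p : ℤ × ℤ => A p.1 * (B p.2 * D (k - p.1 - p.2))) =
      fun p : ℤ × ℤ => A p.1 * B (k - (k - p.1 - p.2) - p.1) * D (k - p.1 - p.2) := by
    funext p
    rw [show k - (k - p.1 - p.2) - p.1 = p.2 by ring, Matrix.mul_assoc]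
  rw [h4]
  exact h3

theorem JLF.of_mid [Finite l] (hA : ∀ i < 0, A i = 0) (hB : MLF B) (hD : ∀ i < 0, D i = 0) :
    JLF A B D := fun k a b => by
  have h1 : ∀ c e, LocallyFinite fun p : ℤ × ℤ => B p.1 c e * (A p.2 a c * D (k - p.2 - p.1) e b) :=
    fun c e => by
    have h3 : ∀ j, LocallyFinite fun i => A i a c * D (k - i - j) e b := fun j =>
      LocallyFinite.of_support (Set.Icc 0 (k - j)) (Set.finite_Icc _ _) fun i hi => by
        rw [Set.mem_Icc, not_and_or, not_le, not_le] at hi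
        rcases hi with hi | hi
        · rw [hA i hi, Matrix.zero_apply, zero_mul]
        · rw [hD _ (by omega), Matrix.zero_apply, mul_zero]
    have h4 := LocallyFinite.mul_sigma (f := fun j => B j c e)
      (g := fun j i => A i a c * D (k - i - j) e b) (hB c e) h3
    exact h4
  simp only [Matrix.mul_apply, Finset.mul_sum]
  refine LocallyFinite.sum _ fun c _ => LocallyFinite.sum _ fun e _ => ?_
  have h2 := (h1 c e).comp_injective (e := Prod.swap) Prod.swap_injective
  refine fun d => (h2 d).subset fun p hp => ?_
  have h3 : A p.1 a c * (B p.2 c e * D (k - p.1 - p.2) e b) =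
      B p.2 c e * (A p.1 a c * D (k - p.1 - p.2) e b) := by ring
  rw [Set.mem_ofPred_eq] at hp
  beta_reduce at hp
  rw [h3] at hp
  exact hp

/-- The part of a sequence with nonnegative indices. -/
def posPart (f : ℤ → Matrix l m (MvPowerSeries σ ℂ)) (n : ℤ) : Matrix l m (MvPowerSeries σ ℂ) :=
  if 0 ≤ n then f n else 0

theorem posPart_of_nonneg {f : ℤ → Matrix l r (MvPowerSeries σ ℂ)} {n : ℤ} (h : 0 ≤ n) :
    posPart f n = f n := if_pos h

theorem posPart_of_neg {f : ℤ → Matrix l r (MvPowerSeries σ ℂ)} {n : ℤ} (h : n < 0) :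
    posPart f n = 0 := if_neg (by omega)

/-- For a fixed index j of `B`, only the finitely many i with -j ≤ i ≤ 0 can contribute to a
nonnegative power of z. -/
theorem mlf_posPart_conv (hA : ∀ i, 0 < i → A i = 0) (hB : MLF B) : MLF (posPart (conv A B)) := by
  have h1 : MLF fun p : ℤ × ℤ => (if 0 ≤ p.1 + p.2 then A p.2 else 0) * B p.1 := by
    refine MLF.mul_sigma_right (f := fun j i => if 0 ≤ j + i then A i else 0) (fun j => ?_) hB
    refine MLF.of_support (Set.Icc (-j) 0) (Set.finite_Icc _ _) fun i hi => ?_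
    rw [Set.mem_Icc, not_and_or, not_le, not_le] at hi
    rcases hi with hi | hi
    · exact if_neg (by omega)
    · rw [hA i hi, ite_self]
  have h2 : Function.Injective fun p : ℤ × ℤ => (p.1 - p.2, p.2) := by
    rintro ⟨a, b⟩ ⟨a', b'⟩ h
    simp only [Prod.mk.injEq] at h ⊢
    omega
  have h3 := (h1.comp_injective h2).msum_fst
  intro a b
  have h4 := h3 a b
  refine fun d => (h4 d).subset fun n hn => ?_
  simp only [Set.mem_ofPred_eq, sub_add_cancel, posPart, conv] at hn ⊢
  by_cases h : 0 ≤ n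
  · simpa only [if_pos h] using hn
  · simp [if_neg h] at hn

theorem conv_posPart (hA : ∀ i, 0 < i → A i = 0) {k : ℤ} (hk : 0 ≤ k) :
    conv A (posPart B) k = conv A B k := by
  unfold conv
  congr 1
  funext i
  by_cases hi : 0 < i
  · rw [hA i hi, Matrix.zero_mul, Matrix.zero_mul]
  · rw [posPart_of_nonneg (by omega)]

end Triple

/-! ### The operators S_w and the two-index matrices -/

namespace FlatFManifold.Calibration

variable {N : ℕ} {X : FlatFManifold N} (Ω : X.Calibration) {σ : Type*}
  {w : Fin N → MvPowerSeries σ ℂ}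

/-- The operator `∑_k (-1)^k Ω^{k-1}_0(w) z^{-k}`. -/
def hat (w : Fin N → MvPowerSeries σ ℂ) : ℤ → Matrix (Fin N) (Fin N) (MvPowerSeries σ ℂ) :=
  negSeq (smap w (altS Ω.series))

/-- The inverse operator `∑_k Ω^0_{k-1}(w) z^{-k}`. -/
def lhat (w : Fin N → MvPowerSeries σ ℂ) : ℤ → Matrix (Fin N) (Fin N) (MvPowerSeries σ ℂ) :=
  negSeq (smap w Ω.lowerSeries)

theorem hat_neg_natCast (k : ℕ) :
    Ω.hat w (-k) = substM w ((-1 : Fun N) ^ k • Ω.mat k) := by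
  rw [hat, negSeq_neg_natCast, coeff_smap, coeff_altS, series, PowerSeries.coeff_mk]

theorem lhat_neg_natCast (k : ℕ) : Ω.lhat w (-k) = substM w (Ω.lower k) := by
  rw [lhat, negSeq_neg_natCast, coeff_smap, lowerSeries, PowerSeries.coeff_mk]

theorem hat_of_pos {i : ℤ} (h : 0 < i) : Ω.hat w i = 0 := negSeq_of_pos _ h

theorem lhat_of_pos {i : ℤ} (h : 0 < i) : Ω.lhat w i = 0 := negSeq_of_pos _ h

theorem conv_lhat_hat (hw : ∀ i, constantCoeff (w i) = 0) :
    conv (Ω.lhat w) (Ω.hat w) = negSeq 1 := by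
  rw [hat, lhat, conv_negSeq, ← smap_mul hw, lowerSeries_mul, smap_one hw]

theorem conv_hat_lhat (hw : ∀ i, constantCoeff (w i) = 0) :
    conv (Ω.hat w) (Ω.lhat w) = negSeq 1 := by
  rw [hat, lhat, conv_negSeq, ← smap_mul hw, mul_lowerSeries, smap_one hw]

/-- This is the meaning of the two-index matrices: up to sign, Ω^a_b is the coefficient of z^{-a-1}
in S_w [S_w^{-1} z^b]_+. -/
theorem sum_hat_mul_lhat (hw : ∀ i, constantCoeff (w i) = 0) (a b : ℕ) :
    ∑ n ∈ Finset.range (b + 1), Ω.hat w (-a - 1 - n) * Ω.lhat w (n - b) =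
      (-1 : MvPowerSeries σ ℂ) ^ (a + 1) • substM w (Ω.two a b) := by
  rw [two, substM_sum hw, Finset.smul_sum, ← Finset.sum_range_reflect]
  refine Finset.sum_congr rfl fun i hi => ?_
  have hi := Finset.mem_range.1 hi
  have h1 : (-(a : ℤ) - 1 - ((b + 1 - 1 - i : ℕ) : ℤ)) = -((a + (b - i) + 1 : ℕ) : ℤ) := by
    omega
  have h2 : ((b + 1 - 1 - i : ℕ) : ℤ) - (b : ℤ) = -((i : ℕ) : ℤ) := by omega
  rw [h1, h2, hat_neg_natCast, lhat_neg_natCast, neg_one_pow_mul_eq_smul, ← substM_mul hw,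
    ← substM_neg_one_pow_smul hw, smul_smul, Matrix.smul_mul, ← pow_add]
  congr 3
  ring

variable {q : ℤ → Matrix (Fin N) Unit (MvPowerSeries σ ℂ)}

/-- The double sum is regrouped by the index b of `q`. For fixed b the truncation and the
triangularity of S_w^{-1} leave 0 ≤ n ≤ b, which is the range in `sum_hat_mul_lhat`. -/
theorem conv_hat_posPart_conv_lhat (hw : ∀ i, constantCoeff (w i) = 0)
    (hq : ∀ n < 0, q n = 0) (hJ : JLF (Ω.hat w) (Ω.lhat w) q)
    (hL : ∀ k, MLF fun i => Ω.lhat w i * q (k - i)) (a : ℕ) :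
    conv (Ω.hat w) (posPart (conv (Ω.lhat w) q)) (-a - 1) =
      (-1 : MvPowerSeries σ ℂ) ^ (a + 1) •
        msum fun b : ℕ => substM w (Ω.two a b) * q b := by
  let F : ℤ × ℤ → Matrix (Fin N) Unit (MvPowerSeries σ ℂ) := fun p =>
    if 0 ≤ p.1 then Ω.hat w (-a - 1 - p.1) * (Ω.lhat w (p.1 - p.2) * q p.2) else 0
  have hF : MLF F := by
    refine MLF.ite ?_ fun p : ℤ × ℤ => 0 ≤ p.1
    have h1 : Function.Injective fun p : ℤ × ℤ => (-(a : ℤ) - 1 - p.1, p.1 - p.2) := by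
      rintro ⟨x, y⟩ ⟨x', y'⟩ h
      simp only [Prod.mk.injEq] at h ⊢
      omega
    have h2 := (hJ (-a - 1)).comp_injective h1
    simpa only [show ∀ p : ℤ × ℤ, -(a : ℤ) - 1 - (-(a : ℤ) - 1 - p.1) - (p.1 - p.2) = p.2 from
      fun p => by ring] using h2
  have h3 : conv (Ω.hat w) (posPart (conv (Ω.lhat w) q)) (-a - 1) =
      msum fun n => msum fun b => F (n, b) := by
    unfold conv
    rw [← msum_equiv (Equiv.subLeft (-(a : ℤ) - 1))]
    congr 1
    funext n
    simp only [Equiv.subLeft_apply, sub_sub_cancel, F]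
    by_cases hn : 0 ≤ n
    · simp only [posPart_of_nonneg hn, if_pos hn]
      have h4 : MLF fun b => Ω.lhat w (n - b) * q b := by
        have := (hL n).comp_injective (sub_left_injective_int n)
        simpa only [sub_sub_cancel] using this
      rw [msum_mul_left _ h4]
      congr 1
      rw [← msum_equiv (Equiv.subLeft n)]
      simp only [Equiv.subLeft_apply, sub_sub_cancel]
    · rw [posPart_of_neg (not_le.1 hn), Matrix.mul_zero]
      simp only [if_neg hn, msum_zero]
  rw [h3, msum_comm hF, msum_of_nonneg _ fun b hb => by
    simp only [F, hq b hb, Matrix.mul_zero, ite_self, msum_zero]]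
  have h5 : ∀ b : ℕ, (msum fun n => F (n, (b : ℤ))) =
      (-1 : MvPowerSeries σ ℂ) ^ (a + 1) • (substM w (Ω.two a b) * q b) := by
    intro b
    rw [msum_of_nonneg _ fun n hn => by simp only [F, if_neg (not_le.2 hn)],
      msum_of_support _ (Finset.range (b + 1)), ← Matrix.smul_mul, ← Ω.sum_hat_mul_lhat hw,
      Matrix.sum_mul]
    · refine Finset.sum_congr rfl fun n _ => ?_
      simp only [F, if_pos (Int.natCast_nonneg n), Matrix.mul_assoc]
    · intro n hn
      have hn := mt Finset.mem_range.2 hn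
      simp only [F, Ω.lhat_of_pos (w := w) (show (0 : ℤ) < n - b by omega), Matrix.zero_mul,
        Matrix.mul_zero, ite_self]
  simp only [h5]
  rcases Nat.even_or_odd (a + 1) with h | h
  · simp only [h.neg_one_pow, one_smul]
  · simp only [h.neg_one_pow, neg_smul, one_smul, msum_neg]

/-- A point `∑_k (-1)^k Ω^{k-1}_0(w) z^{-k} h(z)` with `h ∈ z H_+` satisfies the Euler–Lagrange
equation, and its negative part is given by the two-index matrices. -/
theorem conv_hat_spec (hw : ∀ i, constantCoeff (w i) = 0)
    {h : ℤ → Matrix (Fin N) Unit (MvPowerSeries σ ℂ)} (hh : ∀ n < 0, h n = 0)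
    (hM : ∀ k, MLF fun i => Ω.hat w i * h (k - i)) (hJ : JLF (Ω.lhat w) (Ω.hat w) h)
    (hJ' : JLF (Ω.hat w) (Ω.lhat w) (posPart (conv (Ω.hat w) h)))
    (hL : ∀ k, MLF fun i => Ω.lhat w i * posPart (conv (Ω.hat w) h) (k - i)) :
    (∀ k, 0 ≤ k → conv (Ω.lhat w) (posPart (conv (Ω.hat w) h)) k = h k) ∧
    ∀ a : ℕ, conv (Ω.hat w) h (-a - 1) = (-1 : MvPowerSeries σ ℂ) ^ (a + 1) •
      msum fun b : ℕ => substM w (Ω.two a b) * posPart (conv (Ω.hat w) h) b := by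
  have h1 : conv (Ω.lhat w) (conv (Ω.hat w) h) = h := by
    rw [← conv_assoc hJ (MLF.conv_neg (fun _ => Ω.lhat_of_pos) fun _ => Ω.hat_of_pos) hM,
      Ω.conv_lhat_hat hw, negSeq_one_conv]
  have h2 : ∀ k, 0 ≤ k → conv (Ω.lhat w) (posPart (conv (Ω.hat w) h)) k = h k := by
    intro k hk
    rw [conv_posPart (fun _ => Ω.lhat_of_pos) hk, h1]
  refine ⟨h2, fun a => ?_⟩
  rw [← Ω.conv_hat_posPart_conv_lhat hw (fun n hn => posPart_of_neg hn) hJ' hL]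
  congr 1
  funext k
  by_cases hk : 0 ≤ k
  · rw [posPart_of_nonneg hk, h2 k hk]
  · rw [posPart_of_neg (not_le.1 hk), hh k (not_le.1 hk)]

end FlatFManifold.Calibration

/-! ### The general point of a cone -/

/-- The general point of a graph as a sequence of columns. -/
def GraphGerm.point {N : ℕ} (G : GraphGerm N) (n : ℤ) : Matrix (Fin N) Unit (BigFun N) :=
  col (G.genericPoint n)

/-- The nonnegative part of the general point of a graph. -/
def GraphGerm.qhat {N : ℕ} (G : GraphGerm N) : ℤ → Matrix (Fin N) Unit (BigFun N) :=
  posPart G.point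

theorem GraphGerm.qhat_natCast {N : ℕ} (G : GraphGerm N) (b : ℕ) : G.qhat b = col (G.q b) :=
  posPart_of_nonneg (Int.natCast_nonneg b)

theorem msum_col_apply {N : ℕ} {σ : Type*} {A : ℕ → Matrix (Fin N) (Fin N) (MvPowerSeries σ ℂ)}
    {q : ℕ → Fin N → MvPowerSeries σ ℂ}
    (h : ∀ α, LocallyFinite fun p : Fin N × ℕ => A p.2 α p.1 * q p.2 p.1) (α : Fin N) :
    msum (fun b => A b * col (q b)) α () =
      formalSum fun p : Fin N × ℕ => A p.2 α p.1 * q p.2 p.1 := by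
  have h1 := (h α).comp_injective (Equiv.prodComm ℕ (Fin N)).injective
  rw [← formalSum_equiv (Equiv.prodComm ℕ (Fin N)), formalSum_prod h1, msum_apply]
  congr 1
  funext b
  rw [Matrix.mul_apply, formalSum_of_fintype]
  rfl

namespace FlatFManifold.Calibration

variable {N : ℕ} {X : FlatFManifold N} (Ω : X.Calibration)

theorem locallyFinite_q (G : GraphGerm N) : LocallyFinite fun p : Fin N × ℕ => G.q p.2 p.1 := by
  refine LocallyFinite.add ?_ ?_
  · exact locallyFinite_X
  · refine LocallyFinite.of_support (Set.univ ×ˢ Set.Iio 2)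
      (Set.finite_univ.prod (Set.finite_Iio 2)) fun p hp => ?_
    have hp : ¬ p.2 < 2 := fun h => hp ⟨trivial, h⟩
    rw [GraphGerm.basePoint, if_neg (by omega), if_neg (by omega), map_zero]

theorem mlf_qhat (G : GraphGerm N) : MLF G.qhat := fun β u d => by
  refine (((locallyFinite_q G).comp_injective (e := fun b : ℕ => (β, b))
    fun a b h => by simpa using h) d).image (fun b : ℕ => (b : ℤ)) |>.subset fun n hn => ?_
  by_cases h : 0 ≤ n
  · obtain ⟨b, rfl⟩ := Int.eq_ofNat_of_zero_le h
    refine ⟨b, ?_, rfl⟩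
    rw [Set.mem_ofPred_eq] at hn
    beta_reduce at hn
    rw [G.qhat_natCast] at hn
    exact hn
  · have h1 : G.qhat n = 0 := posPart_of_neg (not_le.1 h)
    refine absurd ?_ hn
    beta_reduce
    rw [h1]
    exact map_zero _

theorem conv_lhat_zero {σ : Type*} (w : Fin N → MvPowerSeries σ ℂ)
    (q : ℤ → Matrix (Fin N) Unit (MvPowerSeries σ ℂ)) :
    conv (Ω.lhat w) q 0 = msum fun k : ℕ => substM w (Ω.lower k) * q k := by
  unfold conv
  rw [msum_of_nonpos _ fun i hi => by rw [Ω.lhat_of_pos hi, Matrix.zero_mul]]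
  simp only [lhat_neg_natCast, zero_sub, neg_neg]

/-- The general point of the cone lies on the ruling `S_w z H_+`. -/
theorem point_eq {G : GraphGerm N} (hb : G.base = Ω.shiftedOrig) (hu : G.unit = X.unit)
    {w : Fin N → BigFun N} (hw : Ω.IsEulerLagrange w)
    (hpot : ∀ a α, G.pot a α =
      formalSum fun p : Fin N × ℕ => subst w (Ω.two a p.2 α p.1) * G.q p.2 p.1) :
    posPart (conv (Ω.lhat w) G.qhat) 0 = 0 ∧
      G.point = conv (Ω.hat w) (posPart (conv (Ω.lhat w) G.qhat)) := by
  have hJ : JLF (Ω.hat w) (Ω.lhat w) G.qhat :=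
    JLF.of_right (fun _ => Ω.hat_of_pos) (fun _ => Ω.lhat_of_pos) (mlf_qhat G)
  have hL := (mlf_qhat G).conv_right (A := Ω.lhat w)
  have hqv : ∀ b, Ω.qv b = G.qhat b := by
    intro b
    rw [G.qhat_natCast, qv]
    congr 1
    funext β
    simp only [GraphGerm.q, GraphGerm.basePoint, origin, hb, hu]
  constructor
  -- The Euler–Lagrange equation is the statement that S_w^{-1} q has no z^0 term.
  · rw [posPart_of_nonneg le_rfl, conv_lhat_zero, ← hw.2]
    simp only [hqv]
  · funext n
    by_cases hn : 0 ≤ n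
    -- S_w never raises powers of z, so in nonnegative degrees the truncation is invisible and S_w
    -- S_w^{-1} q = q applies.
    · rw [conv_posPart (fun _ => Ω.hat_of_pos) hn, ← conv_assoc hJ
        (MLF.conv_neg (fun _ => Ω.hat_of_pos) fun _ => Ω.lhat_of_pos) hL, Ω.conv_hat_lhat hw.1,
        negSeq_one_conv, GraphGerm.qhat, posPart_of_nonneg hn]
    · obtain ⟨a, rfl⟩ : ∃ a : ℕ, n = -a - 1 := ⟨(-n - 1).toNat, by omega⟩
      rw [Ω.conv_hat_posPart_conv_lhat (q := G.qhat) hw.1 (fun n hn => posPart_of_neg hn) hJ hL]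
      simp only [G.qhat_natCast]
      ext1 α u
      rw [Matrix.smul_apply, msum_col_apply (A := fun b => substM w (Ω.two a b)) fun α =>
        (locallyFinite_q G).mul_left fun p => substM w (Ω.two a p.2) α p.1]
      have h1 : -(a : ℤ) - 1 = Int.negSucc a := by omega
      rw [h1, GraphGerm.point, col_apply]
      change (-1) ^ (a + 1) * G.pot a α = _
      rw [hpot]
      rfl

end FlatFManifold.Calibration

/-! ### Points of a cone -/

namespace FlatFManifold.Calibration

variable {N : ℕ} {X : FlatFManifold N} (Ω : X.Calibration) {σ : Type*}

/-- The Euler–Lagrange equation at a given point has at most one solution. -/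
theorem eq_of_lower_sum_eq_zero {v w : Fin N → MvPowerSeries σ ℂ}
    (hv : ∀ α, constantCoeff (v α) = 0) (hw : ∀ α, constantCoeff (w α) = 0)
    {x : ℕ → Matrix (Fin N) Unit (MvPowerSeries σ ℂ)}
    (mv : MLF fun k => substM v (Ω.lower k) * x k)
    (mw : MLF fun k => substM w (Ω.lower k) * x k)
    (hx : ∀ k, (∀ β u, x (k + 1) β u ∈ orderIdeal 1) ∨
      ∀ α β, Ω.lower (k + 1) α β ∈ orderIdeal 2)
    (ev : msum (fun k => substM v (Ω.lower k) * (x k + Ω.bv σ k)) = 0)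
    (ew : msum (fun k => substM w (Ω.lower k) * (x k + Ω.bv σ k)) = 0) : v = w := by
  rw [Ω.lower_sum hv mv, sub_eq_zero] at ev
  rw [Ω.lower_sum hw mw, sub_eq_zero] at ew
  refine eq_of_forall_orderIdeal fun k hk α => ?_
  rw [show v α = col v α () from rfl, show w α = col w α () from rfl, ← ev, ← ew,
    Matrix.add_apply, Matrix.add_apply, add_sub_add_left_eq_sub, msum_apply, msum_apply,
    formalSum_sub (mv.comp_injective Nat.succ_injective α ())
      (mw.comp_injective Nat.succ_injective α ())]
  refine formalSum_mem_orderIdeal fun j => ?_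
  beta_reduce
  rw [← Matrix.sub_apply, ← Matrix.sub_mul, Matrix.mul_apply]
  refine sum_mem fun β _ => ?_
  -- One order is gained either from x_{j+1}, when it has no constant term, or from Ω^0_j, when its
  -- order two makes substitution a contraction.
  rcases hx j with h | h
  · exact mul_mem_orderIdeal (subst_sub_subst_mem hv hw _ hk _) (h β ())
  · exact Ideal.mul_mem_right _ _ (subst_sub_subst_mem_orderIdeal hv hw hk (h α β))

theorem mlf_of_locallyFinite {A : ℕ → Matrix (Fin N) (Fin N) (MvPowerSeries σ ℂ)}
    {q : ℕ → Fin N → MvPowerSeries σ ℂ}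
    (h : ∀ α, LocallyFinite fun p : Fin N × ℕ => A p.2 α p.1 * q p.2 p.1) :
    MLF fun b => A b * col (q b) := fun α u => by
  simp only [Matrix.mul_apply]
  exact LocallyFinite.sum _ fun β _ => (h α).fst β

/-- The solution w of the cone, evaluated at y, solves the same Euler–Lagrange equation as w'.
Uniqueness identifies the two, and the evaluated potentials become the p-coordinates of f.
Admissibility is left as hypotheses because lower and upper triangular operators meet it for
different reasons. -/
theorem contains_of {Ω : X.Calibration} {G : GraphGerm N} (hb : G.base = Ω.shiftedOrig)
    (hu : G.unit = X.unit) {w : Fin N → BigFun N} (hw : Ω.IsEulerLagrange w)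
    (hpot : ∀ a α, G.pot a α =
      formalSum fun p : Fin N × ℕ => subst w (Ω.two a p.2 α p.1) * G.q p.2 p.1)
    {f : Pt N} {y : Fin N × ℕ → BigFun N}
    (hy : ∀ s, y s = f.q s.2 s.1 - C (G.basePoint s.2 s.1))
    (hy0 : ∀ β, constantCoeff (y (β, 0)) = 0 ∧ constantCoeff (y (β, 1)) = 0)
    {w' : Fin N → BigFun N} (hw' : ∀ α, constantCoeff (w' α) = 0)
    (hM : MLF fun k => substM w' (Ω.lower k) * col fun β => y (β, k))
    (hx : ∀ k, (∀ β, y (β, k + 1) ∈ orderIdeal 1) ∨ ∀ α β, Ω.lower (k + 1) α β ∈ orderIdeal 2)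
    (he : (msum fun k => substM w' (Ω.lower k) * col (f.q k)) = 0)
    (hp : ∀ a, col (f.p a) = msum fun b => substM w' (Ω.two a b) * col (f.q b))
    (ha : FAdm y fun m => ypow w m) (h0 : ∀ α, constantCoeff (ev y (w α)) = 0)
    (hF1 : ∀ α, FAdm y fun p : Fin N × ℕ => subst w (Ω.lower p.2 α p.1) * G.q p.2 p.1)
    (hF2 : ∀ a α, FAdm y fun p : Fin N × ℕ => subst w (Ω.two a p.2 α p.1) * G.q p.2 p.1) :
    G.Contains f := by
  have hbv : ∀ b, Ω.bv (Fin N × ℕ) b = colC _ (G.basePoint b) := by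
    intro b
    rw [bv]
    congr 1
    funext β
    simp only [GraphGerm.basePoint, origin, hb, hu]
  have hqv : ∀ b, Ω.qv b = col (G.q b) := by
    intro b
    rw [qv_eq, hbv]
    rfl
  have hfq : ∀ b, col (f.q b) = (col fun β => y (β, b)) + Ω.bv _ b := by
    intro b
    rw [hbv]
    ext1 β u
    simp only [Matrix.add_apply, col_apply, colC_apply, hy, sub_add_cancel]
  have hevq : ∀ b β, ev y (G.q b β) = f.q b β := by
    intro b β
    rw [GraphGerm.q, ev_add (adm_X _) (adm_C _), ev_X, ev_C, hy, sub_add_cancel]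
  have haq : ∀ b β, Adm y (G.q b β) := fun b β => (adm_X _).add (adm_C _)
  set v : Fin N → BigFun N := fun α => ev y (w α) with hv
  have hev : ∀ (A : ℕ → Matrix (Fin N) (Fin N) (Fun N)) α,
      (FAdm y fun p : Fin N × ℕ => subst w (A p.2 α p.1) * G.q p.2 p.1) →
      (LocallyFinite fun p : Fin N × ℕ => subst v (A p.2 α p.1) * f.q p.2 p.1) ∧
      ev y (formalSum fun p : Fin N × ℕ => subst w (A p.2 α p.1) * G.q p.2 p.1) =
        formalSum fun p : Fin N × ℕ => subst v (A p.2 α p.1) * f.q p.2 p.1 := by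
    intro A α hA
    have h1 : (fun p : Fin N × ℕ => ev y (subst w (A p.2 α p.1) * G.q p.2 p.1)) =
        fun p : Fin N × ℕ => subst v (A p.2 α p.1) * f.q p.2 p.1 := by
      funext p
      have h2 := ev_subst hw.1 ha h0 (A p.2 α p.1)
      rw [ev_mul h2.1 (haq _ _), h2.2, hevq]
    refine ⟨?_, ?_⟩
    · rw [← h1]
      exact hA.ev_locallyFinite
    · rw [← h1]
      exact ev_formalSum hA ((locallyFinite_q G).mul_left _)
  have hELv : (msum fun k => substM v (Ω.lower k) * col (f.q k)) = 0 := by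
    ext1 α u
    rw [msum_col_apply (A := fun k => substM v (Ω.lower k)) fun α => (hev Ω.lower α (hF1 α)).1]
    have h1 := congrFun (congrFun hw.2 α) ()
    simp only [hqv] at h1
    rw [msum_col_apply (A := fun k => substM w (Ω.lower k)) fun α =>
      (locallyFinite_q G).mul_left _] at h1
    have h2 := (hev Ω.lower α (hF1 α)).2
    simp only [substM_apply] at h1 ⊢
    rw [← h2, h1]
    change ev y 0 = 0
    simpa using ev_C (y := y) 0
  have hvw : v = w' := by
    refine Ω.eq_of_lower_sum_eq_zero h0 hw' (x := fun k => col fun β => y (β, k)) ?_ hM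
      (fun k => (hx k).imp_left fun h β _ => h β) ?_ ?_
    · have h1 := mlf_of_locallyFinite (A := fun k => substM v (Ω.lower k)) (q := f.q)
        fun α => (hev Ω.lower α (hF1 α)).1
      have h2 := h1.add ((Ω.mlf_bv (σ := Fin N × ℕ)).mul_left fun k => - substM v (Ω.lower k))
      simpa only [hfq, Matrix.mul_add, Matrix.neg_mul, add_neg_cancel_right] using h2
    · simpa only [hfq] using hELv
    · simpa only [hfq] using he
  have hy' : (fun s : Fin N × ℕ => f.q s.2 s.1 - C (G.basePoint s.2 s.1)) = y :=
    funext fun s => (hy s).symm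
  refine ⟨by simpa only [hy] using hy0, fun a α => ?_⟩
  rw [hy', hpot]
  refine ⟨(hF2 a α).adm_formalSum.substTerm_locallyFinite, ?_⟩
  have h1 := hev (Ω.two a) α (hF2 a α)
  change _ = ev y _
  have h2 := congrFun (congrFun (hp a) α) ()
  rw [← hvw, msum_col_apply (A := fun b => substM v (Ω.two a b))
    fun α => (hev (Ω.two a) α (hF2 a α)).1] at h2
  rw [h1.2]
  exact h2

end FlatFManifold.Calibration

/-! ### Constant terms of matrices of power series -/

section ConstantTerms

variable {ι κ σ l m n : Type*}

/-- The matrix of constant terms. -/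
def cc (A : Matrix l m (MvPowerSeries σ ℂ)) : Matrix l m ℂ := A.map constantCoeff

theorem cc_apply (A : Matrix l m (MvPowerSeries σ ℂ)) (a : l) (b : m) :
    cc A a b = constantCoeff (A a b) := rfl

theorem cc_mul [Fintype m] (A : Matrix l m (MvPowerSeries σ ℂ)) (B : Matrix m n (MvPowerSeries σ ℂ)) :
    cc (A * B) = cc A * cc B := Matrix.map_mul

theorem cc_one [DecidableEq m] : cc (1 : Matrix m m (MvPowerSeries σ ℂ)) = 1 :=
  Matrix.map_one (constantCoeff (σ := σ) (R := ℂ)) (map_zero _) (map_one _)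

theorem cc_zero : cc (0 : Matrix l m (MvPowerSeries σ ℂ)) = 0 :=
  Matrix.map_zero (constantCoeff (σ := σ) (R := ℂ)) (map_zero _)

theorem cc_mapC (A : Matrix l m ℂ) : cc (A.map C : Matrix l m (MvPowerSeries σ ℂ)) = A := by
  ext1 a b
  rw [cc_apply, Matrix.map_apply, constantCoeff_C]

theorem cc_msum (f : ι → Matrix l m (MvPowerSeries σ ℂ)) (s : Finset ι)
    (h : ∀ i ∉ s, cc (f i) = 0) : cc (msum f) = ∑ i ∈ s, cc (f i) := by
  ext1 a b
  rw [cc_apply, Matrix.sum_apply, ← coeff_zero_eq_constantCoeff_apply, msum_apply, coeff_formalSum,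
    finsum_eq_sum_of_support_subset]
  · rfl
  · intro i hi
    by_contra hs
    exact hi (congrFun (congrFun (h i hs) a) b)

theorem cc_conv [Fintype m] (A : ℤ → Matrix l m (MvPowerSeries σ ℂ))
    (B : ℤ → Matrix m n (MvPowerSeries σ ℂ)) (k i : ℤ)
    (h : ∀ j, j ≠ i → cc (A j) * cc (B (k - j)) = 0) :
    cc (conv A B k) = cc (A i) * cc (B (k - i)) := by
  rw [conv, cc_msum _ {i} fun j hj => by rw [cc_mul, h j (by simpa using hj)], Finset.sum_singleton,
    cc_mul]

theorem cc_substM {ν : Type*} [Finite ν] {w : ν → MvPowerSeries σ ℂ}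
    (hw : ∀ i, constantCoeff (w i) = 0) (A : Matrix l m (MvPowerSeries ν ℂ)) :
    cc (substM w A) = cc A := by
  ext1 a b
  rw [cc_apply, cc_apply, substM_apply]
  have h1 : A a b - C (constantCoeff (A a b)) ∈ orderIdeal 1 :=
    mem_orderIdeal_one.2 (by simp)
  have h2 := mem_orderIdeal_one.1 (subst_mem_orderIdeal hw h1)
  rw [← coe_substAlgHom (hasSubst_of_constantCoeff_zero hw), map_sub,
    coe_substAlgHom (hasSubst_of_constantCoeff_zero hw), subst_C, map_sub, constantCoeff_C,
    sub_eq_zero] at h2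
  exact h2

theorem LocallyFinite.of_fst [Finite ι] {f : ι × κ → MvPowerSeries σ ℂ}
    (h : ∀ i, LocallyFinite fun k => f (i, k)) : LocallyFinite f := fun d =>
  (Set.finite_iUnion fun i => (h i d).image fun k => (i, k)).subset fun p hp =>
    Set.mem_iUnion.2 ⟨p.1, p.2, hp, rfl⟩

end ConstantTerms

/-! ### The action on columns -/

section Action

variable {N : ℕ}

/-- A sequence of constant matrices as a sequence of matrices of power series. -/
def cseq (σ : Type*) (T : ℤ → Matrix (Fin N) (Fin N) ℂ) (i : ℤ) :
    Matrix (Fin N) (Fin N) (MvPowerSeries σ ℂ) := (T i).map C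

theorem col_act (T : ℤ → Matrix (Fin N) (Fin N) ℂ) (G : GraphGerm N) (n : ℤ) :
    col (act T G.genericPoint n) = conv (cseq _ T) G.point n := by
  ext1 α u
  rfl

theorem locallyFinite_actTerm {T : ℤ → Matrix (Fin N) (Fin N) ℂ} {G : GraphGerm N} {n : ℤ}
    (h : MLF fun i => cseq _ T i * G.point (n - i)) (α : Fin N) :
    LocallyFinite (actTerm T G.genericPoint n α) := h α ()

theorem cseq_of_zero {σ : Type*} {T : ℤ → Matrix (Fin N) (Fin N) ℂ} {i : ℤ} (h : T i = 0) :
    cseq σ T i = 0 := by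
  rw [cseq, h]
  exact Matrix.map_zero _ (map_zero _)

theorem GraphGerm.cc_qhat (G : GraphGerm N) (b : ℕ) : cc (G.qhat b) = col (G.basePoint b) := by
  ext1 β u
  rw [G.qhat_natCast, cc_apply, col_apply, col_apply, q, map_add, constantCoeff_X, zero_add,
    constantCoeff_C]

end Action

/-! ### Transport of cones -/

namespace FlatFManifold.Calibration

variable {N : ℕ} {X : FlatFManifold N} (Ω : X.Calibration) {σ : Type*}

theorem hat_zero {w : Fin N → MvPowerSeries σ ℂ} (hw : ∀ i, constantCoeff (w i) = 0) :
    Ω.hat w 0 = 1 := by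
  have h := Ω.hat_neg_natCast (w := w) 0
  rwa [Nat.cast_zero, neg_zero, pow_zero, one_smul, Ω.mat_zero, substM_one hw] at h

theorem lhat_zero {w : Fin N → MvPowerSeries σ ℂ} (hw : ∀ i, constantCoeff (w i) = 0) :
    Ω.lhat w 0 = 1 := by
  have h := Ω.lhat_neg_natCast (w := w) 0
  rwa [Nat.cast_zero, neg_zero, Ω.lower_zero, substM_one hw] at h

/-- The coordinates of the general point of a cone along its ruling. -/
def ruling (w : Fin N → BigFun N) (G : GraphGerm N) : ℤ → Matrix (Fin N) Unit (BigFun N) :=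
  posPart (conv (Ω.lhat w) G.qhat)

theorem mlf_ruling (w : Fin N → BigFun N) (G : GraphGerm N) : MLF (Ω.ruling w G) :=
  mlf_posPart_conv (fun _ => Ω.lhat_of_pos) (mlf_qhat G)

theorem ruling_of_neg (w : Fin N → BigFun N) (G : GraphGerm N) {n : ℤ} (h : n < 0) :
    Ω.ruling w G n = 0 := posPart_of_neg h

theorem cc_ruling {G : GraphGerm N} (hu : G.unit = X.unit) {w : Fin N → BigFun N}
    (hw : ∀ i, constantCoeff (w i) = 0) (h0 : Ω.ruling w G 0 = 0) (n : ℤ) :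
    cc (Ω.ruling w G n) = if n = 1 then - col X.unit else 0 := by
  rcases lt_or_ge n 1 with hn | hn
  · rw [if_neg (by omega)]
    rcases eq_or_lt_of_le (show n ≤ 0 by omega) with rfl | hn
    · rw [h0, cc_zero]
    · rw [Ω.ruling_of_neg _ _ hn, cc_zero]
  · have h1 : ∀ b : ℤ, 2 ≤ b → cc (G.qhat b) = 0 := by
      intro b hb
      obtain ⟨b, rfl⟩ := Int.eq_ofNat_of_zero_le (show 0 ≤ b by omega)
      rw [G.cc_qhat]
      ext1 β u
      rw [col_apply, GraphGerm.basePoint, if_neg (by omega), if_neg (by omega)]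
      rfl
    rw [ruling, posPart_of_nonneg (by omega), cc_conv _ _ _ 0, Ω.lhat_zero hw, cc_one,
      Matrix.one_mul, sub_zero]
    · split_ifs with h
      · subst h
        have h2 := G.cc_qhat 1
        rw [Nat.cast_one] at h2
        rw [h2]
        ext1 β u
        rw [Matrix.neg_apply, col_apply, col_apply, GraphGerm.basePoint, if_neg one_ne_zero,
          if_pos rfl, hu]
      · exact h1 n (by omega)
    · intro j hj
      rcases lt_or_gt_of_ne hj with hj | hj
      · rw [h1 _ (by omega), Matrix.mul_zero]
      · rw [Ω.lhat_of_pos hj, cc_zero, Matrix.zero_mul]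

end FlatFManifold.Calibration

/-! ### Image of a ruling; lower triangular and linear operators -/

namespace FlatFManifold.Calibration

variable {N : ℕ} {X₁ X₂ : FlatFManifold N} (Ω₁ : X₁.Calibration) (Ω₂ : X₂.Calibration)

/-- If h denotes the ruling coordinate, T S_w h = S_{w'} B h, and B h stays in z H_+ because B has
no negative powers of z; `conv_hat_spec` then applies. The summability hypotheses justify each
change of bracketing. The last conclusion comes from h = -zA at the base point and serves to locate
the image there. -/
theorem act_spec {G : GraphGerm N} (hb : G.base = Ω₁.shiftedOrig)
    (hu : G.unit = X₁.unit) {w : Fin N → BigFun N} (hw : Ω₁.IsEulerLagrange w)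
    (hpot : ∀ a α, G.pot a α =
      formalSum fun p : Fin N × ℕ => subst w (Ω₁.two a p.2 α p.1) * G.q p.2 p.1)
    {w' : Fin N → BigFun N} (hw' : ∀ α, constantCoeff (w' α) = 0)
    {T : ℤ → Matrix (Fin N) (Fin N) ℂ} {B : ℤ → Matrix (Fin N) (Fin N) (BigFun N)}
    (hB : ∀ i < 0, B i = 0)
    (hT : conv (cseq _ T) (Ω₁.hat w) = conv (Ω₂.hat w') B)
    (J1 : JLF (cseq _ T) (Ω₁.hat w) (Ω₁.ruling w G))
    (m1 : ∀ k, MLF fun i => cseq _ T i * Ω₁.hat w (k - i))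
    (m2 : ∀ k, MLF fun i => Ω₁.hat w i * Ω₁.ruling w G (k - i))
    (J2 : JLF (Ω₂.hat w') B (Ω₁.ruling w G))
    (m3 : ∀ k, MLF fun i => Ω₂.hat w' i * B (k - i))
    (hM : ∀ k, MLF fun i => Ω₂.hat w' i * conv B (Ω₁.ruling w G) (k - i))
    (hJ : JLF (Ω₂.lhat w') (Ω₂.hat w') (conv B (Ω₁.ruling w G)))
    (hJ' : JLF (Ω₂.hat w') (Ω₂.lhat w') (posPart (conv (Ω₂.hat w') (conv B (Ω₁.ruling w G)))))
    (hL : ∀ k, MLF fun i => Ω₂.lhat w' i *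
      posPart (conv (Ω₂.hat w') (conv B (Ω₁.ruling w G))) (k - i)) :
    (∀ n α, LocallyFinite (actTerm T G.genericPoint n α)) ∧
    (∀ n, col (act T G.genericPoint n) = conv (Ω₂.hat w') (conv B (Ω₁.ruling w G)) n) ∧
    (msum fun k => substM w' (Ω₂.lower k) * col ((act T G.genericPoint).q k)) = 0 ∧
    (∀ a, col ((act T G.genericPoint).p a) =
      msum fun b => substM w' (Ω₂.two a b) * col ((act T G.genericPoint).q b)) ∧
    ∀ n, cc (conv B (Ω₁.ruling w G) n) = - (cc (B (n - 1)) * col X₁.unit) := by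
  obtain ⟨h0, hpt⟩ := Ω₁.point_eq hb hu hw hpot
  have hr : ∀ i < 0, Ω₁.ruling w G i = 0 := fun i => Ω₁.ruling_of_neg w G
  have hact : ∀ n, col (act T G.genericPoint n) =
      conv (Ω₂.hat w') (conv B (Ω₁.ruling w G)) n := by
    intro n
    rw [col_act, hpt]
    change conv (cseq _ T) (conv (Ω₁.hat w) (Ω₁.ruling w G)) n = _
    rw [← conv_assoc J1 m1 m2, hT, conv_assoc J2 m3 (MLF.conv_pos hB hr)]
  have hh : ∀ n < 0, conv B (Ω₁.ruling w G) n = 0 := by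
    intro n hn
    have : (fun i => B i * Ω₁.ruling w G (n - i)) = fun _ => 0 := by
      funext i
      by_cases hi : i < 0
      · rw [hB i hi, Matrix.zero_mul]
      · rw [hr _ (by omega), Matrix.mul_zero]
    rw [conv, this, msum_zero]
  have hh0 : conv B (Ω₁.ruling w G) 0 = 0 := by
    have : (fun i => B i * Ω₁.ruling w G (0 - i)) = fun _ => 0 := by
      funext i
      rcases lt_trichotomy i 0 with hi | rfl | hi
      · rw [hB i hi, Matrix.zero_mul]
      · rw [sub_zero]
        change B 0 * posPart (conv (Ω₁.lhat w) G.qhat) 0 = 0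
        rw [h0, Matrix.mul_zero]
      · rw [hr _ (by omega), Matrix.mul_zero]
    rw [conv, this, msum_zero]
  obtain ⟨s1, s2⟩ := Ω₂.conv_hat_spec hw' hh hM hJ hJ' hL
  have hq : ∀ b : ℕ, posPart (conv (Ω₂.hat w') (conv B (Ω₁.ruling w G))) b =
      col ((act T G.genericPoint).q b) := by
    intro b
    rw [posPart_of_nonneg (by omega), ← hact]
    rfl
  refine ⟨fun n α => locallyFinite_actTerm ?_ α, hact, ?_, fun a => ?_, fun n => ?_⟩
  · rw [hpt]
    have h2 := (J1 n).msum_fst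
    have h3 : ∀ i, (msum fun k => cseq _ T i * (Ω₁.hat w k * Ω₁.ruling w G (n - i - k))) =
        cseq _ T i * conv (Ω₁.hat w) (Ω₁.ruling w G) (n - i) := fun i =>
      msum_mul_left _ (m2 (n - i))
    refine (congrArg MLF (funext h3)).mp ?_
    exact h2
  · have h2 := s1 0 le_rfl
    rw [conv_lhat_zero, hh0] at h2
    simpa only [hq] using h2
  · have h2 := s2 a
    rw [← hact] at h2
    simp only [hq] at h2
    have h3 : col ((act T G.genericPoint).p a) =
        (-1 : BigFun N) ^ (a + 1) • col (act T G.genericPoint (-a - 1)) := rfl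
    rw [h3, h2, smul_smul, ← mul_pow]
    simp
  · rw [cc_conv _ _ _ (n - 1), Ω₁.cc_ruling hu hw.1 h0, if_pos (by ring), Matrix.mul_neg]
    intro j hj
    rw [Ω₁.cc_ruling hu hw.1 h0, if_neg (by omega), Matrix.mul_zero]

theorem cc_mat_one_mul_unit : cc (Ω₂.mat 1) * col X₂.unit = col Ω₂.shiftedOrig := by
  ext1 α u
  rw [Matrix.mul_apply, col_apply, shiftedOrig, map_sum]
  simp only [map_mul, constantCoeff_C]
  rfl

theorem constantCoeff_displacement {G : GraphGerm N} {f : Pt N} {b : ℕ}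
    (h : cc (col (f b)) = col (G.basePoint b)) (β : Fin N) :
    constantCoeff (f.q b β - C (G.basePoint b β)) = 0 := by
  rw [map_sub, constantCoeff_C, sub_eq_zero]
  exact congrFun (congrFun h β) ()

/-- The action of `G_-` and of the linear group on cones. -/
theorem isImage_of_lower {G₁ G₂ : GraphGerm N} (h₁ : Ω₁.IsConeOf G₁) (h₂ : Ω₂.IsConeOf G₂)
    {w : Fin N → BigFun N} (hw : Ω₁.IsEulerLagrange w)
    {w' : Fin N → BigFun N} (hw' : ∀ α, constantCoeff (w' α) = 0)
    {T : ℤ → Matrix (Fin N) (Fin N) ℂ} (hT0 : ∀ i, 0 < i → T i = 0)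
    (B : Matrix (Fin N) (Fin N) ℂ) (hB : B * col X₁.unit = col X₂.unit)
    (hT : ∀ k, conv (cseq _ T) (Ω₁.hat w) k = Ω₂.hat w' k * B.map C) :
    IsImage T G₁ G₂ := by
  obtain ⟨hb₁, hu₁, w₁, hw₁, hpot₁⟩ := h₁
  obtain ⟨hb₂, hu₂, w₂, hw₂, hpot₂⟩ := h₂
  -- A cone comes with its own topological solution, which uniqueness replaces by the Euler–Lagrange
  -- one.
  obtain rfl : w₁ = w := hw₁.unique hw.isTopologicalSolution
  set Bs : ℤ → Matrix (Fin N) (Fin N) (BigFun N) := fun i => if i = 0 then B.map C else 0 with hBs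
  have hB0 : ∀ i, i ≠ 0 → Bs i = 0 := fun i hi => if_neg hi
  have hT' : conv (cseq _ T) (Ω₁.hat w₁) = conv (Ω₂.hat w') Bs := by
    funext k
    rw [hT, hBs, conv_const_right]
  have hTn : ∀ i, 0 < i → cseq (Fin N × ℕ) T i = 0 := fun i hi => cseq_of_zero (hT0 i hi)
  have hr := Ω₁.mlf_ruling w₁ G₁
  have hconv : conv Bs (Ω₁.ruling w₁ G₁) = fun k => B.map C * Ω₁.ruling w₁ G₁ k := by
    rw [hBs, conv_const_left (B.map C)]
    rfl
  have hM' : MLF (conv Bs (Ω₁.ruling w₁ G₁)) := by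
    rw [hconv]
    exact hr.mul_left _
  have hq' := mlf_posPart_conv (fun i => Ω₂.hat_of_pos (w := w')) hM'
  obtain ⟨ha, hact, he, hp, hcc⟩ := Ω₁.act_spec Ω₂ hb₁ hu₁ hw hpot₁ hw' (T := T) (B := Bs)
    (fun i hi => hB0 i hi.ne) hT'
    (JLF.of_right hTn (fun _ => Ω₁.hat_of_pos) hr)
    (MLF.conv_neg hTn fun _ => Ω₁.hat_of_pos) hr.conv_right
    (JLF.of_right (fun _ => Ω₂.hat_of_pos) (fun i hi => hB0 i hi.ne') hr)
    (MLF.conv_neg (fun _ => Ω₂.hat_of_pos) fun i hi => hB0 i hi.ne')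
    hM'.conv_right (JLF.of_right (fun _ => Ω₂.lhat_of_pos) (fun _ => Ω₂.hat_of_pos) hM')
    (JLF.of_right (fun _ => Ω₂.hat_of_pos) (fun _ => Ω₂.lhat_of_pos) hq') hq'.conv_right
  refine ⟨ha, ?_⟩
  have hccn : ∀ n, cc (conv Bs (Ω₁.ruling w₁ G₁) n) = if n = 1 then - col X₂.unit else 0 := by
    intro n
    rw [hcc]
    split_ifs with h
    · rw [h, sub_self, hBs]
      beta_reduce
      rw [if_pos rfl, cc_mapC, hB]
    · rw [hB0 _ (by omega), cc_zero, Matrix.zero_mul, neg_zero]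
  have hcf : ∀ b : ℕ, cc (col (act T G₁.genericPoint b)) = col (G₂.basePoint b) := by
    intro b
    rw [hact, cc_conv _ _ _ (b - 1), hccn, if_pos (by ring)]
    · match b with
      | 0 =>
        -- At the base point the z^0 coefficient of S_{w'} (-zA) is Ω^0_0 A, the base of the second
        -- cone.
        have h1 := Ω₂.hat_neg_natCast (w := w') 1
        rw [Nat.cast_one] at h1
        rw [Nat.cast_zero, zero_sub, h1, cc_substM hw', pow_one, Matrix.mul_neg, ← Matrix.neg_mul]
        have h2 : - cc ((-1 : Fun N) • Ω₂.mat 1) = cc (Ω₂.mat 1) := by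
          ext1 a b
          simp [cc_apply]
        rw [h2, cc_mat_one_mul_unit, ← hb₂]
        rfl
      | 1 =>
        rw [Nat.cast_one, sub_self, Ω₂.hat_zero hw', cc_one, Matrix.one_mul, ← hu₂]
        rfl
      | b + 2 =>
        rw [Ω₂.hat_of_pos (by omega), cc_zero, Matrix.zero_mul]
        ext1 β u
        rw [col_apply, GraphGerm.basePoint, if_neg (by omega), if_neg (by omega)]
        rfl
    · intro j hj
      rw [hccn, if_neg (by omega), Matrix.mul_zero]
  set y : Fin N × ℕ → BigFun N := fun s =>
    (act T G₁.genericPoint).q s.2 s.1 - C (G₂.basePoint s.2 s.1) with hy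
  have hy0 : ∀ s, constantCoeff (y s) = 0 := fun s => constantCoeff_displacement (hcf s.2) s.1
  have hyl : LocallyFinite y := by
    have h1 : LocallyFinite fun s : Fin N × ℕ => (act T G₁.genericPoint).q s.2 s.1 := by
      refine LocallyFinite.of_fst fun β => ?_
      have h2 := (hq' β ()).comp_injective Nat.cast_injective
      have h3 : (fun k : ℕ => posPart (conv (Ω₂.hat w') (conv Bs (Ω₁.ruling w₁ G₁))) k β ()) =
          fun k => (act T G₁.genericPoint).q k β := by
        funext k
        rw [posPart_of_nonneg (by omega), ← hact]
        rfl
      rw [← h3]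
      exact h2
    have h2 : LocallyFinite fun s : Fin N × ℕ => (C (- G₂.basePoint s.2 s.1) : BigFun N) := by
      refine LocallyFinite.of_support (Set.univ ×ˢ Set.Iio 2)
        (Set.finite_univ.prod (Set.finite_Iio 2)) fun p hp => ?_
      have hp : ¬ p.2 < 2 := fun h => hp ⟨trivial, h⟩
      rw [GraphGerm.basePoint, if_neg (by omega), if_neg (by omega), neg_zero, map_zero]
    have h3 := h1.add h2
    simpa only [map_neg, ← sub_eq_add_neg] using h3
  -- All displacements vanish at the base point and form a locally finite family, so every power
  -- series can be evaluated at y.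
  have hR := reach_finite hy0 hyl
  have hyM : MLF fun k => (col fun β => y (β, k) : Matrix (Fin N) Unit (BigFun N)) :=
    fun β _ => hyl.fst β
  have hw₂' := hw₂.isEulerLagrange
  refine contains_of hb₂ hu₂ hw₂' hpot₂ (y := y) (fun s => rfl)
    (fun β => ⟨hy0 _, hy0 _⟩) hw' (hyM.mul_left _)
    (fun k => Or.inl fun β => mem_orderIdeal_one.2 (hy0 _)) he hp
    (FAdm.of_reach_finite hR ?_) (fun α => ?_)
    (fun α => FAdm.of_reach_finite hR ((locallyFinite_q G₂).mul_left _))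
    (fun a α => FAdm.of_reach_finite hR ((locallyFinite_q G₂).mul_left _))
  · intro d
    refine (Finsupp.finite_of_degree_le d.degree).subset fun m hm => ?_
    exact le_degree_of_mem_orderIdeal (ypow_mem_orderIdeal
      (fun s => mem_orderIdeal_one.2 (hw₂'.1 s)) m) hm
  · rw [← mem_orderIdeal_one]
    refine formalSum_mem_orderIdeal fun m => ?_
    rw [substTerm_eq]
    by_cases hm : m = 0
    · rw [hm, coeff_zero_eq_constantCoeff_apply, hw₂'.1, map_zero, zero_mul]
      exact zero_mem _
    · exact Ideal.mul_mem_left _ _ (orderIdeal_anti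
        (Nat.one_le_iff_ne_zero.2 fun h => hm ((Finsupp.degree_eq_zero_iff m).1 h))
        (ypow_mem_orderIdeal (fun s => mem_orderIdeal_one.2 (hy0 s)) m))

end FlatFManifold.Calibration

/-! ### Weights of exponents -/

section Weights

variable {N : ℕ}

/-- The weight of an exponent, where the variable `t_b` has weight `c b`. -/
def wgt (c : ℕ → ℕ) : (Fin N × ℕ →₀ ℕ) →+ ℕ :=
  Finsupp.liftAddHom fun p => AddMonoidHom.mulLeft (c p.2)

theorem wgt_single (c : ℕ → ℕ) (p : Fin N × ℕ) (n : ℕ) :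
    wgt c (Finsupp.single p n) = c p.2 * n := by
  rw [wgt, Finsupp.liftAddHom_apply_single]
  rfl

theorem mul_le_wgt (c : ℕ → ℕ) (m : Fin N × ℕ →₀ ℕ) (p : Fin N × ℕ) :
    c p.2 * m p ≤ wgt c m := by
  have hle : Finsupp.single p (m p) ≤ m := by rw [Finsupp.single_le_iff]
  obtain ⟨e, he⟩ := exists_add_of_le hle
  have h := congrArg (wgt c) he
  rw [map_add, wgt_single] at h
  omega

/-- The total degree in the variables `t_0`. -/
def zeroDegree : (Fin N × ℕ →₀ ℕ) →+ ℕ := wgt fun b => if b = 0 then 1 else 0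

/-- The total degree in the variables `t_0` and `t_1`. -/
def smallDegree : (Fin N × ℕ →₀ ℕ) →+ ℕ := wgt fun b => if b ≤ 1 then 1 else 0

/-- The total weight, where `t_b` has weight `b - 1` for `b ≥ 1`. -/
def excess : (Fin N × ℕ →₀ ℕ) →+ ℕ := wgt fun b => b - 1

theorem zeroDegree_le (m : Fin N × ℕ →₀ ℕ) : zeroDegree m ≤ smallDegree m := by
  induction m using exponent_induction with
  | h0 => rw [map_zero, map_zero]
  | h1 m s ih =>
    rw [map_add, map_add, zeroDegree, smallDegree, wgt_single, wgt_single] at *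
    refine add_le_add ih ?_
    split_ifs <;> omega

/-- `smallDegree` bounds the multiplicities of t_0 and t_1. For b ≥ 2 each t_b has excess b - 1 ≥ 1,
so `excess` bounds both the multiplicity and the index b. -/
theorem finite_of_weights (K : ℕ) :
    {m : Fin N × ℕ →₀ ℕ | excess m ≤ K ∧ smallDegree m ≤ K}.Finite := by
  classical
  refine (Set.finite_Iic (∑ p ∈ (Finset.univ : Finset (Fin N)) ×ˢ Finset.range (K + 2),
    Finsupp.single p K)).subset fun m hm p => ?_
  obtain ⟨h1, h2⟩ := hm
  have h3 := (mul_le_wgt _ m p).trans h1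
  have h4 := (mul_le_wgt _ m p).trans h2
  by_cases h0 : m p = 0
  · rw [h0]
    exact Nat.zero_le _
  · have h5 : m p ≤ K ∧ p.2 < K + 2 := by
      by_cases hp : p.2 ≤ 1
      · rw [if_pos hp] at h4
        omega
      · have h6 := Nat.le_mul_of_pos_left (m p) (show 0 < p.2 - 1 by omega)
        have h7 := Nat.le_mul_of_pos_right (p.2 - 1) (Nat.pos_of_ne_zero h0)
        omega
    rw [Finsupp.finsetSum_apply, Finset.sum_eq_single_of_mem p
      (Finset.mem_product.2 ⟨Finset.mem_univ _, Finset.mem_range.2 h5.2⟩)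
      fun t _ ht => by simp [ht], Finsupp.single_eq_same]
    exact h5.1

/-- Up to total degree `n`, every exponent of `f` has at least `k` more factors `t_0` than its
excess. -/
def WtGE (n k : ℕ) (f : BigFun N) : Prop :=
  ∀ m, m.degree < n → coeff m f ≠ 0 → excess m + k ≤ zeroDegree m

theorem WtGE.mul {n k l : ℕ} {f g : BigFun N} (hf : WtGE n k f) (hg : WtGE n l g) :
    WtGE n (k + l) (f * g) := fun m hm h => by
  obtain ⟨a, b, rfl, ha, hb⟩ := exists_coeff_ne_zero_of_mul h
  rw [map_add] at hm
  have h1 := hf a (by omega) ha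
  have h2 := hg b (by omega) hb
  rw [map_add, map_add]
  omega

theorem WtGE.C_mul {n k : ℕ} {f : BigFun N} (hf : WtGE n k f) (c : ℂ) : WtGE n k (C c * f) :=
  fun m hm h => hf m hm (by
    rw [coeff_C_mul] at h
    exact right_ne_zero_of_mul h)

theorem WtGE.formalSum {ι : Type*} {n k : ℕ} {f : ι → BigFun N} (hf : ∀ i, WtGE n k (f i)) :
    WtGE n k (FlatF.formalSum f) := fun m hm h => by
  by_contra h1
  refine h (finsum_eq_zero_of_forall_eq_zero fun i => ?_)
  by_contra h2
  exact h1 (hf i m hm h2)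

theorem WtGE.ypow {ι : Type*} {n : ℕ} {w : ι → BigFun N} (hw : ∀ i, WtGE n 1 (w i))
    (m : ι →₀ ℕ) : WtGE n m.degree (FlatF.ypow w m) := by
  classical
  induction m using exponent_induction with
  | h0 =>
    rw [ypow_zero]
    intro m _ h
    rw [coeff_one] at h
    rw [(ite_ne_right_iff.1 h).1]
    simp
  | h1 m s ih =>
    rw [ypow_add_single, map_add, Finsupp.degree_single]
    exact ih.mul (hw s)

theorem WtGE.subst {ν : Type*} [Finite ν] {n k : ℕ} {w : ν → BigFun N}
    (h0 : ∀ i, constantCoeff (w i) = 0) (hw : ∀ i, WtGE n 1 (w i)) {f : MvPowerSeries ν ℂ}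
    (hf : f ∈ orderIdeal k) : WtGE n k (MvPowerSeries.subst w f) := by
  rw [subst_eq_formalSum h0]
  refine WtGE.formalSum fun m => ?_
  by_cases hm : m.degree < k
  · rw [hf m hm, map_zero, zero_mul]
    exact fun _ _ h => absurd (map_zero _) h
  · refine WtGE.C_mul (fun e he h => ?_) _
    have := WtGE.ypow hw m e he h
    omega

/-- Only the displacements of t_0 and t_1 are known to lack constant terms; factors t_b with b ≥ 2
contribute no order. -/
theorem ypow_mem_orderIdeal_smallDegree {τ : Type*} {y : Fin N × ℕ → MvPowerSeries τ ℂ}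
    (hy : ∀ β, constantCoeff (y (β, 0)) = 0 ∧ constantCoeff (y (β, 1)) = 0)
    (m : Fin N × ℕ →₀ ℕ) : ypow y m ∈ orderIdeal (smallDegree m) := by
  induction m using exponent_induction with
  | h0 => simpa using mem_orderIdeal_zero _
  | h1 m s ih =>
    rw [ypow_add_single, map_add]
    refine mul_mem_orderIdeal ih ?_
    rw [smallDegree, wgt_single, mul_one]
    obtain ⟨β, b⟩ := s
    match b with
    | 0 => exact mem_orderIdeal_one.2 (hy β).1
    | 1 => exact mem_orderIdeal_one.2 (hy β).2
    | b + 2 =>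
      rw [if_neg (by simp)]
      exact mem_orderIdeal_zero _

end Weights

theorem locallyFinite_of_orderIdeal {σ : Type*} {f : ℕ → MvPowerSeries σ ℂ}
    (h : ∀ k, f k ∈ orderIdeal k) : LocallyFinite f := fun d =>
  (Set.finite_Iic d.degree).subset fun k hk => le_degree_of_mem_orderIdeal (h k) hk

theorem FAdm.subst {ι ν σ τ : Type*} [Finite ν] {w : ν → MvPowerSeries σ ℂ}
    (hw : ∀ i, constantCoeff (w i) = 0) {y : σ → MvPowerSeries τ ℂ}
    (ha : FAdm y fun m => ypow w m) {f : ι → MvPowerSeries ν ℂ} (hf : LocallyFinite f) :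
    FAdm y fun i => MvPowerSeries.subst w (f i) := fun d => by
  refine ((ha d).biUnion fun p _ => (hf p.1).image fun i => (i, p.2)).subset ?_
  rintro ⟨i, e⟩ ⟨he, h⟩
  dsimp only at h he
  rw [subst_eq_formalSum hw] at h
  obtain ⟨m, hm⟩ : ∃ m, coeff e (C (coeff m (f i)) * ypow w m) ≠ 0 := by
    by_contra! h1
    exact h (finsum_eq_zero_of_forall_eq_zero h1)
  rw [coeff_C_mul] at hm
  exact Set.mem_biUnion (x := (m, e)) ⟨he, right_ne_zero_of_mul hm⟩
    ⟨i, left_ne_zero_of_mul hm, rfl⟩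

/-! ### Normalized calibrations -/

theorem mlf_of_orderIdeal {σ l m : Type*} {A : ℤ → Matrix l m (MvPowerSeries σ ℂ)}
    (h0 : ∀ i, 0 < i → A i = 0) (h : ∀ (k : ℕ) a b, A (-k) a b ∈ orderIdeal k) : MLF A :=
  fun a b d => by
    refine ((locallyFinite_of_orderIdeal fun k => h k a b) d).image (fun k : ℕ => (-k : ℤ))
      |>.subset fun i hi => ?_
    by_cases hp : 0 < i
    · refine absurd ?_ hi
      beta_reduce
      rw [h0 i hp]
      exact map_zero _
    · obtain ⟨k, rfl⟩ := Int.exists_eq_neg_ofNat (show i ≤ 0 by omega)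
      exact ⟨k, hi, rfl⟩

namespace FlatFManifold.Calibration

variable {N : ℕ} {X : FlatFManifold N} (Ω : X.Calibration)

/-- All the matrices of the calibration but the first vanish at the base point. -/
def IsNormalized : Prop := ∀ k, cc (Ω.mat (k + 1)) = 0

variable {Ω}

theorem cc_lower_succ (h : Ω.IsNormalized) (k : ℕ) : cc (Ω.lower (k + 1)) = 0 := by
  let φ : Matrix (Fin N) (Fin N) (Fun N) →+* Matrix (Fin N) (Fin N) ℂ :=
    (constantCoeff (σ := Fin N) (R := ℂ)).mapMatrix
  have h1 : PowerSeries.map φ (altS Ω.series) = 1 := by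
    ext1 k
    rw [PowerSeries.coeff_map, coeff_altS, series, PowerSeries.coeff_mk, PowerSeries.coeff_one]
    split_ifs with hk
    · rw [hk, Ω.mat_zero, pow_zero, one_smul, map_one]
    · obtain ⟨j, rfl⟩ := Nat.exists_eq_succ_of_ne_zero hk
      ext1 a b
      have h2 : constantCoeff (Ω.mat (j + 1) a b) = 0 := congrFun (congrFun (h j) a) b
      change constantCoeff ((-1 : Fun N) ^ (j + 1) * Ω.mat (j + 1) a b) = 0
      rw [map_mul, h2, mul_zero]
  have h2 := congrArg (PowerSeries.map φ) Ω.lowerSeries_mul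
  rw [map_mul, h1, mul_one, map_one] at h2
  have h3 := congrArg (PowerSeries.coeff (k + 1)) h2
  rwa [PowerSeries.coeff_map, lowerSeries, PowerSeries.coeff_mk, PowerSeries.coeff_one,
    if_neg (by omega)] at h3

/-- For a normalized calibration the k-th matrix is a k-fold iterated integral from the base point,
and each integration raises the order by one. -/
theorem mat_mem_orderIdeal (h : Ω.IsNormalized) (k : ℕ) (α β : Fin N) :
    Ω.mat k α β ∈ orderIdeal k := by
  induction k generalizing α β with
  | zero => exact mem_orderIdeal_zero _
  | succ k ih =>
    refine mem_orderIdeal_of_pderiv (congrFun (congrFun (h k) α) β) fun γ => ?_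
    rw [Ω.deriv]
    exact sum_mem fun μ _ => Ideal.mul_mem_left _ _ (ih α μ)

theorem lower_mem_orderIdeal (h : Ω.IsNormalized) (k : ℕ) (α β : Fin N) :
    Ω.lower k α β ∈ orderIdeal k := by
  induction k generalizing α β with
  | zero => exact mem_orderIdeal_zero _
  | succ k ih =>
    refine mem_orderIdeal_of_pderiv (congrFun (congrFun (cc_lower_succ h k) α) β) fun γ => ?_
    rw [← pdM_apply, Ω.pdM_lower_succ, Matrix.mul_apply]
    exact sum_mem fun μ _ => Ideal.mul_mem_left _ _ (ih μ β)

theorem two_mem_orderIdeal (h : Ω.IsNormalized) (a b : ℕ) (α β : Fin N) :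
    Ω.two a b α β ∈ orderIdeal (a + b + 1) := by
  rw [two, Matrix.sum_apply]
  refine sum_mem fun i hi => ?_
  have hi := Finset.mem_range.1 hi
  rw [neg_one_pow_mul_eq_smul, Matrix.smul_apply, Matrix.mul_apply]
  refine Ideal.mul_mem_left _ _ (sum_mem fun μ _ => ?_)
  exact orderIdeal_anti (by omega)
    (mul_mem_orderIdeal (mat_mem_orderIdeal h (a + (b - i) + 1) α μ) (lower_mem_orderIdeal h i μ β))

theorem mlf_hat (h : Ω.IsNormalized) {σ : Type*} {w : Fin N → MvPowerSeries σ ℂ}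
    (hw : ∀ i, constantCoeff (w i) = 0) : MLF (Ω.hat w) :=
  mlf_of_orderIdeal (fun _ => Ω.hat_of_pos) fun k a b => by
    rw [hat_neg_natCast, substM_neg_one_pow_smul hw]
    exact Ideal.mul_mem_left _ _ (subst_mem_orderIdeal hw (mat_mem_orderIdeal h k a b))

theorem mlf_lhat (h : Ω.IsNormalized) {σ : Type*} {w : Fin N → MvPowerSeries σ ℂ}
    (hw : ∀ i, constantCoeff (w i) = 0) : MLF (Ω.lhat w) :=
  mlf_of_orderIdeal (fun _ => Ω.lhat_of_pos) fun k a b => by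
    rw [lhat_neg_natCast]
    exact subst_mem_orderIdeal hw (lower_mem_orderIdeal h k a b)

theorem shiftedOrig_eq_zero (h : Ω.IsNormalized) : Ω.shiftedOrig = 0 := by
  have h1 := Ω.cc_mat_one_mul_unit
  rw [h 0, Matrix.zero_mul] at h1
  exact col_injective h1.symm

/-- In w = t_0 + Σ Ω^0_k(w) t_{k+1} the factor Ω^0_k has order k + 1, hence k + 1 surplus factors
t_0 by induction, while t_{k+1} raises the excess by k. At least one surplus factor remains. The
truncation by total degree makes the induction possible, since w occurs on both sides. -/
theorem IsEulerLagrange.wtGE (hN : Ω.IsNormalized) {w : Fin N → BigFun N}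
    (hw : Ω.IsEulerLagrange w) (n : ℕ) (α : Fin N) : WtGE n 1 (w α) := by
  classical
  induction n generalizing α with
  | zero => exact fun m hm => absurd hm (Nat.not_lt_zero _)
  | succ n ih =>
    intro m hm h
    have h1 := hw.2
    rw [Ω.eulerLagrange_sum hw.1, sub_eq_zero] at h1
    have h2 : w α = (xv N 0 + msum fun k => substM w (Ω.lower (k + 1)) * xv N (k + 1)) α () :=
      (congrFun (congrFun h1 α) ()).symm
    rw [h2, Matrix.add_apply, map_add] at h
    have hX : ∀ (s : Fin N × ℕ) (e : Fin N × ℕ →₀ ℕ), coeff e (MvPowerSeries.X s : BigFun N) ≠ 0 →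
        e = Finsupp.single s 1 := fun s e he => by
      rw [coeff_X] at he
      exact (ite_ne_right_iff.1 he).1
    by_cases h3 : coeff m (xv N 0 α ()) = 0
    · rw [h3, zero_add, msum_apply, coeff_formalSum] at h
      obtain ⟨k, hk⟩ : ∃ k, coeff m ((substM w (Ω.lower (k + 1)) * xv N (k + 1)) α ()) ≠ 0 := by
        by_contra! h4
        exact h (finsum_eq_zero_of_forall_eq_zero h4)
      rw [Matrix.mul_apply, map_sum] at hk
      obtain ⟨β, -, hβ⟩ := Finset.exists_ne_zero_of_sum_ne_zero hk
      obtain ⟨a, b, rfl, ha, hb⟩ := exists_coeff_ne_zero_of_mul hβ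
      obtain rfl := hX _ _ hb
      rw [map_add, Finsupp.degree_single] at hm
      have h5 := WtGE.subst hw.1 (fun i => ih i) (lower_mem_orderIdeal hN (k + 1) α β) a
        (by omega) ha
      rw [map_add, map_add, excess, zeroDegree, wgt_single, wgt_single] at *
      simp only [Nat.add_eq_zero_iff, one_ne_zero, and_false, if_false] at h5 ⊢
      omega
    · obtain rfl := hX _ _ h3
      rw [excess, zeroDegree, wgt_single, wgt_single]
      simp

end FlatFManifold.Calibration

/-! ### Transport of cones by upper triangular operators -/

namespace FlatFManifold.Calibration

variable {N : ℕ} {X₁ X₂ : FlatFManifold N} (Ω₁ : X₁.Calibration) (Ω₂ : X₂.Calibration)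

/-- The action of `G_+` on cones. -/
theorem isImage_of_upper (hN₁ : Ω₁.IsNormalized) (hN₂ : Ω₂.IsNormalized)
    {G₁ G₂ : GraphGerm N} (h₁ : Ω₁.IsConeOf G₁) (h₂ : Ω₂.IsConeOf G₂)
    {w : Fin N → BigFun N} (hw : Ω₁.IsEulerLagrange w)
    {w' : Fin N → BigFun N} (hw' : ∀ α, constantCoeff (w' α) = 0)
    {T : ℤ → Matrix (Fin N) (Fin N) ℂ} (hT0 : ∀ i < 0, T i = 0)
    {B : ℤ → Matrix (Fin N) (Fin N) (BigFun N)} (hB0 : ∀ i < 0, B i = 0)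
    (hB : cc (B 0) * col X₁.unit = col X₂.unit)
    (hT : conv (cseq _ T) (Ω₁.hat w) = conv (Ω₂.hat w') B) :
    IsImage T G₁ G₂ := by
  obtain ⟨hb₁, hu₁, w₁, hw₁, hpot₁⟩ := h₁
  obtain ⟨hb₂, hu₂, w₂, hw₂, hpot₂⟩ := h₂
  obtain rfl : w₁ = w := hw₁.unique hw.isTopologicalSolution
  have hTn : ∀ i < 0, cseq (Fin N × ℕ) T i = 0 := fun i hi => cseq_of_zero (hT0 i hi)
  have hr : ∀ i < 0, Ω₁.ruling w₁ G₁ i = 0 := fun i => Ω₁.ruling_of_neg w₁ G₁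
  have m1 := mlf_hat hN₁ hw.1
  have m2 := mlf_hat hN₂ hw'
  have m3 := mlf_lhat hN₂ hw'
  obtain ⟨ha, hact, he, hp, hcc⟩ := Ω₁.act_spec Ω₂ hb₁ hu₁ hw hpot₁ hw' (T := T) (B := B)
    hB0 hT (JLF.of_mid hTn m1 hr) m1.conv_right m1.conv_left (JLF.of_first m2 hB0 hr)
    m2.conv_left m2.conv_left (JLF.of_left m3 m2) (JLF.of_left m2 m3) m3.conv_left
  refine ⟨ha, ?_⟩
  have hccn : ∀ n ≤ 1, cc (conv B (Ω₁.ruling w₁ G₁) n) = if n = 1 then - col X₂.unit else 0 := by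
    intro n hn
    rw [hcc]
    split_ifs with h
    · rw [h, sub_self, hB]
    · rw [hB0 _ (by omega), cc_zero, Matrix.zero_mul, neg_zero]
  have hcf : ∀ b : ℕ, b ≤ 1 → cc (col (act T G₁.genericPoint b)) = col (G₂.basePoint b) := by
    intro b hb
    rw [hact, cc_conv _ _ _ 0, Ω₂.hat_zero hw', cc_one, Matrix.one_mul, sub_zero, hccn _ (by omega)]
    · match b with
      | 0 =>
        rw [if_neg (by simp)]
        ext1 β u
        rw [col_apply, GraphGerm.basePoint, if_pos rfl, hb₂, shiftedOrig_eq_zero hN₂]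
        rfl
      | 1 =>
        rw [if_pos (by simp), ← hu₂]
        rfl
    · intro j hj
      rcases lt_or_gt_of_ne hj with hj | hj
      · obtain ⟨k, rfl⟩ : ∃ k : ℕ, j = -(k + 1 : ℕ) := ⟨(-j - 1).toNat, by omega⟩
        rw [hat_neg_natCast, cc_substM hw']
        have h2 : cc ((-1 : Fun N) ^ (k + 1) • Ω₂.mat (k + 1)) = 0 := by
          ext1 a b
          have h3 : constantCoeff (Ω₂.mat (k + 1) a b) = 0 := congrFun (congrFun (hN₂ k) a) b
          rw [cc_apply, Matrix.smul_apply, smul_eq_mul, map_mul, h3, mul_zero]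
          rfl
        rw [h2, Matrix.zero_mul]
      · rw [Ω₂.hat_of_pos hj, cc_zero, Matrix.zero_mul]
  set y : Fin N × ℕ → BigFun N := fun s =>
    (act T G₁.genericPoint).q s.2 s.1 - C (G₂.basePoint s.2 s.1) with hy
  have hy0 : ∀ β, constantCoeff (y (β, 0)) = 0 ∧ constantCoeff (y (β, 1)) = 0 := fun β =>
    ⟨constantCoeff_displacement (hcf 0 (by omega)) β,
      constantCoeff_displacement (hcf 1 le_rfl) β⟩
  have hw₂' := hw₂.isEulerLagrange
  have hsm : ∀ d m, m ∈ Reach y d → smallDegree m ≤ d.degree := by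
    rintro d m ⟨e, he, h⟩
    exact (le_degree_of_mem_orderIdeal (ypow_mem_orderIdeal_smallDegree hy0 m) h).trans
      (Finsupp.degree_mono he)
  have hlow : MLF Ω₂.lower := fun a b =>
    locallyFinite_of_orderIdeal fun k => lower_mem_orderIdeal hN₂ k a b
  -- A reachable exponent e has `smallDegree` at most |d|. If it occurs in w^m, then excess plus |m|
  -- is at most `zeroDegree`, hence at most |d| too. Only finitely many pairs (m, e) satisfy these
  -- bounds.
  have hfa : FAdm y fun m => ypow w₂ m := by
    intro d
    refine ((Finsupp.finite_of_degree_le (σ := Fin N) d.degree).prod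
      (finite_of_weights d.degree)).subset ?_
    rintro ⟨m, e⟩ ⟨he, h⟩
    have h1 := WtGE.ypow (fun i => hw₂'.wtGE hN₂ (e.degree + 1) i) m e (Nat.lt_succ_self _) h
    have h2 := zeroDegree_le e
    have h3 := hsm d e he
    exact ⟨show m.degree ≤ d.degree by omega, show excess e ≤ d.degree by omega, h3⟩
  have haq : ∀ b β, Adm y (G₂.q b β) := fun b β => (adm_X _).add (adm_C _)
  refine contains_of hb₂ hu₂ hw₂' hpot₂ (y := y) (fun s => rfl) hy0 hw' ?_ (fun k => ?_) he hp hfa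
    (fun α => ?_) (fun α => ?_) (fun a α => ?_)
  · refine MLF.mul_right (fun a b => ?_) _
    exact locallyFinite_of_orderIdeal fun k =>
      subst_mem_orderIdeal hw' (lower_mem_orderIdeal hN₂ k a b)
  · match k with
    | 0 => exact Or.inl fun β => mem_orderIdeal_one.2 (hy0 β).2
    -- The displacement of t_{k+2} may contain a constant, but Ω^0_{k+1} has order at least two.
    | k + 1 => exact Or.inr fun α β => orderIdeal_anti (by omega) (lower_mem_orderIdeal hN₂ _ α β)
  · rw [← mem_orderIdeal_one]
    refine formalSum_mem_orderIdeal fun m => ?_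
    rw [substTerm_eq]
    by_cases hm : coeff m (w₂ α) = 0
    · rw [hm, map_zero, zero_mul]
      exact zero_mem _
    · have h1 := hw₂'.wtGE hN₂ (m.degree + 1) α m (Nat.lt_succ_self _) hm
      have h2 := zeroDegree_le m
      exact Ideal.mul_mem_left _ _ (orderIdeal_anti (by omega)
        (ypow_mem_orderIdeal_smallDegree hy0 m))
  · refine FAdm.mul_right (FAdm.subst hw₂'.1 hfa ?_) fun p => haq _ _
    exact LocallyFinite.of_fst fun β => hlow α β
  · refine FAdm.mul_right (FAdm.subst hw₂'.1 hfa ?_) fun p => haq _ _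
    exact LocallyFinite.of_fst fun β => locallyFinite_of_orderIdeal fun k =>
      orderIdeal_anti (by omega) (two_mem_orderIdeal hN₂ a k α β)

end FlatFManifold.Calibration

/-! ### The ring of vector fields and its idempotents -/

namespace FlatFManifold

variable {N : ℕ}

/-- Formal vector fields on a flat F-manifold. -/
def Tan (X : FlatFManifold N) : Type := Fin N → Fun N

variable {X : FlatFManifold N}

/-- Only the additive structure is inherited: the function type carries the pointwise product, and
`Tan` keeps it apart from the product of vector fields. -/
instance : AddCommGroup X.Tan := inferInstanceAs (AddCommGroup (Fin N → Fun N))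

/-- The product of vector fields. -/
instance : Mul X.Tan := ⟨fun u v α => ∑ β, ∑ γ, X.c α β γ * (u β * v γ)⟩

/-- The unit vector field. -/
instance : One X.Tan := ⟨fun α => C (X.unit α)⟩

theorem tan_mul_apply (u v : X.Tan) (α : Fin N) :
    (u * v) α = ∑ β, ∑ γ, X.c α β γ * (u β * v γ) := rfl

theorem tan_mul_comm (u v : X.Tan) : u * v = v * u := by
  funext α
  rw [tan_mul_apply, tan_mul_apply, Finset.sum_comm]
  refine Finset.sum_congr rfl fun γ _ => Finset.sum_congr rfl fun β _ => ?_
  rw [X.c_comm, mul_comm (u β)]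

theorem tan_add_mul (u v w : X.Tan) : (u + v) * w = u * w + v * w := by
  funext α
  change (∑ β, ∑ γ, X.c α β γ * ((u β + v β) * w γ)) = (u * w) α + (v * w) α
  simp only [tan_mul_apply, add_mul, mul_add, Finset.sum_add_distrib]

theorem tan_one_mul (u : X.Tan) : 1 * u = u := by
  funext α
  rw [tan_mul_apply, Finset.sum_comm]
  have h : ∀ γ, ∑ β, X.c α β γ * ((1 : X.Tan) β * u γ) = if α = γ then u γ else 0 := by
    intro γ
    have h1 := X.sum_unit_c α γ
    have h2 : ∑ β, X.c α β γ * ((1 : X.Tan) β * u γ) = (∑ β, C (X.unit β) * X.c α β γ) * u γ := by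
      rw [Finset.sum_mul]
      refine Finset.sum_congr rfl fun β _ => ?_
      change X.c α β γ * (C (X.unit β) * u γ) = _
      ring
    rw [h2, h1, ite_mul, one_mul, zero_mul]
  refine (Finset.sum_congr rfl fun γ _ => h γ).trans ?_
  refine (Finset.sum_eq_single α (fun γ _ hγ => if_neg hγ.symm) fun h => ?_).trans (if_pos rfl)
  exact absurd (Finset.mem_univ α) h

/-- The associativity axiom says that u(vw) is symmetric in u and v; together with commutativity
this is associativity. -/
theorem tan_mul_assoc (u v w : X.Tan) : u * v * w = u * (v * w) := by
  have key : ∀ u v w : X.Tan, ∀ α, (u * (v * w)) α =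
      ∑ β, ∑ γ, ∑ δ, (∑ μ, X.c α β μ * X.c μ γ δ) * (u β * v γ * w δ) := by
    intro u v w α
    simp only [tan_mul_apply, Finset.mul_sum, Finset.sum_mul]
    refine Finset.sum_congr rfl fun β _ => ?_
    rw [Finset.sum_comm]
    refine Finset.sum_congr rfl fun γ _ => ?_
    rw [Finset.sum_comm]
    refine Finset.sum_congr rfl fun δ _ => Finset.sum_congr rfl fun μ _ => ?_
    ring
  have h1 : ∀ u v w : X.Tan, u * (v * w) = v * (u * w) := by
    intro u v w
    funext α
    rw [key, key, Finset.sum_comm]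
    refine Finset.sum_congr rfl fun γ _ => Finset.sum_congr rfl fun β _ =>
      Finset.sum_congr rfl fun δ _ => ?_
    have := FlatFManifold.assoc_axiom X α β γ δ
    change ∑ μ, X.c α β μ * X.c μ γ δ = ∑ μ, X.c α γ μ * X.c μ β δ at this
    rw [this, mul_comm (u β)]
  rw [tan_mul_comm (u * v), h1 w u v, tan_mul_comm w v]

instance : CommRing X.Tan :=
  { (inferInstance : AddCommGroup X.Tan) with
    mul := (· * ·)
    one := 1
    mul_assoc := tan_mul_assoc
    mul_comm := tan_mul_comm
    one_mul := tan_one_mul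
    mul_one := fun u => by rw [tan_mul_comm, tan_one_mul]
    left_distrib := fun u v w => by
      rw [tan_mul_comm, tan_add_mul, tan_mul_comm v, tan_mul_comm w]
    right_distrib := tan_add_mul
    zero_mul := fun u => by
      have h := tan_add_mul 0 0 u
      rw [add_zero] at h
      exact left_eq_add.1 h
    mul_zero := fun u => by
      have h := tan_add_mul 0 0 u
      rw [add_zero] at h
      rw [tan_mul_comm]
      exact left_eq_add.1 h }

/-- The ideal of vector fields of order at least `k`. -/
def tanOrder (X : FlatFManifold N) (k : ℕ) : Ideal X.Tan where
  carrier := {u | ∀ α, u α ∈ orderIdeal k}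
  zero_mem' := fun _ => zero_mem _
  add_mem' := fun hu hv α => add_mem (hu α) (hv α)
  smul_mem' := fun u v hv α => by
    change (u * v) α ∈ _
    rw [tan_mul_apply]
    exact sum_mem fun β _ => sum_mem fun γ _ =>
      Ideal.mul_mem_left _ _ (Ideal.mul_mem_left _ _ (hv γ))

theorem mem_tanOrder {k : ℕ} {u : X.Tan} : u ∈ X.tanOrder k ↔ ∀ α, u α ∈ orderIdeal k := Iff.rfl

theorem mul_mem_tanOrder {j k : ℕ} {u v : X.Tan} (hu : u ∈ X.tanOrder j) (hv : v ∈ X.tanOrder k) :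
    u * v ∈ X.tanOrder (j + k) := fun α => by
  rw [tan_mul_apply]
  exact sum_mem fun β _ => sum_mem fun γ _ =>
    Ideal.mul_mem_left _ _ (mul_mem_orderIdeal (hu β) (hv γ))

theorem eq_zero_of_tanOrder {u : X.Tan} (h : ∀ k, u ∈ X.tanOrder k → u ∈ X.tanOrder (k + 1)) :
    u = 0 := by
  have h1 : ∀ k, u ∈ X.tanOrder k := by
    intro k
    induction k with
    | zero => exact fun α => mem_orderIdeal_zero _
    | succ k ih => exact h k ih
  funext α
  exact eq_zero_of_forall_mem_orderIdeal fun k => h1 k α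

/-- Idempotents at the base point extend to the formal neighbourhood. -/
theorem exists_idempotent (e : X.Tan) (he : e * e - e ∈ X.tanOrder 1) :
    ∃ p : X.Tan, p * p = p ∧ p - e ∈ X.tanOrder 1 := by
  have hc : ∀ a : X.Tan, (∀ i, constantCoeff (a i) = constantCoeff (e i)) ↔ a - e ∈ X.tanOrder 1 := by
    intro a
    rw [mem_tanOrder]
    refine forall_congr' fun i => ?_
    rw [mem_orderIdeal_one]
    change _ ↔ constantCoeff (a i - e i) = 0
    rw [map_sub, sub_eq_zero]
  have h4 : (1 : X.Tan) - (2 * e - 1) * (2 * e - 1) ∈ X.tanOrder 1 := by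
    have : (1 : X.Tan) - (2 * e - 1) * (2 * e - 1) = (-4) * (e * e - e) := by ring
    rw [this]
    exact Ideal.mul_mem_left _ _ he
  -- A Newton step for a² = a. The derivative 2a - 1 is inverted by 2e - 1, whose square is 1 modulo
  -- vector fields vanishing at the base point.
  let Φ : X.Tan → X.Tan := fun a => a - (2 * e - 1) * (a * a - a)
  have h5 : ∀ a : X.Tan, a - e ∈ X.tanOrder 1 → Φ a - e ∈ X.tanOrder 1 := fun a ha => by
    have : Φ a - e = (a - e) * (1 - (2 * e - 1) * (a + e - 1)) - (2 * e - 1) * (e * e - e) := by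
      simp only [Φ]
      ring
    rw [this]
    exact Ideal.sub_mem _ (Ideal.mul_mem_right _ _ ha) (Ideal.mul_mem_left _ _ he)
  have h6 : ∀ k, ∀ a b : X.Tan, a - e ∈ X.tanOrder 1 → b - e ∈ X.tanOrder 1 →
      a - b ∈ X.tanOrder k → Φ a - Φ b ∈ X.tanOrder (k + 1) := fun k a b ha hb hab => by
    have : Φ a - Φ b = (a - b) *
        ((1 - (2 * e - 1) * (2 * e - 1)) - (2 * e - 1) * ((a - e) + (b - e))) := by
      simp only [Φ]
      ring
    rw [this]
    exact mul_mem_tanOrder hab (Ideal.sub_mem _ h4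
      (Ideal.mul_mem_left _ _ (Ideal.add_mem _ ha hb)))
  have h7 : ∃ p : X.Tan, (∀ i, constantCoeff (p i) = constantCoeff (e i)) ∧ Φ p = p :=
    exists_fixed_point (fun i => constantCoeff (e i)) Φ
      (fun a ha => (hc (Φ a)).2 (h5 a ((hc a).1 ha)))
      fun k a b ha hb hab => h6 k a b ((hc a).1 ha) ((hc b).1 hb) hab
  obtain ⟨p, hp, h⟩ := h7
  refine ⟨p, ?_, (hc p).1 hp⟩
  have h1 : (2 * e - 1) * (p * p - p) = 0 := by
    have h2 : p - (2 * e - 1) * (p * p - p) = p := h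
    exact sub_eq_self.1 h2
  refine sub_eq_zero.1 (eq_zero_of_tanOrder (u := (p * p - p)) fun k hk => ?_)
  -- The defect is killed by 2e - 1, so it equals itself times a factor of order one; its order
  -- therefore exceeds every bound.
  have h2 : (p * p - p) = (p * p - p) * (1 - (2 * e - 1) * (2 * e - 1)) := by
    have : (p * p - p) * (1 - (2 * e - 1) * (2 * e - 1)) =
        (p * p - p) - (2 * e - 1) * ((2 * e - 1) * (p * p - p)) := by ring
    rw [this, h1, mul_zero, sub_zero]
  rw [h2]
  exact mul_mem_tanOrder hk h4

theorem constantCoeff_tan_mul (u v : X.Tan) (α : Fin N) : constantCoeff ((u * v) α) =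
    X.mulOrig (fun β => constantCoeff (u β)) (fun β => constantCoeff (v β)) α := by
  rw [tan_mul_apply, mulOrig]
  simp only [map_sum, map_mul, mul_assoc]

/-- The matrix whose columns are the vectors of a basis. -/
def frame (π : Module.Basis (Fin N) ℂ (Fin N → ℂ)) : Matrix (Fin N) (Fin N) ℂ :=
  Matrix.of fun α k => π k α

theorem isUnit_frame (π : Module.Basis (Fin N) ℂ (Fin N → ℂ)) : IsUnit (frame π).det := by
  have h := (Pi.basisFun ℂ (Fin N)).isUnit_det π
  rw [Module.Basis.det_apply] at h
  exact h

/-- For k ≠ l the product of the lifts is an idempotent vanishing at the base point; equal to its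
own square, it has infinite order and is zero. -/
theorem exists_orthogonal_idempotents (π : Module.Basis (Fin N) ℂ (Fin N → ℂ))
    (hπ : ∀ k l, X.mulOrig (π k) (π l) = if k = l then π k else 0) :
    ∃ p : Fin N → X.Tan, (∀ k l, p k * p l = if k = l then p k else 0) ∧
      ∀ k α, constantCoeff (p k α) = π k α := by
  have h1 : ∀ k, ∃ p : X.Tan, p * p = p ∧ ∀ α, constantCoeff (p α) = π k α := by
    intro k
    let e : X.Tan := fun α => C (π k α)
    have he : ∀ α, constantCoeff (e α) = π k α := fun α => constantCoeff_C _
    obtain ⟨p, hp, h⟩ := exists_idempotent e fun α => by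
      rw [mem_orderIdeal_one]
      change constantCoeff ((e * e) α - e α) = 0
      rw [map_sub, constantCoeff_tan_mul]
      simp only [he]
      rw [hπ, if_pos rfl, sub_self]
    refine ⟨p, hp, fun α => ?_⟩
    have h2 := mem_orderIdeal_one.1 (h α)
    change constantCoeff (p α - e α) = 0 at h2
    rwa [map_sub, he, sub_eq_zero] at h2
  choose p hp hc using h1
  refine ⟨p, fun k l => ?_, hc⟩
  split_ifs with hkl
  · rw [← hkl, hp]
  · have h2 : p k * p l ∈ X.tanOrder 1 := fun α => by
      rw [mem_orderIdeal_one, constantCoeff_tan_mul]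
      simp only [hc]
      rw [hπ, if_neg hkl]
      rfl
    refine eq_zero_of_tanOrder fun j hj => ?_
    have h3 : p k * p l = (p k * p l) * (p k * p l) := by
      rw [mul_mul_mul_comm, hp, hp]
    rw [h3]
    exact mul_mem_tanOrder hj h2

/-- A frame of idempotents diagonalizes the multiplication by the coordinate vector fields. -/
theorem exists_frame (π : Module.Basis (Fin N) ℂ (Fin N → ℂ))
    (hπ : ∀ k l, X.mulOrig (π k) (π l) = if k = l then π k else 0) :
    ∃ Ψ Θ : Matrix (Fin N) (Fin N) (Fun N), Ψ * Θ = 1 ∧ Θ * Ψ = 1 ∧ cc Ψ = frame π ∧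
      ∀ γ, X.Cmat γ * Ψ = Ψ * Matrix.diagonal fun j => Θ j γ := by
  obtain ⟨p, hp, hc⟩ := exists_orthogonal_idempotents π hπ
  let Ψ : Matrix (Fin N) (Fin N) (Fun N) := Matrix.of fun α k => p k α
  have h1 : cc Ψ = frame π := by
    ext1 α k
    exact hc k α
  have h2 : IsUnit Ψ.det := by
    rw [MvPowerSeries.isUnit_iff_constantCoeff, RingHom.map_det]
    have h3 : (constantCoeff (σ := Fin N) (R := ℂ)).mapMatrix Ψ = frame π := h1
    rw [h3]
    exact isUnit_frame π
  have h3 := Matrix.mul_nonsing_inv Ψ h2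
  refine ⟨Ψ, Ψ⁻¹, h3, Matrix.nonsing_inv_mul Ψ h2, h1, fun γ => ?_⟩
  ext1 α l
  rw [Matrix.mul_diagonal, Matrix.mul_apply]
  have h4 : ∀ β, ∑ j, Ψ β j * Ψ⁻¹ j γ = if β = γ then 1 else 0 := by
    intro β
    rw [← Matrix.mul_apply, h3, Matrix.one_apply]
  have h5 : ∀ j, ∑ β, ∑ δ, X.c α β δ * (Ψ β j * Ψ δ l) = if j = l then Ψ α j else 0 := by
    intro j
    have h6 := congrFun (hp j l) α
    rw [tan_mul_apply] at h6
    refine h6.trans ?_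
    split_ifs <;> rfl
  -- Here ∂/∂t^γ = Σ_j Θ_{jγ} p_j, and multiplying by p_l keeps only its l-th term, so the
  -- eigenvalues are the entries of Θ.
  have h6 : ∑ j, Ψ⁻¹ j γ * ∑ β, ∑ δ, X.c α β δ * (Ψ β j * Ψ δ l) =
      ∑ δ, X.c α γ δ * Ψ δ l := by
    simp only [Finset.mul_sum]
    rw [Finset.sum_comm]
    have h7 : ∀ β, ∑ j, ∑ δ, Ψ⁻¹ j γ * (X.c α β δ * (Ψ β j * Ψ δ l)) =
        (∑ j, Ψ β j * Ψ⁻¹ j γ) * ∑ δ, X.c α β δ * Ψ δ l := by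
      intro β
      rw [Finset.sum_mul]
      refine Finset.sum_congr rfl fun j _ => ?_
      rw [Finset.mul_sum]
      exact Finset.sum_congr rfl fun δ _ => by ring
    simp only [h7, h4, ite_mul, one_mul, zero_mul]
    simp
  simp only [Cmat_apply]
  rw [← h6]
  simp only [h5, mul_ite, mul_zero]
  simp [mul_comm]

end FlatFManifold

/-! ### Closed one-forms and exponentials -/

section Integration

variable {N : ℕ}

/-- The Poincaré lemma for formal power series. -/
theorem exists_primitive (η : Fin N → Fun N)
    (h : ∀ γ δ, pderiv ℂ δ (η γ) = pderiv ℂ γ (η δ)) :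
    ∃ f : Fun N, constantCoeff f = 0 ∧ ∀ γ, pderiv ℂ γ f = η γ := by
  -- Radial integration: on the monomial of exponent m, the Euler field acts by |m| and turns the
  -- primitive into Σ t^δ η_δ.
  let f : Fun N := fun m => (m.degree : ℂ)⁻¹ *
    ∑ δ, if 1 ≤ m δ then coeff (m - Finsupp.single δ 1) (η δ) else 0
  have hf : ∀ m, coeff m f = (m.degree : ℂ)⁻¹ *
    ∑ δ, if 1 ≤ m δ then coeff (m - Finsupp.single δ 1) (η δ) else 0 := fun m => rfl
  refine ⟨f, ?_, fun γ => ?_⟩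
  · rw [← coeff_zero_eq_constantCoeff_apply, hf]
    simp
  · ext m
    rw [coeff_pderiv, hf, mul_assoc, Finset.sum_mul]
    have h1 : ∀ δ, (if 1 ≤ (m + Finsupp.single γ 1 : Fin N →₀ ℕ) δ then
        coeff (m + Finsupp.single γ 1 - Finsupp.single δ 1) (η δ) else 0) * ((m γ : ℂ) + 1) =
          ((m + Finsupp.single γ 1 : Fin N →₀ ℕ) δ : ℂ) * coeff m (η γ) := by
      intro δ
      by_cases hδ : δ = γ
      · subst hδ
        rw [if_pos (by simp), add_tsub_cancel_right]
        simp [mul_comm]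
      · have h2 : (m + Finsupp.single γ 1 : Fin N →₀ ℕ) δ = m δ := by
          simp [hδ]
        rw [h2]
        split_ifs with h3
        · obtain ⟨n, rfl⟩ : ∃ n, m = n + Finsupp.single δ 1 :=
            ⟨m - Finsupp.single δ 1, (tsub_add_cancel_of_le (Finsupp.single_le_iff.2 h3)).symm⟩
          have h4 := congrArg (coeff n) (h γ δ)
          rw [coeff_pderiv, coeff_pderiv] at h4
          rw [add_right_comm, add_tsub_cancel_right]
          simp only [Finsupp.add_apply, Finsupp.single_eq_same,
            Finsupp.single_eq_of_ne (Ne.symm hδ), add_zero]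
          push_cast
          rw [← h4, mul_comm]
        · rw [zero_mul, show m δ = 0 by omega, Nat.cast_zero, zero_mul]
    simp only [h1]
    rw [← Finset.sum_mul]
    have h5 : (∑ δ, ((m + Finsupp.single γ 1 : Fin N →₀ ℕ) δ : ℂ)) =
        ((m + Finsupp.single γ 1).degree : ℂ) := by
      rw [Finsupp.degree_eq_sum, Nat.cast_sum]
    have h6 : ((m + Finsupp.single γ 1).degree : ℂ) ≠ 0 := by
      rw [map_add, Finsupp.degree_single]
      exact Nat.cast_ne_zero.2 (by omega)
    rw [h5, inv_mul_cancel_left₀ h6]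

theorem exists_exp (φ : Fun N) (h0 : constantCoeff φ = 0) :
    ∃ a : Fun N, constantCoeff a = 1 ∧ ∀ γ, pderiv ℂ γ a = a * pderiv ℂ γ φ := by
  let E : MvPowerSeries Unit ℂ := fun m => ((m ()).factorial : ℂ)⁻¹
  have hE : pderiv ℂ () E = E := by
    refine MvPowerSeries.ext fun m => ?_
    rw [coeff_pderiv]
    change (((m + Finsupp.single () 1 : Unit →₀ ℕ) ()).factorial : ℂ)⁻¹ * ((m () : ℂ) + 1) =
      ((m ()).factorial : ℂ)⁻¹
    rw [Finsupp.add_apply, Finsupp.single_eq_same, Nat.factorial_succ]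
    have h1 : ((m ()).factorial : ℂ) ≠ 0 := Nat.cast_ne_zero.2 (Nat.factorial_ne_zero _)
    have h2 : ((m () : ℂ) + 1) ≠ 0 := Nat.cast_add_one_ne_zero _
    push_cast
    field_simp
  refine ⟨subst (fun _ : Unit => φ) E, ?_, fun γ => ?_⟩
  · have h1 := cc_substM (w := fun _ : Unit => φ) (fun _ => h0)
      (Matrix.of fun (_ _ : Unit) => E)
    refine (congrFun (congrFun h1 ()) ()).trans ?_
    change constantCoeff E = 1
    rw [← coeff_zero_eq_constantCoeff_apply]
    change (((0 : Unit →₀ ℕ) ()).factorial : ℂ)⁻¹ = 1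
    simp
  · rw [pderiv_subst (fun _ => h0)]
    simp [hE]

end Integration

/-! ### Frames of eigenvectors -/

/-- A frame of common eigenvectors of the multiplication operators, whose eigenvalues form an
invertible matrix. -/
structure EigenFrame {N : ℕ} (X : FlatFManifold N) where
  Ψ : Matrix (Fin N) (Fin N) (Fun N)
  Θ : Matrix (Fin N) (Fin N) (Fun N)
  d : Matrix (Fin N) (Fin N) (Fun N)
  e : Matrix (Fin N) (Fin N) (Fun N)
  mul_inv : Ψ * Θ = 1
  inv_mul : Θ * Ψ = 1
  d_mul_e : d * e = 1
  eigen : ∀ γ, X.Cmat γ * Ψ = Ψ * Matrix.diagonal fun j => d j γ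

namespace EigenFrame

variable {N : ℕ} {X : FlatFManifold N} (E : EigenFrame X)

/-- The diagonal matrix of eigenvalues of the multiplication by a coordinate vector field. -/
def D (γ : Fin N) : Matrix (Fin N) (Fin N) (Fun N) := Matrix.diagonal fun j => E.d j γ

/-- The connection matrices of the frame. -/
def V (γ : Fin N) : Matrix (Fin N) (Fin N) (Fun N) := E.Θ * pdM γ E.Ψ

/-- The symmetry of the commutators with the eigenvalue matrices. -/
def Sym (M : Fin N → Matrix (Fin N) (Fin N) (Fun N)) : Prop :=
  ∀ γ δ, E.D γ * M δ - M δ * E.D γ = E.D δ * M γ - M γ * E.D δ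

theorem C_mul (γ : Fin N) : X.Cmat γ * E.Ψ = E.Ψ * E.D γ := E.eigen γ

theorem inv_mul_C (γ : Fin N) : E.Θ * X.Cmat γ = E.D γ * E.Θ := by
  calc E.Θ * X.Cmat γ = E.Θ * (X.Cmat γ * E.Ψ) * E.Θ := by
        rw [Matrix.mul_assoc, Matrix.mul_assoc, E.mul_inv, Matrix.mul_one]
    _ = _ := by rw [E.C_mul, ← Matrix.mul_assoc, E.inv_mul, Matrix.one_mul]

theorem commutator_apply (γ : Fin N) (M : Matrix (Fin N) (Fin N) (Fun N)) (i j : Fin N) :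
    (E.D γ * M - M * E.D γ) i j = (E.d i γ - E.d j γ) * M i j := by
  rw [Matrix.sub_apply, D, Matrix.diagonal_mul, Matrix.mul_diagonal]
  ring

/-- This is C_γ Ψ = Ψ D_γ differentiated along δ and multiplied by Θ. Its right side is symmetric in
γ and δ because the C_γ come from second derivatives of a potential. -/
theorem deriv_eigen (γ δ : Fin N) :
    E.D γ * E.V δ - E.V δ * E.D γ - pdM δ (E.D γ) = - (E.Θ * pdM δ (X.Cmat γ) * E.Ψ) := by
  have h := congrArg (fun A => E.Θ * pdM δ A) (E.C_mul γ)
  simp only [pdM_mul, Matrix.mul_add] at h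
  have h1 : E.Θ * (X.Cmat γ * pdM δ E.Ψ) = E.D γ * E.V δ := by
    rw [← Matrix.mul_assoc, E.inv_mul_C, Matrix.mul_assoc, V]
  have h2 : E.Θ * (pdM δ E.Ψ * E.D γ) = E.V δ * E.D γ := by rw [← Matrix.mul_assoc, V]
  have h3 : E.Θ * (E.Ψ * pdM δ (E.D γ)) = pdM δ (E.D γ) := by
    rw [← Matrix.mul_assoc, E.inv_mul, Matrix.one_mul]
  rw [h1, h2, h3, ← Matrix.mul_assoc] at h
  rw [sub_sub, ← h]
  abel

/-- Commutators with D_γ vanish on the diagonal, so the diagonal of `deriv_eigen` is this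
closedness. It makes the eigenvalues differentials of the canonical coordinates. -/
theorem pderiv_d (j γ δ : Fin N) : pderiv ℂ δ (E.d j γ) = pderiv ℂ γ (E.d j δ) := by
  have h := (E.deriv_eigen γ δ).trans ((by rw [X.pdM_Cmat δ γ] :
    - (E.Θ * pdM δ (X.Cmat γ) * E.Ψ) = - (E.Θ * pdM γ (X.Cmat δ) * E.Ψ)).trans
      (E.deriv_eigen δ γ).symm)
  have h1 := congrFun (congrFun h j) j
  rw [Matrix.sub_apply, Matrix.sub_apply (_ - _), commutator_apply, commutator_apply, sub_self,
    sub_self, zero_mul, zero_mul, zero_sub, zero_sub, neg_inj, pdM_apply, pdM_apply, D, D,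
    Matrix.diagonal_apply_eq, Matrix.diagonal_apply_eq] at h1
  exact h1

theorem pdM_D (γ δ : Fin N) : pdM δ (E.D γ) = pdM γ (E.D δ) := by
  ext1 i j
  rw [pdM_apply, pdM_apply, D, D, Matrix.diagonal_apply, Matrix.diagonal_apply]
  split_ifs
  · exact E.pderiv_d i γ δ
  · rw [map_zero, map_zero]

theorem sym_V : E.Sym E.V := fun γ δ => by
  have h := (E.deriv_eigen γ δ).trans ((by rw [X.pdM_Cmat δ γ] :
    - (E.Θ * pdM δ (X.Cmat γ) * E.Ψ) = - (E.Θ * pdM γ (X.Cmat δ) * E.Ψ)).trans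
      (E.deriv_eigen δ γ).symm)
  rwa [E.pdM_D γ δ, sub_left_inj] at h

/-- Differentiating the recursion for the next coefficient expresses the commutator through second
derivatives of P and first derivatives of C and D, all symmetric in the two directions. -/
theorem sym_of_eq {P P' : Matrix (Fin N) (Fin N) (Fun N)}
    (h : ∀ γ, X.Cmat γ * P' - P' * E.D γ = pdM γ P) : E.Sym fun γ => E.Θ * pdM γ P' := by
  have key : ∀ γ δ, E.D γ * (E.Θ * pdM δ P') - E.Θ * pdM δ P' * E.D γ =
      E.Θ * (pdM δ (pdM γ P) - pdM δ (X.Cmat γ) * P' + P' * pdM δ (E.D γ)) := by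
    intro γ δ
    rw [← h γ, pdM_sub, pdM_mul, pdM_mul, ← Matrix.mul_assoc, ← E.inv_mul_C, Matrix.mul_assoc,
      Matrix.mul_assoc, ← Matrix.mul_sub]
    congr 1
    abel
  intro γ δ
  beta_reduce
  rw [key, key, pdM_comm, X.pdM_Cmat δ γ, E.pdM_D γ δ]

/-- Since d e = 1, contracting d_i - d_j with the i-th column of e gives 1. Off-diagonal entries are
thus solved for without dividing by differences of eigenvalues, which may vanish in a given
direction. -/
theorem apply_of_sym {M : Fin N → Matrix (Fin N) (Fin N) (Fun N)} (h : E.Sym M) {i j : Fin N}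
    (hij : i ≠ j) (γ : Fin N) :
    M γ i j = (E.d i γ - E.d j γ) * ∑ δ, E.e δ i * M δ i j := by
  have h1 : ∀ δ, (E.d i γ - E.d j γ) * M δ i j = (E.d i δ - E.d j δ) * M γ i j := by
    intro δ
    rw [← commutator_apply, h γ δ, commutator_apply]
  have h2 : ∀ k, ∑ δ, E.d k δ * E.e δ i = if k = i then 1 else 0 := by
    intro k
    rw [← Matrix.mul_apply, E.d_mul_e, Matrix.one_apply]
  calc M γ i j = (∑ δ, E.d i δ * E.e δ i - ∑ δ, E.d j δ * E.e δ i) * M γ i j := by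
        rw [h2, h2, if_pos rfl, if_neg hij.symm, sub_zero, one_mul]
    _ = ∑ δ, E.e δ i * ((E.d i δ - E.d j δ) * M γ i j) := by
        rw [← Finset.sum_sub_distrib, Finset.sum_mul]
        exact Finset.sum_congr rfl fun δ _ => by ring
    _ = _ := by
        rw [Finset.mul_sum]
        refine Finset.sum_congr rfl fun δ _ => ?_
        rw [← h1]
        ring

/-- By `apply_of_sym` each off-diagonal term of the diagonal entry carries the factor (d_i - d_j)_γ
(d_i - d_j)_δ times something independent of γ and δ, hence is symmetric. -/
theorem mul_diag_comm {M : Fin N → Matrix (Fin N) (Fin N) (Fun N)} (h : E.Sym M)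
    {j γ δ : Fin N} (h0 : E.V δ j j * M γ j j = E.V γ j j * M δ j j) :
    (E.V δ * M γ) j j = (E.V γ * M δ) j j := by
  rw [Matrix.mul_apply, Matrix.mul_apply]
  refine Finset.sum_congr rfl fun i _ => ?_
  by_cases hij : i = j
  · rw [hij, h0]
  · rw [E.apply_of_sym h hij γ, E.apply_of_sym h hij δ, E.apply_of_sym E.sym_V (Ne.symm hij) γ,
      E.apply_of_sym E.sym_V (Ne.symm hij) δ]
    ring

theorem pdM_inv (γ : Fin N) : pdM γ E.Θ = - (E.V γ * E.Θ) := by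
  have h := congrArg (pdM γ) E.inv_mul
  rw [pdM_mul, pdM_one] at h
  calc pdM γ E.Θ = pdM γ E.Θ * E.Ψ * E.Θ := by rw [Matrix.mul_assoc, E.mul_inv, Matrix.mul_one]
    _ = _ := by rw [eq_neg_of_add_eq_zero_left h, Matrix.neg_mul, V]

/-- The derivative of Θ ∂_γ P is -V_δ Θ ∂_γ P plus a symmetric term; on the diagonal the first term
is symmetric as well. The diagonal one-forms are therefore closed and can be integrated. -/
theorem pderiv_diag_comm {P : Matrix (Fin N) (Fin N) (Fun N)}
    (h : E.Sym fun γ => E.Θ * pdM γ P) {j γ δ : Fin N}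
    (h0 : E.V δ j j * (E.Θ * pdM γ P) j j = E.V γ j j * (E.Θ * pdM δ P) j j) :
    pderiv ℂ δ ((E.Θ * pdM γ P) j j) = pderiv ℂ γ ((E.Θ * pdM δ P) j j) := by
  rw [← pdM_apply, ← pdM_apply, pdM_mul, pdM_mul, E.pdM_inv, E.pdM_inv, Matrix.neg_mul,
    Matrix.neg_mul, Matrix.mul_assoc, Matrix.mul_assoc, pdM_comm, Matrix.add_apply,
    Matrix.add_apply, Matrix.neg_apply, Matrix.neg_apply, E.mul_diag_comm h h0]

theorem mul_pdM_mul_diagonal (γ : Fin N) (b : Fin N → Fun N) (j : Fin N) :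
    (E.Θ * pdM γ (E.Ψ * Matrix.diagonal b)) j j = E.V γ j j * b j + pderiv ℂ γ (b j) := by
  have h : pdM γ (Matrix.diagonal b) = Matrix.diagonal fun i => pderiv ℂ γ (b i) := by
    ext1 i k
    rw [pdM_apply, Matrix.diagonal_apply, Matrix.diagonal_apply]
    split_ifs
    · rfl
    · exact map_zero _
  rw [pdM_mul, Matrix.mul_add, ← Matrix.mul_assoc, ← Matrix.mul_assoc, E.inv_mul, Matrix.one_mul, h,
    Matrix.add_apply, Matrix.mul_diagonal, Matrix.diagonal_apply_eq, V]

/-- Rescaling of the eigenvectors makes the diagonals of the connection matrices vanish. -/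
theorem exists_normalized : ∃ E' : EigenFrame X, E'.d = E.d ∧ cc E'.Ψ = cc E.Ψ ∧
    ∀ γ j, E'.V γ j j = 0 := by
  have h1 : ∀ j, ∃ a b : Fun N, constantCoeff a = 1 ∧ a * b = 1 ∧
      ∀ γ, pderiv ℂ γ a = - (E.V γ j j * a) := by
    intro j
    -- Scaling the j-th eigenvector by exp φ with dφ = -V_jj cancels the diagonal of the connection;
    -- φ vanishes at the base point, which keeps the frame there.
    obtain ⟨φ, hφ0, hφ⟩ := exists_primitive (fun γ => - E.V γ j j) fun γ δ => by
      rw [map_neg, map_neg]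
      exact congrArg _ (E.pderiv_diag_comm E.sym_V (mul_comm _ _))
    obtain ⟨a, ha0, ha⟩ := exists_exp φ hφ0
    have hu : IsUnit a := by
      rw [MvPowerSeries.isUnit_iff_constantCoeff, ha0]
      exact isUnit_one
    obtain ⟨b, hb⟩ := hu.exists_right_inv
    refine ⟨a, b, ha0, hb, fun γ => ?_⟩
    rw [ha, hφ]
    ring
  choose a b ha0 hab ha using h1
  have hab' : Matrix.diagonal a * Matrix.diagonal b = (1 : Matrix (Fin N) (Fin N) (Fun N)) := by
    rw [Matrix.diagonal_mul_diagonal]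
    simp only [hab, Matrix.diagonal_one]
  have hba : Matrix.diagonal b * Matrix.diagonal a = (1 : Matrix (Fin N) (Fin N) (Fun N)) := by
    rw [Matrix.diagonal_mul_diagonal]
    simp only [mul_comm (b _), hab, Matrix.diagonal_one]
  refine ⟨⟨E.Ψ * Matrix.diagonal a, Matrix.diagonal b * E.Θ, E.d, E.e, ?_, ?_, E.d_mul_e, ?_⟩,
    rfl, ?_, ?_⟩
  · rw [Matrix.mul_assoc, ← Matrix.mul_assoc (Matrix.diagonal a), hab', Matrix.one_mul, E.mul_inv]
  · rw [Matrix.mul_assoc, ← Matrix.mul_assoc E.Θ, E.inv_mul, Matrix.one_mul, hba]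
  · intro γ
    rw [← Matrix.mul_assoc, E.eigen, Matrix.mul_assoc, Matrix.mul_assoc,
      Matrix.diagonal_mul_diagonal, Matrix.diagonal_mul_diagonal]
    simp only [mul_comm]
  · have h2 : cc (Matrix.diagonal a : Matrix (Fin N) (Fin N) (Fun N)) = 1 := by
      ext1 i j
      rw [cc_apply, Matrix.diagonal_apply, Matrix.one_apply]
      split_ifs
      · exact ha0 i
      · exact map_zero _
    rw [cc_mul, h2, Matrix.mul_one]
  · intro γ j
    change (Matrix.diagonal b * E.Θ * pdM γ (E.Ψ * Matrix.diagonal a)) j j = 0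
    rw [Matrix.mul_assoc, Matrix.diagonal_mul, mul_pdM_mul_diagonal, ha, add_neg_cancel, mul_zero]

/-- The condition under which the next coefficient of the fundamental solution exists. -/
def Solvable (P : Matrix (Fin N) (Fin N) (Fun N)) : Prop :=
  (E.Sym fun γ => E.Θ * pdM γ P) ∧ ∀ γ j, (E.Θ * pdM γ P) j j = 0

theorem exists_next (hV : ∀ γ j, E.V γ j j = 0) {P : Matrix (Fin N) (Fin N) (Fun N)}
    (hP : E.Solvable P) : ∃ P', (∀ γ, X.Cmat γ * P' - P' * E.D γ = pdM γ P) ∧ E.Solvable P' := by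
  -- The recursion prescribes [D_γ, Q], hence only the off-diagonal part of Q; its solvability is
  -- the vanishing diagonal in `Solvable`.
  let Q : Matrix (Fin N) (Fin N) (Fun N) := Matrix.of fun i j =>
    if i = j then 0 else ∑ δ, E.e δ i * (E.Θ * pdM δ P) i j
  have hQ : ∀ γ, E.D γ * Q - Q * E.D γ = E.Θ * pdM γ P := by
    intro γ
    ext1 i j
    rw [commutator_apply]
    by_cases hij : i = j
    · rw [hij, sub_self, zero_mul, hP.2]
    · rw [E.apply_of_sym hP.1 hij γ, show Q i j = _ from if_neg hij]
  have h1 : ∀ A γ, X.Cmat γ * (E.Ψ * A) - E.Ψ * A * E.D γ = E.Ψ * (E.D γ * A - A * E.D γ) := by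
    intro A γ
    rw [← Matrix.mul_assoc, E.C_mul, Matrix.mul_sub, Matrix.mul_assoc, Matrix.mul_assoc]
  have h2 : ∀ γ, X.Cmat γ * (E.Ψ * Q) - E.Ψ * Q * E.D γ = pdM γ P := by
    intro γ
    rw [h1, hQ, ← Matrix.mul_assoc, E.mul_inv, Matrix.one_mul]
  have h3 := E.sym_of_eq h2
  -- The diagonal part is still free and is fixed by integration so that the following coefficient
  -- can be solved for.
  have h4 : ∀ j, ∃ b : Fun N, constantCoeff b = 0 ∧
      ∀ γ, pderiv ℂ γ b = - (E.Θ * pdM γ (E.Ψ * Q)) j j := by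
    intro j
    refine exists_primitive (fun γ => - (E.Θ * pdM γ (E.Ψ * Q)) j j) fun γ δ => ?_
    rw [map_neg, map_neg, E.pderiv_diag_comm h3 (by rw [hV, hV, zero_mul, zero_mul])]
  choose b hb0 hb using h4
  have h5 : ∀ γ, X.Cmat γ * (E.Ψ * (Q + Matrix.diagonal b)) -
      E.Ψ * (Q + Matrix.diagonal b) * E.D γ = pdM γ P := by
    intro γ
    have h6 : E.D γ * Matrix.diagonal b = Matrix.diagonal b * E.D γ := by
      rw [D, Matrix.diagonal_mul_diagonal, Matrix.diagonal_mul_diagonal]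
      simp only [mul_comm]
    rw [← h2 γ, h1, h1, Matrix.mul_add, Matrix.add_mul, h6, add_sub_add_right_eq_sub]
  refine ⟨_, h5, E.sym_of_eq h5, fun γ j => ?_⟩
  rw [Matrix.mul_add, pdM_add, Matrix.mul_add, Matrix.add_apply, mul_pdM_mul_diagonal, hV, hb,
    zero_mul, zero_add, add_neg_cancel]

/-- The formal fundamental solution of the flatness equations at `z = 0`. -/
theorem exists_fundamental (hV : ∀ γ j, E.V γ j j = 0) :
    ∃ P : ℕ → Matrix (Fin N) (Fin N) (Fun N), P 0 = E.Ψ ∧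
      ∀ γ k, X.Cmat γ * P (k + 1) - P (k + 1) * E.D γ = pdM γ (P k) := by
  choose! f hf1 hf2 using fun P (hP : E.Solvable P) => E.exists_next hV hP
  have h0 : E.Solvable E.Ψ := ⟨E.sym_V, hV⟩
  have h1 : ∀ k, E.Solvable (f^[k] E.Ψ) := by
    intro k
    induction k with
    | zero => exact h0
    | succ k ih =>
      rw [Function.iterate_succ_apply']
      exact hf2 _ ih
  refine ⟨fun k => f^[k] E.Ψ, rfl, fun γ k => ?_⟩
  beta_reduce
  rw [Function.iterate_succ_apply']
  exact hf1 _ (h1 k) γ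

end EigenFrame

/-! ### Canonical coordinates and the fundamental solution -/

/-- Canonical coordinates `u` and a fundamental solution `P(z)` of the flatness equations of a
semisimple flat F-manifold. -/
structure CanonicalSolution {N : ℕ} (X : FlatFManifold N) (M : Matrix (Fin N) (Fin N) ℂ) where
  u : Fin N → Fun N
  P : PowerSeries (Matrix (Fin N) (Fin N) (Fun N))
  I : PowerSeries (Matrix (Fin N) (Fin N) (Fun N))
  u_zero : ∀ j, constantCoeff (u j) = 0
  mul_inv : P * I = 1
  inv_mul : I * P = 1
  P_zero : cc (PowerSeries.coeff 0 P) = M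
  jac : M * (Matrix.of fun j γ => constantCoeff (pderiv ℂ γ (u j))) = 1
  unit : (col X.unit : Matrix (Fin N) Unit ℂ) = M * (col 1 : Matrix (Fin N) Unit ℂ)
  -- Equivalently, with U = diag(u), the product P e^{U/z} satisfies z ∂_γ (P e^{U/z}) = C_γ P
  -- e^{U/z}.
  flat : ∀ γ, PowerSeries.X * pdS γ P = PowerSeries.C (X.Cmat γ) * P -
    P * PowerSeries.C (Matrix.diagonal fun j => pderiv ℂ γ (u j))

theorem flat_of_coeff {N : ℕ} {A D : Matrix (Fin N) (Fin N) (Fun N)} {γ : Fin N}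
    {P : PowerSeries (Matrix (Fin N) (Fin N) (Fun N))}
    (h0 : A * PowerSeries.coeff 0 P - PowerSeries.coeff 0 P * D = 0)
    (h : ∀ k, A * PowerSeries.coeff (k + 1) P - PowerSeries.coeff (k + 1) P * D =
      pdM γ (PowerSeries.coeff k P)) :
    PowerSeries.X * pdS γ P = PowerSeries.C A * P - P * PowerSeries.C D := by
  refine PowerSeries.ext fun k => ?_
  rw [map_sub, PowerSeries.coeff_C_mul, PowerSeries.coeff_mul_C]
  match k with
  | 0 => rw [PowerSeries.coeff_zero_X_mul, h0]
  | k + 1 => rw [PowerSeries.coeff_succ_X_mul, coeff_pdS, h]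

theorem FlatFManifold.sum_unit_Cmat {N : ℕ} (X : FlatFManifold N) :
    ∑ γ, (C (X.unit γ) : Fun N) • X.Cmat γ = 1 := by
  ext1 α β
  rw [Matrix.sum_apply, Matrix.one_apply, ← X.sum_unit_c]
  rfl

theorem exists_canonicalSolution {N : ℕ} (X : FlatFManifold N)
    (π : Module.Basis (Fin N) ℂ (Fin N → ℂ))
    (hπ : ∀ k l, X.mulOrig (π k) (π l) = if k = l then π k else 0) :
    Nonempty (CanonicalSolution X (FlatFManifold.frame π)) := by
  obtain ⟨Ψ, Θ, h1, h2, h3, h4⟩ := FlatFManifold.exists_frame π hπ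
  obtain ⟨E, hd, hΨ, hV⟩ := EigenFrame.exists_normalized ⟨Ψ, Θ, Θ, Ψ, h1, h2, h2, h4⟩
  obtain ⟨P, hP0, hP⟩ := E.exists_fundamental hV
  have hu : ∀ j, ∃ u : Fun N, constantCoeff u = 0 ∧ ∀ γ, pderiv ℂ γ u = E.d j γ := fun j =>
    exists_primitive _ fun γ δ => E.pderiv_d j γ δ
  choose u hu0 hu using hu
  have hD : ∀ γ, (Matrix.diagonal fun j => pderiv ℂ γ (u j)) = E.D γ := by
    intro γ
    simp only [hu]
    rfl
  let U : (Matrix (Fin N) (Fin N) (Fun N))ˣ := ⟨E.Ψ, E.Θ, E.mul_inv, E.inv_mul⟩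
  have hU : PowerSeries.constantCoeff (PowerSeries.mk P) = U := by
    rw [← PowerSeries.coeff_zero_eq_constantCoeff_apply, PowerSeries.coeff_mk, hP0]
  have hcd : cc Θ = Matrix.of fun j γ => constantCoeff (pderiv ℂ γ (u j)) := by
    ext1 j γ
    rw [Matrix.of_apply, hu, hd]
    rfl
  have hΨΘ : FlatFManifold.frame π * cc Θ = 1 := by rw [← h3, ← cc_mul, h1, cc_one]
  refine ⟨⟨u, PowerSeries.mk P, PowerSeries.invOfUnit (PowerSeries.mk P) U, hu0,
    PowerSeries.mul_invOfUnit _ _ hU, PowerSeries.invOfUnit_mul _ _ hU, ?_, ?_, ?_, fun γ => ?_⟩⟩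
  · rw [PowerSeries.coeff_mk, hP0, hΨ]
    exact h3
  · rw [← hcd, hΨΘ]
  · have h5 : Ψ * Matrix.diagonal (fun j => ∑ γ, C (X.unit γ) * Θ j γ) = Ψ * 1 := by
      have h6 : (Matrix.diagonal (fun j => ∑ γ, C (X.unit γ) * Θ j γ) :
          Matrix (Fin N) (Fin N) (Fun N)) =
          ∑ γ, (C (X.unit γ) : Fun N) • Matrix.diagonal fun j => Θ j γ := by
        ext1 i j
        rw [Matrix.sum_apply, Matrix.diagonal_apply]
        simp only [Matrix.smul_apply, Matrix.diagonal_apply, smul_eq_mul]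
        split_ifs
        · rfl
        · simp
      rw [h6, Finset.mul_sum, Matrix.mul_one]
      simp only [Matrix.mul_smul, ← h4]
      simp only [← Matrix.smul_mul]
      rw [← Finset.sum_mul, X.sum_unit_Cmat, Matrix.one_mul]
    have h6 := congrArg (Θ * ·) h5
    simp only [← Matrix.mul_assoc, h2, Matrix.one_mul] at h6
    have h7 : cc Θ * (col X.unit : Matrix (Fin N) Unit ℂ) = col 1 := by
      ext1 j v
      have h8 := congrFun (congrFun h6 j) j
      rw [Matrix.diagonal_apply_eq, Matrix.one_apply_eq] at h8
      have h9 := congrArg constantCoeff h8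
      rw [map_sum, map_one] at h9
      rw [Matrix.mul_apply, col_apply]
      refine Eq.trans (Finset.sum_congr rfl fun γ _ => ?_) h9
      rw [map_mul, constantCoeff_C, mul_comm]
      rfl
    rw [← h7, ← Matrix.mul_assoc, hΨΘ, Matrix.one_mul]
  · rw [hD]
    refine flat_of_coeff ?_ fun k => ?_
    · rw [PowerSeries.coeff_mk, hP0, E.C_mul, sub_self]
    · rw [PowerSeries.coeff_mk, PowerSeries.coeff_mk, hP]

/-! ### The intertwining series of two semisimple flat F-manifolds -/

section Intertwine

variable {N : ℕ} {X₁ X₂ : FlatFManifold N} {M : Matrix (Fin N) (Fin N) ℂ}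
  (S₁ : CanonicalSolution X₁ M) (S₂ : CanonicalSolution X₂ M)

/-- The change of variables matching the canonical coordinates. -/
theorem exists_matching : ∃ v : Fin N → Fun N, (∀ α, constantCoeff (v α) = 0) ∧
    ∀ j, subst v (S₂.u j) = S₁.u j := by
  -- M inverts the Jacobian of u₂ at the base point, so r = M u₂ - t has order two. The equation
  -- u₂(v) = u₁ becomes v = M u₁ - r(v), a contraction.
  let r : Fin N → Fun N := fun α => ∑ j, C (M α j) * S₂.u j - MvPowerSeries.X α
  have hr0 : ∀ α, constantCoeff (r α) = 0 := by
    intro α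
    simp only [r, map_sub, map_sum, map_mul, S₂.u_zero, mul_zero, Finset.sum_const_zero,
      constantCoeff_X, sub_zero]
  have hr : ∀ α, r α ∈ orderIdeal 2 := by
    intro α
    refine mem_orderIdeal_of_pderiv (hr0 α) fun γ => ?_
    rw [mem_orderIdeal_one]
    have h1 := congrFun (congrFun S₂.jac α) γ
    rw [Matrix.mul_apply, Matrix.one_apply] at h1
    simp only [Matrix.of_apply] at h1
    simp only [r, map_sub, map_sum, Derivation.leibniz, pderiv_C, smul_eq_mul, mul_zero, add_zero,
      map_mul, constantCoeff_C, h1]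
    split_ifs with h
    · rw [h, pderiv_X_self, map_one, sub_self]
    · rw [pderiv_X_of_ne h, map_zero, sub_self]
  let Φ : (Fin N → Fun N) → Fin N → Fun N := fun v α =>
    (∑ j, C (M α j) * S₁.u j) - subst v (r α)
  obtain ⟨v, hv, h⟩ := exists_fixed_point (fun _ : Fin N => 0) Φ
    (fun v hv α => by
      have h1 := mem_orderIdeal_one.1 (subst_mem_orderIdeal hv (mem_orderIdeal_one.2 (hr0 α)))
      simp only [Φ, map_sub, map_sum, map_mul, S₁.u_zero, mul_zero, Finset.sum_const_zero, h1,
        sub_zero])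
    (fun k a b ha hb hab α => by
      have h1 : Φ a α - Φ b α = -(subst a (r α) - subst b (r α)) := by
        simp only [Φ]
        ring
      rw [h1]
      exact neg_mem (subst_sub_subst_mem_orderIdeal ha hb hab (hr α)))
  refine ⟨v, hv, ?_⟩
  have hs := hasSubst_of_constantCoeff_zero hv
  have h2 : ∀ α, subst v (r α) = (∑ j, C (M α j) * subst v (S₂.u j)) - v α := by
    intro α
    have h3 : subst v (MvPowerSeries.X α : Fun N) = v α := subst_X hs α
    simp only [r]
    rw [← coe_substAlgHom hs, map_sub, map_sum, coe_substAlgHom, h3]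
    congr 1
    refine Finset.sum_congr rfl fun j _ => ?_
    rw [subst_mul hs, subst_C]
  have h3 : ∀ α, ∑ j, C (M α j) * (subst v (S₂.u j) - S₁.u j) = 0 := by
    intro α
    have h4 := congrFun h α
    simp only [Φ, h2] at h4
    simp only [mul_sub, Finset.sum_sub_distrib]
    linear_combination -h4
  intro j
  have h4 := mul_eq_one_comm.1 S₂.jac
  rw [← sub_eq_zero]
  have h5 : ∑ α, C ((Matrix.of fun j γ => constantCoeff (pderiv ℂ γ (S₂.u j))) j α) *
      ∑ i, C (M α i) * (subst v (S₂.u i) - S₁.u i) = 0 := by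
    simp only [h3, mul_zero, Finset.sum_const_zero]
  simp only [Finset.mul_sum] at h5
  rw [Finset.sum_comm] at h5
  have h6 : ∀ i, ∑ α, C ((Matrix.of fun j γ => constantCoeff (pderiv ℂ γ (S₂.u j))) j α) *
      (C (M α i) * (subst v (S₂.u i) - S₁.u i)) =
      if j = i then subst v (S₂.u i) - S₁.u i else 0 := by
    intro i
    have h7 := congrFun (congrFun h4 j) i
    rw [Matrix.mul_apply, Matrix.one_apply] at h7
    have h8 := congrArg (C (σ := Fin N)) h7
    rw [map_sum] at h8
    simp only [map_mul] at h8
    simp only [← mul_assoc]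
    rw [← Finset.sum_mul, h8]
    split_ifs <;> simp
  simp only [h6] at h5
  simpa using h5

/-- This is the pullback of the flatness equation along v; since u₂(v) = u₁, its diagonal term
becomes that of the first manifold. -/
theorem flat_smap {v : Fin N → Fun N} (hv : ∀ α, constantCoeff (v α) = 0)
    (huv : ∀ j, subst v (S₂.u j) = S₁.u j) (γ : Fin N) :
    PowerSeries.X * pdS γ (smap v S₂.P) =
      PowerSeries.C (X₂.Cw v fun δ => pderiv ℂ γ (v δ)) * smap v S₂.P -
      smap v S₂.P * PowerSeries.C (Matrix.diagonal fun j => pderiv ℂ γ (S₁.u j)) := by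
  have hd : (Matrix.diagonal fun j => pderiv ℂ γ (S₁.u j)) =
      ∑ δ, pderiv ℂ γ (v δ) • substM v (Matrix.diagonal fun j => pderiv ℂ δ (S₂.u j)) := by
    ext1 i j
    rw [Matrix.sum_apply, Matrix.diagonal_apply, ← huv, pderiv_subst hv]
    simp only [Matrix.smul_apply, substM_apply, Matrix.diagonal_apply, smul_eq_mul]
    split_ifs
    · exact Finset.sum_congr rfl fun δ _ => mul_comm _ _
    · simp [subst_zero (hasSubst_of_constantCoeff_zero hv)]
  have key : ∀ A : Matrix (Fin N) (Fin N) (Fun N),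
      (X₂.Cw v fun δ => pderiv ℂ γ (v δ)) * substM v A -
        substM v A * (Matrix.diagonal fun j => pderiv ℂ γ (S₁.u j)) =
      ∑ δ, pderiv ℂ γ (v δ) • (substM v (X₂.Cmat δ * A) -
        substM v (A * Matrix.diagonal fun j => pderiv ℂ δ (S₂.u j))) := by
    intro A
    rw [hd, FlatFManifold.Cw, Finset.sum_mul, Finset.mul_sum, ← Finset.sum_sub_distrib]
    refine Finset.sum_congr rfl fun δ _ => ?_
    rw [substM_mul hv, substM_mul hv, Matrix.smul_mul, Matrix.mul_smul, smul_sub]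
  have hsub : ∀ A B : Matrix (Fin N) (Fin N) (Fun N),
      substM v A - substM v B = substM v (A - B) := by
    intro A B
    rw [sub_eq_iff_eq_add, ← substM_add hv, sub_add_cancel]
  simp only [hsub] at key
  refine flat_of_coeff ?_ fun k => ?_
  · rw [coeff_smap, key]
    refine Finset.sum_eq_zero fun δ _ => ?_
    have h1 := congrArg (PowerSeries.coeff 0) (S₂.flat δ)
    rw [PowerSeries.coeff_zero_X_mul, map_sub, PowerSeries.coeff_C_mul,
      PowerSeries.coeff_mul_C] at h1
    rw [← h1, substM_zero hv, smul_zero]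
  · rw [coeff_smap, coeff_smap, key, pdM_substM hv]
    refine Finset.sum_congr rfl fun δ _ => ?_
    have h1 := congrArg (PowerSeries.coeff (k + 1)) (S₂.flat δ)
    rw [PowerSeries.coeff_succ_X_mul, map_sub, PowerSeries.coeff_C_mul,
      PowerSeries.coeff_mul_C, coeff_pdS] at h1
    rw [← h1]

/-- The intertwining series. -/
def intertwiner (v : Fin N → Fun N) : PowerSeries (Matrix (Fin N) (Fin N) (Fun N)) :=
  smap v S₂.P * S₁.I

/-- The diagonal terms of P₂(v) and of P₁^{-1} are equal and opposite, so only the two connections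
remain: the exponentials e^{U/z} have cancelled. -/
theorem flat_intertwiner {v : Fin N → Fun N} (hv : ∀ α, constantCoeff (v α) = 0)
    (huv : ∀ j, subst v (S₂.u j) = S₁.u j) (γ : Fin N) :
    PowerSeries.X * pdS γ (intertwiner S₁ S₂ v) =
      PowerSeries.C (X₂.Cw v fun δ => pderiv ℂ γ (v δ)) * intertwiner S₁ S₂ v -
      intertwiner S₁ S₂ v * PowerSeries.C (X₁.Cmat γ) := by
  have h1 := flat_smap S₁ S₂ hv huv γ
  have h2 := S₁.flat γ
  set D := PowerSeries.C (Matrix.diagonal fun j => pderiv ℂ γ (S₁.u j))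
  set Q := smap v S₂.P
  set A := PowerSeries.C (X₂.Cw v fun δ => pderiv ℂ γ (v δ))
  set A₁ := PowerSeries.C (X₁.Cmat γ)
  have h3 : pdS γ S₁.I = - (S₁.I * pdS γ S₁.P * S₁.I) := by
    have h4 := congrArg (pdS γ) S₁.inv_mul
    rw [pdS_mul, pdS_one] at h4
    calc pdS γ S₁.I = pdS γ S₁.I * S₁.P * S₁.I := by rw [mul_assoc, S₁.mul_inv, mul_one]
      _ = _ := by rw [eq_neg_of_add_eq_zero_left h4, neg_mul]
  have h4 : PowerSeries.X * pdS γ S₁.I = D * S₁.I - S₁.I * A₁ := by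
    calc PowerSeries.X * pdS γ S₁.I = - (S₁.I * (PowerSeries.X * pdS γ S₁.P) * S₁.I) := by
          rw [h3, mul_neg, ← mul_assoc, ← mul_assoc, PowerSeries.X_mul, mul_assoc S₁.I]
      _ = S₁.I * S₁.P * D * S₁.I - S₁.I * A₁ * (S₁.P * S₁.I) := by
          rw [h2]
          noncomm_ring
      _ = _ := by rw [S₁.mul_inv, S₁.inv_mul, one_mul, mul_one]
  rw [intertwiner, pdS_mul, mul_add, ← mul_assoc, h1, ← mul_assoc PowerSeries.X Q,
    PowerSeries.X_mul (φ := Q), mul_assoc Q, h4]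
  noncomm_ring

/-- Both solutions start from the same frame M of idempotents at the base point, and M is
invertible. -/
theorem cc_intertwiner {v : Fin N → Fun N} (hv : ∀ α, constantCoeff (v α) = 0) :
    cc (PowerSeries.coeff 0 (intertwiner S₁ S₂ v)) = 1 := by
  have h1 : intertwiner S₁ S₂ v * S₁.P = smap v S₂.P := by
    rw [intertwiner, mul_assoc, S₁.inv_mul, mul_one]
  have h2 := congrArg (fun A => cc (PowerSeries.coeff 0 A)) h1
  simp only [PowerSeries.coeff_mul, Finset.Nat.antidiagonal_zero, Finset.sum_singleton, cc_mul, coeff_smap, cc_substM hv, S₁.P_zero,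
    S₂.P_zero] at h2
  have h3 := congrArg (· * Matrix.of fun j γ => constantCoeff (pderiv ℂ γ (S₁.u j))) h2
  simpa only [Matrix.mul_assoc, S₁.jac, Matrix.mul_one] using h3

end Intertwine

/-! ### Intertwining calibrations -/

theorem msum_sub {ι σ l m : Type*} {f g : ι → Matrix l m (MvPowerSeries σ ℂ)} (hf : MLF f)
    (hg : MLF g) : msum (fun i => f i - g i) = msum f - msum g := by
  ext1 a b
  exact (formalSum_sub (hf a b) (hg a b)).symm

theorem constantCoeff_subst {ν σ : Type*} [Finite ν] {w : ν → MvPowerSeries σ ℂ}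
    (hw : ∀ i, constantCoeff (w i) = 0) (f : MvPowerSeries ν ℂ) :
    constantCoeff (subst w f) = constantCoeff f :=
  congrFun (congrFun (cc_substM hw (Matrix.of fun _ _ : Unit => f)) ()) ()

theorem substM_substM {ν μ σ l m : Type*} [Finite ν] [Finite μ] {a : ν → MvPowerSeries μ ℂ}
    {b : μ → MvPowerSeries σ ℂ} (ha : ∀ i, constantCoeff (a i) = 0)
    (hb : ∀ i, constantCoeff (b i) = 0) (A : Matrix l m (MvPowerSeries ν ℂ)) :
    substM b (substM a A) = substM (fun i => subst b (a i)) A := by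
  ext1 i j
  exact subst_comp_subst_apply (hasSubst_of_constantCoeff_zero ha)
    (hasSubst_of_constantCoeff_zero hb) _

/-- A derivative trades index n for n + 1, so the order of the difference is raised for all n
simultaneously. -/
theorem eq_of_pdM_eq {N : ℕ} {K K' : ℤ → Matrix (Fin N) (Fin N) (Fun N)}
    {D : Fin N → Matrix (Fin N) (Fin N) (Fun N)}
    (h : ∀ γ n, pdM γ (K n) = -(K (n + 1) * D γ)) (h' : ∀ γ n, pdM γ (K' n) = -(K' (n + 1) * D γ))
    (h0 : ∀ n, cc (K n) = cc (K' n)) : K = K' := by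
  have key : ∀ (k : ℕ) n α β, (K n - K' n) α β ∈ orderIdeal k := by
    intro k
    induction k with
    | zero => exact fun _ _ _ => mem_orderIdeal_zero _
    | succ k ih =>
      intro n α β
      refine mem_orderIdeal_of_pderiv ?_ fun γ => ?_
      · rw [Matrix.sub_apply, map_sub, sub_eq_zero]
        exact congrFun (congrFun (h0 n) α) β
      · have h1 : pdM γ (K n - K' n) = -((K (n + 1) - K' (n + 1)) * D γ) := by
          rw [pdM_sub, h, h', Matrix.sub_mul]
          abel
        rw [← pdM_apply, h1, Matrix.neg_apply, Matrix.mul_apply]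
        exact neg_mem (sum_mem fun μ _ => Ideal.mul_mem_right _ _ (ih _ _ _))
  funext n
  rw [← sub_eq_zero]
  ext1 α β
  exact eq_zero_of_forall_mem_orderIdeal fun k => key k n α β

namespace FlatFManifold.Calibration

variable {N : ℕ} {X : FlatFManifold N} (Ω : X.Calibration)

theorem pdM_hat {σ : Type*} {w : Fin N → MvPowerSeries σ ℂ} (hw : ∀ i, constantCoeff (w i) = 0)
    (s : σ) (n : ℤ) :
    pdM s (Ω.hat w n) = -(Ω.hat w (n + 1) * X.Cw w fun δ => pderiv ℂ s (w δ)) := by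
  rcases lt_or_ge 0 n with hn | hn
  · rw [Ω.hat_of_pos hn, Ω.hat_of_pos (by omega), pdM_zero, Matrix.zero_mul, neg_zero]
  obtain ⟨k, rfl⟩ : ∃ k : ℕ, n = -k := ⟨(-n).toNat, by omega⟩
  match k with
  | 0 =>
    rw [Nat.cast_zero, neg_zero, zero_add, Ω.hat_of_pos one_pos, Matrix.zero_mul, neg_zero,
      Ω.hat_zero hw, pdM_one]
  | k + 1 =>
    have h1 : -((k + 1 : ℕ) : ℤ) + 1 = -(k : ℤ) := by push_cast; ring
    rw [h1, hat_neg_natCast, hat_neg_natCast, pdM_substM hw, FlatFManifold.Cw, Finset.mul_sum,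
      ← Finset.sum_neg_distrib]
    refine Finset.sum_congr rfl fun δ _ => ?_
    rw [pdM_neg_one_pow_smul, Ω.pdM_mat_succ, substM_neg_one_pow_smul hw,
      substM_neg_one_pow_smul hw, substM_mul hw, pow_succ, Matrix.mul_smul, Matrix.smul_mul,
      mul_neg_one, neg_smul, smul_neg]

theorem substM_hat {σ τ : Type*} [Finite σ] {a : Fin N → MvPowerSeries σ ℂ}
    {b : σ → MvPowerSeries τ ℂ} (ha : ∀ i, constantCoeff (a i) = 0)
    (hb : ∀ i, constantCoeff (b i) = 0) (i : ℤ) :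
    substM b (Ω.hat a i) = Ω.hat (fun s => subst b (a s)) i := by
  rcases lt_or_ge 0 i with hi | hi
  · rw [Ω.hat_of_pos hi, Ω.hat_of_pos hi, substM_zero hb]
  · obtain ⟨k, rfl⟩ : ∃ k : ℕ, i = -k := ⟨(-i).toNat, by omega⟩
    rw [hat_neg_natCast, hat_neg_natCast, substM_substM ha hb]

theorem cc_hat {Ω : X.Calibration} (hN : Ω.IsNormalized) {σ : Type*}
    {w : Fin N → MvPowerSeries σ ℂ} (hw : ∀ i, constantCoeff (w i) = 0) {i : ℤ} (hi : i ≠ 0) :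
    cc (Ω.hat w i) = 0 := by
  rcases lt_or_gt_of_ne hi with hj | hj
  · obtain ⟨k, rfl⟩ : ∃ k : ℕ, i = -(k + 1 : ℕ) := ⟨(-i - 1).toNat, by omega⟩
    rw [hat_neg_natCast, cc_substM hw]
    ext1 a b
    have h3 : constantCoeff (Ω.mat (k + 1) a b) = 0 := congrFun (congrFun (hN k) a) b
    rw [cc_apply, Matrix.smul_apply, smul_eq_mul, map_mul, h3, mul_zero]
    rfl
  · rw [Ω.hat_of_pos hj, cc_zero]

end FlatFManifold.Calibration

theorem FlatFManifold.Cw_X {N : ℕ} (X : FlatFManifold N) (γ : Fin N) :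
    X.Cw (MvPowerSeries.X : Fin N → Fun N)
      (fun δ => pderiv ℂ γ (MvPowerSeries.X δ : Fun N)) = X.Cmat γ := by
  have h1 : ∀ A : Matrix (Fin N) (Fin N) (Fun N),
      substM (MvPowerSeries.X : Fin N → Fun N) A = A := by
    intro A
    ext1 a b
    rw [substM_apply, subst_self]
    rfl
  rw [FlatFManifold.Cw, Finset.sum_eq_single γ]
  · rw [pderiv_X_self, one_smul, h1]
  · intro δ _ hδ
    rw [pderiv_X_of_ne hδ, zero_smul]
  · simp

theorem pdM_posSeq {N : ℕ} {A D : Matrix (Fin N) (Fin N) (Fun N)} {γ : Fin N}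
    {P : PowerSeries (Matrix (Fin N) (Fin N) (Fun N))}
    (h : PowerSeries.X * pdS γ P = PowerSeries.C A * P - P * PowerSeries.C D) (n : ℤ) :
    pdM γ (posSeq P n) = A * posSeq P (n + 1) - posSeq P (n + 1) * D := by
  have h1 := fun k => congrArg (PowerSeries.coeff k) h
  simp only [map_sub, PowerSeries.coeff_C_mul, PowerSeries.coeff_mul_C] at h1
  rcases lt_or_ge n 0 with hn | hn
  · rw [posSeq_of_neg _ hn, pdM_zero]
    rcases lt_or_eq_of_le (show n + 1 ≤ 0 by omega) with h2 | h2
    · rw [posSeq_of_neg _ h2, Matrix.mul_zero, Matrix.zero_mul, sub_zero]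
    · have h3 := h1 0
      rw [PowerSeries.coeff_zero_X_mul] at h3
      rw [h2, show (0 : ℤ) = ((0 : ℕ) : ℤ) from rfl, posSeq_natCast]
      exact h3
  · obtain ⟨k, rfl⟩ := Int.eq_ofNat_of_zero_le hn
    have h3 := h1 (k + 1)
    rw [PowerSeries.coeff_succ_X_mul, coeff_pdS] at h3
    rw [show (k : ℤ) + 1 = ((k + 1 : ℕ) : ℤ) by push_cast; rfl, posSeq_natCast, posSeq_natCast, h3]

/-! ### The relation R S¹ = S²_v B and the operator of G_+ -/

section Intertwine

variable {N : ℕ} {X₁ X₂ : FlatFManifold N} {M : Matrix (Fin N) (Fin N) ℂ}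

/-- The value at the base point of the intertwining series. -/
def intertwinerAt (B : PowerSeries (Matrix (Fin N) (Fin N) (Fun N))) :
    PowerSeries (Matrix (Fin N) (Fin N) ℂ) := PowerSeries.mk fun k => cc (PowerSeries.coeff k B)

theorem cseq_intertwinerAt (B : PowerSeries (Matrix (Fin N) (Fin N) (Fun N))) (σ : Type*) (n : ℤ) :
    cseq σ (upper (intertwinerAt B)) n = (cc (posSeq B n)).map C := by
  rw [cseq, upper, posSeq]
  split_ifs
  · rw [intertwinerAt, PowerSeries.coeff_mk]
  · rw [cc_zero]

/-- Both sides satisfy ∂_γ K_n = -K_{n+1} C_γ for the first manifold. On the right the terms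
containing the connection of the second manifold cancel. At the base point both equal the value of
B, because normalized calibrations are the identity there. -/
theorem conv_intertwiner (Ω₁ : X₁.Calibration) (Ω₂ : X₂.Calibration) (hN₁ : Ω₁.IsNormalized)
    (hN₂ : Ω₂.IsNormalized) {v : Fin N → Fun N} (hv : ∀ α, constantCoeff (v α) = 0)
    {B : PowerSeries (Matrix (Fin N) (Fin N) (Fun N))}
    (hB : ∀ γ, PowerSeries.X * pdS γ B =
      PowerSeries.C (X₂.Cw v fun δ => pderiv ℂ γ (v δ)) * B - B * PowerSeries.C (X₁.Cmat γ)) :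
    conv (cseq _ (upper (intertwinerAt B))) (Ω₁.hat MvPowerSeries.X) =
      conv (Ω₂.hat v) (posSeq B) := by
  have hX : ∀ i, constantCoeff (MvPowerSeries.X i : Fun N) = 0 := fun i => constantCoeff_X i
  have m1 := FlatFManifold.Calibration.mlf_hat hN₁ hX
  have m2 := FlatFManifold.Calibration.mlf_hat hN₂ hv
  have e1 : ∀ k, MLF fun i => cseq (Fin N) (upper (intertwinerAt B)) i *
      Ω₁.hat MvPowerSeries.X (k - i) := m1.conv_right
  have e2 : ∀ k, MLF fun i => Ω₂.hat v i * posSeq B (k - i) := m2.conv_left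
  refine eq_of_pdM_eq (D := X₁.Cmat) (fun γ n => ?_) (fun γ n => ?_) fun n => ?_
  · unfold conv
    rw [pdM_msum _ (e1 n), ← msum_mul_right _ (e1 (n + 1)), ← msum_neg]
    congr 1
    funext i
    rw [pdM_mul, cseq, pdM_mapC, Matrix.zero_mul, zero_add, Ω₁.pdM_hat hX, X₁.Cw_X,
      Matrix.mul_neg, Matrix.mul_assoc, show n + 1 - i = n - i + 1 by ring]
  · unfold conv
    rw [pdM_msum _ (e2 n), ← msum_mul_right _ (e2 (n + 1)), ← msum_neg]
    set A := X₂.Cw v fun δ => pderiv ℂ γ (v δ)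
    have e3 : MLF fun i => Ω₂.hat v i * (A * posSeq B (n + 1 - i)) := m2.mul_right _
    have e4 : MLF fun i => Ω₂.hat v (i + 1) * (A * posSeq B (n - i)) :=
      (m2.comp_injective (add_left_injective (1 : ℤ))).mul_right _
    have e5 : MLF fun i => Ω₂.hat v i * posSeq B (n + 1 - i) * X₁.Cmat γ :=
      (m2.mul_right _).mul_right _
    -- Shifting the summation index cancels the derivative of S²_v against the left connection term
    -- of B.
    have h1 : (msum fun i => Ω₂.hat v (i + 1) * (A * posSeq B (n - i))) =
        msum fun i => Ω₂.hat v i * (A * posSeq B (n + 1 - i)) := by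
      rw [← msum_equiv (Equiv.addRight (1 : ℤ)) fun i => Ω₂.hat v i * (A * posSeq B (n + 1 - i))]
      congr 1
      funext i
      rw [Equiv.coe_addRight, add_sub_add_right_eq_sub]
    have h2 : ∀ i, pdM γ (Ω₂.hat v i * posSeq B (n - i)) =
        (Ω₂.hat v i * (A * posSeq B (n + 1 - i)) - Ω₂.hat v (i + 1) * (A * posSeq B (n - i))) -
          Ω₂.hat v i * posSeq B (n + 1 - i) * X₁.Cmat γ := by
      intro i
      rw [pdM_mul, Ω₂.pdM_hat hv, pdM_posSeq (hB γ), show n - i + 1 = n + 1 - i by ring,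
        Matrix.mul_sub, Matrix.neg_mul, Matrix.mul_assoc, Matrix.mul_assoc]
      abel
    simp only [h2]
    have e6 : MLF fun i => Ω₂.hat v i * (A * posSeq B (n + 1 - i)) -
        Ω₂.hat v (i + 1) * (A * posSeq B (n - i)) := fun a b => by
      have h3 := (e3 a b).add ((e4 a b).mul_left fun _ => -1)
      refine Eq.mp (congrArg _ (funext fun i => ?_)) h3
      beta_reduce
      rw [Matrix.sub_apply]
      ring
    rw [msum_sub e6 e5, msum_sub e3 e4, h1, sub_self, zero_sub, msum_neg]
  · rw [cc_conv _ _ n n, cc_conv _ _ n 0, sub_self, sub_zero, Ω₁.hat_zero hX, Ω₂.hat_zero hv,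
      cc_one, Matrix.one_mul, Matrix.mul_one, cseq_intertwinerAt, cc_mapC]
    · intro j hj
      rw [FlatFManifold.Calibration.cc_hat hN₂ hv hj, Matrix.zero_mul]
    · intro j hj
      rw [FlatFManifold.Calibration.cc_hat hN₁ hX (by omega), Matrix.mul_zero]

/-- Two semisimple flat F-manifolds with the same idempotents at the base points are related by the
action of `G_+`. -/
theorem exists_upper {π : Module.Basis (Fin N) ℂ (Fin N → ℂ)}
    (hπ₁ : ∀ k l, X₁.mulOrig (π k) (π l) = if k = l then π k else 0)
    (hπ₂ : ∀ k l, X₂.mulOrig (π k) (π l) = if k = l then π k else 0)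
    {Ω₁ : X₁.Calibration} {Ω₂ : X₂.Calibration} (hN₁ : Ω₁.IsNormalized) (hN₂ : Ω₂.IsNormalized) :
    ∃ R ∈ GPlus N, ∀ G₁ G₂, Ω₁.IsConeOf G₁ → Ω₂.IsConeOf G₂ → IsImage (upper R) G₁ G₂ := by
  obtain ⟨S₁⟩ := exists_canonicalSolution X₁ π hπ₁
  obtain ⟨S₂⟩ := exists_canonicalSolution X₂ π hπ₂
  obtain ⟨v, hv, huv⟩ := exists_matching S₁ S₂
  set B := intertwiner S₁ S₂ v with hBdef
  have hB := flat_intertwiner S₁ S₂ hv huv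
  have hB0 := cc_intertwiner S₁ S₂ hv
  rw [← hBdef] at hB0
  have hX : ∀ i, constantCoeff (MvPowerSeries.X i : Fun N) = 0 := fun i => constantCoeff_X i
  have key := conv_intertwiner Ω₁ Ω₂ hN₁ hN₂ hv hB
  rw [← hBdef] at key
  refine ⟨intertwinerAt B, ?_, fun G₁ G₂ h₁ h₂ => ?_⟩
  · show PowerSeries.coeff 0 (intertwinerAt B) = 1
    rw [intertwinerAt, PowerSeries.coeff_mk, hB0]
  obtain ⟨w, hw⟩ := Ω₁.exists_isEulerLagrange
  have m1 := FlatFManifold.Calibration.mlf_hat hN₁ hX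
  have m2 := FlatFManifold.Calibration.mlf_hat hN₂ hv
  -- The identity in t is pulled back along the topological solution w of the first cone, so the
  -- ruling parameter of the image is v(w).
  refine Ω₁.isImage_of_upper Ω₂ hN₁ hN₂ h₁ h₂ hw (w' := fun α => subst w (v α))
    (fun α => by rw [constantCoeff_subst hw.1, hv]) (fun i hi => if_neg (by omega))
    (B := fun n => substM w (posSeq B n))
    (fun i hi => by rw [posSeq_of_neg _ hi, substM_zero hw.1]) ?_ ?_
  · rw [show (0 : ℤ) = ((0 : ℕ) : ℤ) from rfl, posSeq_natCast, cc_substM hw.1, hB0, Matrix.one_mul,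
      S₁.unit, S₂.unit]
  · funext k
    have h1 := congrArg (substM w) (congrFun key k)
    unfold conv at h1 ⊢
    rw [(substM_msum hw.1 (m1.conv_right k)).2, (substM_msum hw.1 (m2.conv_left k)).2] at h1
    simp only [substM_mul hw.1, Ω₂.substM_hat hv hw.1, Ω₁.substM_hat hX hw.1,
      subst_X (hasSubst_of_constantCoeff_zero hw.1), cseq, substM_mapC] at h1
    exact h1

end Intertwine

/-! ### Linear changes of coordinates -/

section Linear

variable {N : ℕ} (M : GL (Fin N) ℂ)

/-- The linear functions `M⁻¹ t`. -/
def linearSub (α : Fin N) : Fun N := ∑ β, C ((M⁻¹).1 α β) * MvPowerSeries.X β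

theorem constantCoeff_linearSub (α : Fin N) : constantCoeff (linearSub M α) = 0 := by
  simp [linearSub]

theorem pderiv_linearSub (α γ : Fin N) : pderiv ℂ γ (linearSub M α) = C ((M⁻¹).1 α γ) := by
  rw [linearSub, map_sum, Finset.sum_eq_single γ]
  · rw [Derivation.leibniz, pderiv_C, pderiv_X_self, smul_zero, add_zero, smul_eq_mul, mul_one]
  · intro β _ hβ
    rw [Derivation.leibniz, pderiv_C, pderiv_X_of_ne hβ, smul_zero, smul_zero, add_zero]
  · simp

theorem pdM_linearSub {l m : Type*} (A : Matrix l m (Fun N)) (γ : Fin N) :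
    pdM γ (substM (linearSub M) A) =
      ∑ δ, (C ((M⁻¹).1 δ γ) : Fun N) • substM (linearSub M) (pdM δ A) := by
  rw [pdM_substM (constantCoeff_linearSub M)]
  simp only [pderiv_linearSub]

theorem GL_mul_inv : M.1 * (M⁻¹).1 = 1 := by rw [← Units.val_mul, mul_inv_cancel, Units.val_one]

theorem GL_inv_mul : (M⁻¹).1 * M.1 = 1 := by rw [← Units.val_mul, inv_mul_cancel, Units.val_one]

theorem mapC_mul {σ l m n : Type*} [Fintype m] (A : Matrix l m ℂ) (B : Matrix m n ℂ) :
    ((A * B).map C : Matrix l n (MvPowerSeries σ ℂ)) =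
      (A.map C : Matrix l m (MvPowerSeries σ ℂ)) * (B.map C : Matrix m n (MvPowerSeries σ ℂ)) :=
  Matrix.map_mul

theorem mapC_one {σ m : Type*} [DecidableEq m] :
    (1 : Matrix m m ℂ).map (C : ℂ → MvPowerSeries σ ℂ) = 1 :=
  Matrix.map_one (C : ℂ →+* MvPowerSeries σ ℂ) (map_zero _) (map_one _)

theorem mapC_zero {σ l m : Type*} :
    (0 : Matrix l m ℂ).map (C : ℂ → MvPowerSeries σ ℂ) = 0 :=
  Matrix.map_zero (C : ℂ →+* MvPowerSeries σ ℂ) (map_zero _)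

/-- The image of a calibration matrix under a linear change of coordinates. -/
def conjM (A : Matrix (Fin N) (Fin N) (Fun N)) : Matrix (Fin N) (Fin N) (Fun N) :=
  (M.1.map C : Matrix (Fin N) (Fin N) (Fun N)) * substM (linearSub M) A *
    ((M⁻¹).1.map C : Matrix (Fin N) (Fin N) (Fun N))

theorem mapC_inv_mul {σ : Type*} : ((M⁻¹).1.map C : Matrix (Fin N) (Fin N) (MvPowerSeries σ ℂ)) *
    (M.1.map C : Matrix (Fin N) (Fin N) (MvPowerSeries σ ℂ)) = 1 := by
  rw [← mapC_mul, GL_inv_mul, mapC_one]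

theorem conjM_mul (A B : Matrix (Fin N) (Fin N) (Fun N)) :
    conjM M (A * B) = conjM M A * conjM M B := by
  have h := mapC_inv_mul M (σ := Fin N)
  rw [conjM, substM_mul (constantCoeff_linearSub M)]
  simp only [conjM]
  calc _ = (M.1.map C : Matrix (Fin N) (Fin N) (Fun N)) * substM (linearSub M) A * 1 *
          substM (linearSub M) B * ((M⁻¹).1.map C : Matrix (Fin N) (Fin N) (Fun N)) := by
        simp only [mul_one, mul_assoc]
    _ = _ := by
        rw [← h]
        simp only [mul_assoc]

theorem conjM_one : conjM M 1 = 1 := by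
  rw [conjM, substM_one (constantCoeff_linearSub M), mul_one, ← mapC_mul, GL_mul_inv, mapC_one]

theorem cc_conjM (A : Matrix (Fin N) (Fin N) (Fun N)) :
    cc (conjM M A) = M.1 * cc A * (M⁻¹).1 := by
  rw [conjM, cc_mul, cc_mul, cc_mapC, cc_mapC, cc_substM (constantCoeff_linearSub M)]

theorem pdM_conjM (A : Matrix (Fin N) (Fin N) (Fun N)) (γ : Fin N) :
    pdM γ (conjM M A) = ∑ δ, (C ((M⁻¹).1 δ γ) : Fun N) • conjM M (pdM δ A) := by
  rw [conjM, pdM_mul, pdM_mapC, Matrix.mul_zero, add_zero, pdM_mul, pdM_mapC, Matrix.zero_mul,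
    zero_add, pdM_linearSub, Finset.mul_sum, Finset.sum_mul]
  refine Finset.sum_congr rfl fun δ _ => ?_
  rw [Matrix.mul_smul, Matrix.smul_mul, conjM]

variable (X : FlatFManifold N)

namespace FlatFManifold

/-- The vector potential in the coordinates `M t`. -/
def linearF (α : Fin N) : Fun N := ∑ μ, C (M.1 α μ) * subst (linearSub M) (X.F μ)

theorem pderiv_pderiv_linearF (γ α β : Fin N) :
    pderiv ℂ γ (pderiv ℂ β (linearF M X α)) =
      (∑ δ, (C ((M⁻¹).1 δ γ) : Fun N) • conjM M (X.Cmat δ)) α β := by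
  have h0 := constantCoeff_linearSub M
  have h1 : ∀ f : Fun N, ∀ γ, pderiv ℂ γ (subst (linearSub M) f) =
      ∑ δ, C ((M⁻¹).1 δ γ) * subst (linearSub M) (pderiv ℂ δ f) := by
    intro f γ
    rw [pderiv_subst h0]
    simp only [pderiv_linearSub, mul_comm]
  have h2 : ∀ (c : ℂ) (f : Fun N) γ, pderiv ℂ γ (C c * f) = C c * pderiv ℂ γ f := by
    intro c f γ
    rw [Derivation.leibniz, pderiv_C, smul_zero, add_zero, smul_eq_mul]
  have h3 : pderiv ℂ β (linearF M X α) = (((M.1.map C : Matrix (Fin N) (Fin N) (Fun N)) *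
      substM (linearSub M) (Matrix.of fun μ ε => pderiv ℂ ε (X.F μ))) *
      ((M⁻¹).1.map C : Matrix (Fin N) (Fin N) (Fun N))) α β := by
    simp only [linearF, map_sum, h2, h1, Matrix.mul_apply, substM_apply, Matrix.of_apply,
      Matrix.map_apply, Finset.mul_sum, Finset.sum_mul]
    rw [Finset.sum_comm]
    exact Finset.sum_congr rfl fun _ _ => Finset.sum_congr rfl fun _ _ => by ring
  rw [h3]
  have h4 := congrFun (congrFun (pdM_conjM M (Matrix.of fun μ ε => pderiv ℂ ε (X.F μ)) γ) α) β
  exact h4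

theorem sum_inv_mulVec (v : Fin N → ℂ) (δ : Fin N) :
    ∑ γ, (M.1.mulVec v) γ * (M⁻¹).1 δ γ = v δ := by
  have h : (M⁻¹).1.mulVec (M.1.mulVec v) = v := by
    rw [Matrix.mulVec_mulVec, GL_inv_mul, Matrix.one_mulVec]
  refine Eq.trans (Finset.sum_congr rfl fun γ _ => mul_comm _ _) (congrFun h δ)

theorem sum_smul_inv {R V : Type*} [CommRing R] [AddCommGroup V] [Module R V] (φ : ℂ →+* R)
    (v : Fin N → ℂ) (A : Fin N → V) :
    ∑ γ, φ (M.1.mulVec v γ) • ∑ δ, φ ((M⁻¹).1 δ γ) • A δ = ∑ δ, φ (v δ) • A δ := by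
  simp only [Finset.smul_sum, smul_smul, ← map_mul]
  rw [Finset.sum_comm]
  refine Finset.sum_congr rfl fun δ _ => ?_
  rw [← Finset.sum_smul, ← map_sum, sum_inv_mulVec]

theorem conjM_smul_sum (v : Fin N → ℂ) (A : Fin N → Matrix (Fin N) (Fin N) (Fun N)) :
    conjM M (∑ δ, (C (v δ) : Fun N) • A δ) = ∑ δ, (C (v δ) : Fun N) • conjM M (A δ) := by
  have h0 := constantCoeff_linearSub M
  rw [conjM, substM_sum h0, Finset.mul_sum, Finset.sum_mul]
  refine Finset.sum_congr rfl fun δ _ => ?_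
  have h1 : substM (linearSub M) ((C (v δ) : Fun N) • A δ) =
      (C (v δ) : Fun N) • substM (linearSub M) (A δ) := by
    ext1 a b
    rw [substM_apply, Matrix.smul_apply, Matrix.smul_apply, smul_eq_mul, smul_eq_mul,
      subst_mul (hasSubst_of_constantCoeff_zero h0), subst_C, substM_apply]
  rw [h1, Matrix.mul_smul, Matrix.smul_mul, conjM]

theorem sum_unit_linear : ∑ γ, (C (M.1.mulVec X.unit γ) : Fun N) •
    ∑ δ, (C ((M⁻¹).1 δ γ) : Fun N) • conjM M (X.Cmat δ) = 1 := by
  rw [sum_smul_inv M (C : ℂ →+* Fun N), ← conjM_smul_sum, X.sum_unit_Cmat, conjM_one]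

/-- The flat F-manifold obtained by a linear change of coordinates. -/
def linearChange : FlatFManifold N where
  orig := M.1.mulVec X.orig
  unit := M.1.mulVec X.unit
  F := linearF M X
  unit_axiom := by
    intro α β
    simp only [pderiv_pderiv_linearF]
    rw [← Matrix.one_apply, ← sum_unit_linear M X, Matrix.sum_apply]
    rfl
  assoc_axiom := by
    intro α β γ δ
    simp only [pderiv_pderiv_linearF]
    rw [← Matrix.mul_apply, ← Matrix.mul_apply, Finset.sum_mul_sum, Finset.sum_mul_sum,
      Finset.sum_comm]
    refine congrFun (congrFun (Finset.sum_congr rfl fun i _ => Finset.sum_congr rfl fun j _ => ?_) α) δ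
    rw [Matrix.smul_mul, Matrix.mul_smul, Matrix.smul_mul, Matrix.mul_smul, ← conjM_mul,
      ← conjM_mul, X.Cmat_comm, smul_smul, smul_smul, mul_comm (C _ : Fun N)]

theorem linearChange_Cmat (γ : Fin N) : (linearChange M X).Cmat γ =
    ∑ δ, (C ((M⁻¹).1 δ γ) : Fun N) • conjM M (X.Cmat δ) := by
  ext1 α β
  exact pderiv_pderiv_linearF M X γ α β

theorem mulOrig_eq (v w : Fin N → ℂ) :
    X.mulOrig v w = (∑ β, v β • cc (X.Cmat β)).mulVec w := by
  funext α
  simp only [mulOrig, Matrix.mulVec, dotProduct, Matrix.sum_apply, Matrix.smul_apply, smul_eq_mul,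
    Finset.sum_mul]
  rw [Finset.sum_comm]
  refine Finset.sum_congr rfl fun γ _ => Finset.sum_congr rfl fun β _ => ?_
  rw [mul_comm (v β)]
  rfl

theorem linearChange_mulOrig (v w : Fin N → ℂ) :
    (linearChange M X).mulOrig (M.1.mulVec v) (M.1.mulVec w) = M.1.mulVec (X.mulOrig v w) := by
  have h1 : ∀ γ, cc ((linearChange M X).Cmat γ) =
      ∑ δ, (M⁻¹).1 δ γ • (M.1 * cc (X.Cmat δ) * (M⁻¹).1) := by
    intro γ
    rw [linearChange_Cmat]
    ext1 α β
    simp only [cc_apply, Matrix.sum_apply, map_sum, Matrix.smul_apply, smul_eq_mul, map_mul,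
      constantCoeff_C, ← cc_conjM]
  have h2 := sum_smul_inv M (RingHom.id ℂ) v fun δ => M.1 * cc (X.Cmat δ) * (M⁻¹).1
  simp only [RingHom.id_apply] at h2
  rw [mulOrig_eq, mulOrig_eq]
  simp only [h1]
  rw [h2, Matrix.mulVec_mulVec, Matrix.mulVec_mulVec, Finset.sum_mul, Finset.mul_sum]
  congr 1
  refine Finset.sum_congr rfl fun δ _ => ?_
  rw [Matrix.smul_mul, Matrix.mul_smul, mul_assoc, mul_assoc, GL_inv_mul, mul_one]

/-- The calibration obtained by a linear change of coordinates. -/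
def Calibration.linearChange {X : FlatFManifold N} (Ω : X.Calibration) :
    (FlatFManifold.linearChange M X).Calibration where
  mat k := conjM M (Ω.mat k)
  mat_zero := by rw [Ω.mat_zero, conjM_one]
  deriv d α β γ := by
    have h1 : pdM γ (conjM M (Ω.mat (d + 1))) =
        conjM M (Ω.mat d) * (FlatFManifold.linearChange M X).Cmat γ := by
      rw [pdM_conjM, linearChange_Cmat, Finset.mul_sum]
      refine Finset.sum_congr rfl fun δ _ => ?_
      rw [Ω.pdM_mat_succ, conjM_mul, Matrix.mul_smul]
    rw [← pdM_apply, h1, Matrix.mul_apply]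
    exact Finset.sum_congr rfl fun μ _ => mul_comm _ _

variable {X} in
theorem Calibration.IsNormalized.linearChange {Ω : X.Calibration} (hN : Ω.IsNormalized) :
    (Ω.linearChange M).IsNormalized := fun k => by
  show cc (conjM M (Ω.mat (k + 1))) = 0
  rw [cc_conjM, hN, Matrix.mul_zero, Matrix.zero_mul]

variable {X} in
/-- The action of the linear group on cones. -/
theorem Calibration.isImage_linearChange (Ω : X.Calibration) {G₁ G₂ : GraphGerm N}
    (h₁ : Ω.IsConeOf G₁) (h₂ : (Ω.linearChange M).IsConeOf G₂) : IsImage (const M) G₁ G₂ := by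
  obtain ⟨w, hw⟩ := Ω.exists_isEulerLagrange
  -- At w' = M w the linear functions M⁻¹ t take the values w, which gives M S_w = S'_{w'} M.
  let w' : Fin N → BigFun N := fun α => ∑ β, C (M.1 α β) * w β
  have hw' : ∀ α, constantCoeff (w' α) = 0 := fun α => by
    simp only [w', map_sum, map_mul, hw.1, mul_zero, Finset.sum_const_zero]
  have hs := hasSubst_of_constantCoeff_zero hw'
  have hL : (fun α => subst w' (linearSub M α)) = w := by
    funext α
    rw [linearSub, ← coe_substAlgHom hs, map_sum, coe_substAlgHom]
    have h1 : ∀ β, subst w' (C ((M⁻¹).1 α β) * MvPowerSeries.X β : Fun N) =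
        ∑ γ, C ((M⁻¹).1 α β * M.1 β γ) * w γ := by
      intro β
      rw [subst_mul hs, subst_C, subst_X hs]
      simp only [w', Finset.mul_sum, map_mul, mul_assoc]
    simp only [h1]
    rw [Finset.sum_comm]
    have h2 : ∀ γ, ∑ β, C ((M⁻¹).1 α β * M.1 β γ) * w γ =
        C ((1 : Matrix (Fin N) (Fin N) ℂ) α γ) * w γ := by
      intro γ
      rw [← Finset.sum_mul, ← map_sum, ← Matrix.mul_apply, GL_inv_mul]
    simp only [h2, Matrix.one_apply]
    rw [Finset.sum_eq_single α]
    · rw [if_pos rfl, map_one, one_mul]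
    · intro γ _ hγ
      rw [if_neg hγ.symm, map_zero, zero_mul]
    · simp
  refine Ω.isImage_of_lower (Ω.linearChange M) h₁ h₂ hw hw'
    (fun i hi => if_neg (by omega)) M.1 ?_ fun k => ?_
  · ext1 α u
    rfl
  · have h1 : cseq (Fin N × ℕ) (const M) = fun i => if i = 0 then M.1.map C else 0 := by
      funext i
      rw [cseq, const]
      split_ifs
      · rfl
      · exact mapC_zero
    rw [h1, conv_const_left]
    beta_reduce
    rcases lt_or_ge 0 k with hk | hk
    · rw [Calibration.hat_of_pos _ hk, Calibration.hat_of_pos _ hk, Matrix.zero_mul,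
        Matrix.mul_zero]
    · obtain ⟨n, rfl⟩ : ∃ n : ℕ, k = -n := ⟨(-k).toNat, by omega⟩
      rw [Calibration.hat_neg_natCast, Calibration.hat_neg_natCast, substM_neg_one_pow_smul hw.1,
        substM_neg_one_pow_smul hw', Matrix.mul_smul, Matrix.smul_mul]
      congr 1
      show _ = substM w' (conjM M (Ω.mat n)) * _
      rw [conjM, substM_mul hw', substM_mul hw', substM_mapC, substM_mapC,
        substM_substM (constantCoeff_linearSub M) hw', hL, mul_assoc, mapC_inv_mul, mul_one]

end FlatFManifold

end Linear

/-! ### Change of calibration -/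

/-- A power series with constant matrix coefficients, as a series of matrices of functions. -/
def constS (σ : Type*) {N : ℕ} (S : PowerSeries (Matrix (Fin N) (Fin N) ℂ)) :
    PowerSeries (Matrix (Fin N) (Fin N) (MvPowerSeries σ ℂ)) :=
  PowerSeries.map (C (σ := σ) (R := ℂ)).mapMatrix S

theorem coeff_constS (σ : Type*) {N : ℕ} (S : PowerSeries (Matrix (Fin N) (Fin N) ℂ)) (k : ℕ) :
    PowerSeries.coeff k (constS σ S) = (PowerSeries.coeff k S).map C := PowerSeries.coeff_map _ _ _

theorem pdS_constS {σ : Type*} {N : ℕ} (S : PowerSeries (Matrix (Fin N) (Fin N) ℂ)) (s : σ) :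
    pdS s (constS σ S) = 0 := by
  ext1 k
  rw [coeff_pdS, coeff_constS, pdM_mapC, map_zero]

namespace FlatFManifold.Calibration

variable {N : ℕ} {X : FlatFManifold N} (Ω : X.Calibration)

/-- The calibration obtained by multiplication by a constant series. -/
def leftMul (S : PowerSeries (Matrix (Fin N) (Fin N) ℂ)) (hS : PowerSeries.coeff 0 S = 1) :
    X.Calibration where
  mat k := PowerSeries.coeff k (constS (Fin N) S * Ω.series)
  mat_zero := by
    rw [PowerSeries.coeff_mul, Finset.Nat.antidiagonal_zero, Finset.sum_singleton, coeff_constS, hS,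
      series, PowerSeries.coeff_mk, Ω.mat_zero, mapC_one, mul_one]
  deriv d α β γ := by
    have h1 := congrArg (PowerSeries.coeff (d + 1)) (pdS_mul γ (constS (Fin N) S) Ω.series)
    rw [pdS_constS, zero_mul, zero_add, Ω.pdS_series, ← mul_assoc, ← PowerSeries.X_mul, mul_assoc,
      ← mul_assoc (constS _ _), PowerSeries.coeff_succ_X_mul, PowerSeries.coeff_mul_C,
      coeff_pdS] at h1
    rw [← pdM_apply, h1, Matrix.mul_apply]
    exact Finset.sum_congr rfl fun μ _ => mul_comm _ _

theorem series_leftMul (S : PowerSeries (Matrix (Fin N) (Fin N) ℂ))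
    (hS : PowerSeries.coeff 0 S = 1) : (Ω.leftMul S hS).series = constS (Fin N) S * Ω.series :=
  PowerSeries.ext fun _ => PowerSeries.coeff_mk _ _

/-- The operator S_w carries signs (-1)^k, so the constant series S acts as S(-1/z); here w' = w and
B = Id. -/
theorem isImage_of_series_eq {Ω Ω' : X.Calibration} {S : PowerSeries (Matrix (Fin N) (Fin N) ℂ)}
    (h : Ω'.series = constS (Fin N) S * Ω.series) {G₁ G₂ : GraphGerm N} (h₁ : Ω.IsConeOf G₁)
    (h₂ : Ω'.IsConeOf G₂) : IsImage (FlatF.lower (altS S)) G₁ G₂ := by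
  obtain ⟨w, hw⟩ := Ω.exists_isEulerLagrange
  refine Ω.isImage_of_lower Ω' h₁ h₂ hw hw.1 (fun i hi => if_neg (by omega)) 1
    (Matrix.one_mul _) fun k => ?_
  have h1 : cseq (Fin N × ℕ) (FlatF.lower (altS S)) = negSeq (smap w (altS (constS (Fin N) S))) := by
    funext i
    rw [cseq, FlatF.lower, negSeq]
    split_ifs
    · rw [coeff_smap, coeff_altS, coeff_altS, coeff_constS, substM_neg_one_pow_smul hw.1,
        substM_mapC]
      ext1 a b
      simp
    · exact mapC_zero
  rw [h1, hat, conv_negSeq, ← smap_mul hw.1, ← altS_mul, ← h, mapC_one, mul_one, hat]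

/-- S' is the value of the calibration at the base point and S its inverse. Both relations are kept
because passing to the normalized cone and returning from it are both needed. -/
theorem exists_normalized_calibration : ∃ Ω' : X.Calibration, Ω'.IsNormalized ∧
    ∃ S S' : PowerSeries (Matrix (Fin N) (Fin N) ℂ), PowerSeries.coeff 0 S = 1 ∧
      PowerSeries.coeff 0 S' = 1 ∧ Ω'.series = constS (Fin N) S * Ω.series ∧
      Ω.series = constS (Fin N) S' * Ω'.series := by
  let φ : Matrix (Fin N) (Fin N) (Fun N) →+* Matrix (Fin N) (Fin N) ℂ :=
    (constantCoeff (σ := Fin N) (R := ℂ)).mapMatrix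
  set S' := PowerSeries.map φ Ω.series with hS'
  have h0 : PowerSeries.coeff 0 S' = 1 := by
    rw [hS', PowerSeries.coeff_map, series, PowerSeries.coeff_mk, Ω.mat_zero, map_one]
  have h0' : PowerSeries.constantCoeff S' = ((1 : (Matrix (Fin N) (Fin N) ℂ)ˣ) : _) := by
    rw [← PowerSeries.coeff_zero_eq_constantCoeff_apply, h0, Units.val_one]
  set S := PowerSeries.invOfUnit S' 1 with hS
  have h1 : S * S' = 1 := PowerSeries.invOfUnit_mul _ _ h0'
  have h2 : S' * S = 1 := PowerSeries.mul_invOfUnit _ _ h0'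
  have h3 : PowerSeries.coeff 0 S = 1 := by
    have h := congrArg (PowerSeries.coeff 0) h1
    rwa [PowerSeries.coeff_mul, Finset.Nat.antidiagonal_zero, Finset.sum_singleton, h0, mul_one,
      PowerSeries.coeff_one, if_pos rfl] at h
  refine ⟨Ω.leftMul S h3, fun k => ?_, S, S', h3, h0, Ω.series_leftMul S h3, ?_⟩
  · have h4 : PowerSeries.map φ (constS (Fin N) S * Ω.series) = 1 := by
      rw [map_mul, ← hS', ← h1]
      refine congrArg (· * _) (PowerSeries.ext fun k => ?_)
      rw [PowerSeries.coeff_map, coeff_constS]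
      exact cc_mapC _
    have h5 := congrArg (PowerSeries.coeff (k + 1)) h4
    rw [PowerSeries.coeff_map, PowerSeries.coeff_one, if_neg (by omega)] at h5
    exact h5
  · rw [series_leftMul, ← mul_assoc, constS, constS, ← map_mul, h2, map_one, one_mul]

/-! ### Ancestor cones -/

/-- Ω^a_b has order at least a + b + 1, and q_0 vanishes at the base point, so every potential has
order at least two. -/
theorem IsNormalized.isAncestor {Ω : X.Calibration} (hN : Ω.IsNormalized) {G : GraphGerm N}
    (h : Ω.IsConeOf G) : G.IsAncestor := by
  obtain ⟨hb, -, w, hw, hpot⟩ := h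
  have hb0 : G.base = 0 := by rw [hb, shiftedOrig_eq_zero hN]
  refine ⟨hb0, fun a α p => ?_⟩
  rw [← mem_orderIdeal_one]
  refine pderiv_mem_orderIdeal ?_ p
  rw [hpot]
  refine formalSum_mem_orderIdeal fun s => ?_
  have h1 := subst_mem_orderIdeal hw.constantCoeff_eq_zero (two_mem_orderIdeal hN a s.2 α s.1)
  by_cases hs : s.2 = 0
  · refine orderIdeal_anti (by omega) (mul_mem_orderIdeal (k := 1) h1 ?_)
    rw [mem_orderIdeal_one, GraphGerm.q, GraphGerm.basePoint, if_pos hs, hb0]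
    simp
  · exact Ideal.mul_mem_right _ _ (orderIdeal_anti (by omega) h1)

theorem two_zero (a : ℕ) : Ω.two a 0 = Ω.mat (a + 1) := by
  simp [two, Ω.lower_zero]

/-- The t^β_0-derivative of F^{α,a} at the base point is Ω^a_0 there minus (∂_β Ω^a_1) A. The second
term contains Ω^0_0 A, the base of the cone, which is zero for an ancestor cone. -/
theorem IsConeOf.isNormalized {Ω : X.Calibration} {G : GraphGerm N} (h : Ω.IsConeOf G)
    (hA : G.IsAncestor) : Ω.IsNormalized := by
  obtain ⟨hb, hu, w, hw, hpot⟩ := h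
  obtain ⟨hb0, hA⟩ := hA
  have hw0 := hw.constantCoeff_eq_zero
  have hso : (col Ω.shiftedOrig : Matrix (Fin N) Unit ℂ) = 0 := by
    rw [← hb, hb0]
    rfl
  -- On the locus where all t_b with b ≥ 1 vanish, w is the coordinate t_0.
  have hdw : ∀ γ β, constantCoeff (pderiv ℂ (β, 0) (w γ)) = if γ = β then 1 else 0 := by
    intro γ β
    rw [← coeff_zero_eq_constantCoeff_apply, coeff_pderiv, zero_add, hw.1 γ _ (by
      intro p hp
      rw [Finset.mem_singleton.1 (Finsupp.support_single_subset hp)]), coeff_X]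
    by_cases h : γ = β
    · subst h
      simp
    · rw [if_neg h, if_neg, zero_mul]
      intro h1
      have h2 := (Finsupp.single_left_inj one_ne_zero).1 h1
      exact h (Prod.mk.inj h2).1.symm
  have hds : ∀ (f : Fun N) β, constantCoeff (pderiv ℂ (β, 0) (subst w f)) =
      constantCoeff (pderiv ℂ β f) := by
    intro f β
    rw [pderiv_subst hw0, map_sum]
    simp only [map_mul, hdw, constantCoeff_subst hw0, mul_ite, mul_one, mul_zero]
    simp
  intro a
  ext1 α β
  have h1 := hA a α (β, 0)
  have hl : LocallyFinite fun p : Fin N × ℕ => subst w (Ω.two a p.2 α p.1) * G.q p.2 p.1 :=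
    (locallyFinite_q G).mul_left _
  have hterm : ∀ p : Fin N × ℕ, coeff 0
      (pderiv ℂ (β, 0) (subst w (Ω.two a p.2 α p.1) * G.q p.2 p.1)) =
      constantCoeff (Ω.two a p.2 α p.1) * (if p = (β, 0) then 1 else 0) +
        G.basePoint p.2 p.1 * constantCoeff (pderiv ℂ β (Ω.two a p.2 α p.1)) := by
    intro p
    have h2 : constantCoeff (pderiv ℂ (β, 0) (G.q p.2 p.1)) = if p = (β, 0) then 1 else 0 := by
      rw [GraphGerm.q, map_add, pderiv_C, add_zero]
      split_ifs with h
      · rw [h, pderiv_X_self, map_one]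
      · rw [pderiv_X_of_ne h, map_zero]
    rw [coeff_zero_eq_constantCoeff_apply, Derivation.leibniz, smul_eq_mul, smul_eq_mul, map_add,
      map_mul, map_mul, h2, hds, constantCoeff_subst hw0]
    congr 2
    rw [GraphGerm.q, map_add, constantCoeff_X, constantCoeff_C, zero_add]
  have hsum : ∑ β', constantCoeff (pderiv ℂ β (Ω.two a 1 α β')) * X.unit β' = 0 := by
    have h2 : cc (pdM β (Ω.two a 1)) * (col X.unit : Matrix (Fin N) Unit ℂ) = 0 := by
      rw [Ω.pdM_two, Ω.lower_one, cc_mul, cc_mul, Matrix.mul_assoc, Matrix.mul_assoc,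
        cc_mat_one_mul_unit, hso, Matrix.mul_zero, Matrix.mul_zero]
    exact congrFun (congrFun h2 α) ()
  rw [hpot, pderiv_formalSum _ hl, ← coeff_zero_eq_constantCoeff_apply, coeff_formalSum,
    finsum_eq_sum_of_support_subset (s := Finset.univ ×ˢ Finset.range 2)] at h1
  · simp only [hterm] at h1
    rw [Finset.sum_product] at h1
    simp only [Finset.sum_range_succ, Finset.sum_range_zero, zero_add, GraphGerm.basePoint,
      hb0, hu, Ω.two_zero, Prod.mk.injEq, one_ne_zero, and_false, if_false, if_true, and_true,
      mul_zero, Pi.zero_apply, zero_mul, add_zero, mul_ite, mul_one, neg_mul] at h1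
    rw [Finset.sum_add_distrib, Finset.sum_neg_distrib] at h1
    simp only [mul_comm (X.unit _), hsum, neg_zero, add_zero, Finset.sum_ite_eq',
      Finset.mem_univ, if_true] at h1
    exact h1
  · intro p hp
    rw [Function.mem_support, hterm] at hp
    by_contra h2
    have h3 : 2 ≤ p.2 := by
      by_contra h3
      exact h2 (by simp; omega)
    refine hp ?_
    have h4 : p ≠ (β, 0) := by
      rintro rfl
      exact absurd h3 (by simp)
    rw [GraphGerm.basePoint, if_neg (show p.2 ≠ 0 by omega), if_neg (show p.2 ≠ 1 by omega),
      zero_mul, add_zero, if_neg h4, mul_zero]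

end FlatFManifold.Calibration

/-! ### The trivial flat F-manifold -/

section Trivial

variable (N : ℕ)

/-- The calibration `exp(t z)` of the trivial flat F-manifold. -/
def trivialCalibration : (trivialFlatFManifold N).Calibration where
  mat k := Matrix.diagonal fun α => C ((k.factorial : ℂ)⁻¹) * MvPowerSeries.X α ^ k
  mat_zero := by simp
  deriv d α β γ := by
    have h1 : ∀ μ, (trivialFlatFManifold N).c μ γ β = if γ = μ ∧ β = μ then 1 else 0 := fun μ =>
      pderiv_pderiv_half_sq μ γ β
    simp only [h1, Matrix.diagonal_apply]
    rw [Finset.sum_eq_single α]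
    · by_cases hβ : β = α
      · subst hβ
        rw [if_pos rfl, if_pos rfl, Derivation.leibniz, pderiv_C, smul_zero, add_zero,
          pderiv_pow, smul_eq_mul]
        by_cases hγ : γ = β
        · subst hγ
          rw [if_pos ⟨rfl, rfl⟩, pderiv_X_self, one_mul]
          have h2 : ((d.factorial : ℂ)⁻¹) = ((d + 1).factorial : ℂ)⁻¹ * (d + 1 : ℕ) := by
            have h3 : ((d + 1 : ℕ) : ℂ) ≠ 0 := Nat.cast_ne_zero.2 (by omega)
            have h4 : (d.factorial : ℂ) ≠ 0 := Nat.cast_ne_zero.2 (Nat.factorial_ne_zero d)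
            rw [Nat.factorial_succ, Nat.cast_mul]
            field_simp
          rw [h2, map_mul, map_natCast, Nat.add_sub_cancel]
          ring
        · rw [if_neg fun h => hγ h.1, pderiv_X_of_ne (Ne.symm hγ)]
          ring
      · rw [if_neg (Ne.symm hβ), if_neg fun h => hβ h.2, map_zero, zero_mul]
    · intro μ _ hμ
      rw [if_neg (Ne.symm hμ), mul_zero]
    · simp

theorem isNormalized_trivialCalibration : (trivialCalibration N).IsNormalized := fun k => by
  ext1 α β
  rw [cc_apply]
  show constantCoeff (Matrix.diagonal _ α β) = 0
  rw [Matrix.diagonal_apply]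
  split_ifs <;> simp

theorem trivial_mulOrig (k l : Fin N) : (trivialFlatFManifold N).mulOrig
    (Pi.basisFun ℂ (Fin N) k) (Pi.basisFun ℂ (Fin N) l) =
      if k = l then Pi.basisFun ℂ (Fin N) k else 0 := by
  funext α
  have h1 : ∀ β γ, constantCoeff ((trivialFlatFManifold N).c α β γ) =
      if β = α ∧ γ = α then 1 else 0 := fun β γ => by
    rw [FlatFManifold.c]
    rw [show (trivialFlatFManifold N).F α = C (1 / 2 : ℂ) * X α ^ 2 from rfl,
      pderiv_pderiv_half_sq]
    split_ifs <;> simp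
  simp only [FlatFManifold.mulOrig, h1, ite_and]
  by_cases h : k = l
  · subst h
    simp [Pi.single_apply, eq_comm]
  · rw [if_neg h]
    simp only [Pi.basisFun_apply, Pi.single_apply]
    simp
    intro h2 h3
    exact h (h2.trans h3.symm)

end Trivial

/-! ### Transitivity -/

theorem exists_GL {N : ℕ} (π π' : Module.Basis (Fin N) ℂ (Fin N → ℂ)) :
    ∃ M : GL (Fin N) ℂ, ∀ k, M.1.mulVec (π k) = π' k := by
  obtain ⟨U, hU⟩ := (Matrix.isUnit_iff_isUnit_det _).2 (FlatFManifold.isUnit_frame π)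
  obtain ⟨U', hU'⟩ := (Matrix.isUnit_iff_isUnit_det _).2 (FlatFManifold.isUnit_frame π')
  have h : ((U' * U⁻¹ : GL (Fin N) ℂ)).1 * FlatFManifold.frame π = FlatFManifold.frame π' := by
    rw [← hU, ← hU', ← Units.val_mul, inv_mul_cancel_right]
  refine ⟨U' * U⁻¹, fun k => ?_⟩
  funext α
  exact congrFun (congrFun h α) k

/-- M carries the idempotents of one algebra to those of the other. Each unit is the sum of its
idempotents, so the units agree as well and G_+ can do the rest. -/
theorem exists_const_upper {N : ℕ} {X₁ X₂ : FlatFManifold N} (hs₁ : X₁.IsSemisimple)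
    (hs₂ : X₂.IsSemisimple) {Ω₁ : X₁.Calibration} {Ω₂ : X₂.Calibration} (hN₁ : Ω₁.IsNormalized)
    (hN₂ : Ω₂.IsNormalized) {G₁ : GraphGerm N} (h₁ : Ω₁.IsConeOf G₁) :
    ∃ R ∈ GPlus N, ∃ M : GL (Fin N) ℂ, ∃ G₂ G₃ : GraphGerm N,
      IsImage (const M) G₁ G₂ ∧ G₂.IsAncestor ∧ G₂.IsSemisimpleCone ∧
      IsImage (upper R) G₂ G₃ ∧ G₃.IsAncestor ∧ G₃.IsSemisimpleCone ∧ Ω₂.IsConeOf G₃ := by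
  obtain ⟨π₁, hπ₁⟩ := hs₁
  obtain ⟨π₂, hπ₂⟩ := hs₂
  obtain ⟨M, hM⟩ := exists_GL π₁ π₂
  have hπ : ∀ k l, (FlatFManifold.linearChange M X₁).mulOrig (π₂ k) (π₂ l) =
      if k = l then π₂ k else 0 := by
    intro k l
    rw [← hM, ← hM, FlatFManifold.linearChange_mulOrig, hπ₁]
    split_ifs
    · rfl
    · exact Matrix.mulVec_zero _
  have hN := hN₁.linearChange M
  obtain ⟨G₂, hG₂⟩ := (Ω₁.linearChange M).exists_isConeOf
  obtain ⟨G₃, hG₃⟩ := Ω₂.exists_isConeOf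
  obtain ⟨R, hR, hRG⟩ := exists_upper hπ hπ₂ hN hN₂
  exact ⟨R, hR, M, G₂, G₃, Ω₁.isImage_linearChange M h₁ hG₂, hN.isAncestor hG₂,
    ⟨_, _, ⟨π₂, hπ⟩, hG₂⟩, hRG _ _ hG₂ hG₃, hN₂.isAncestor hG₃, ⟨_, _, ⟨π₂, hπ₂⟩, hG₃⟩, hG₃⟩

theorem lower_altS_mem {N : ℕ} {S : PowerSeries (Matrix (Fin N) (Fin N) ℂ)}
    (h : PowerSeries.coeff 0 S = 1) : altS S ∈ GMinus N := by
  show PowerSeries.coeff 0 (altS S) = 1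
  rw [coeff_altS, h, pow_zero, one_smul]

end FlatF

end

/-! ### Assembly of the theorem -/

theorem mainTheorem4 (N : ℕ) :
    (∃ T : FlatF.GraphGerm N, T.IsTrivialCone) ∧
    (∀ T G : FlatF.GraphGerm N, T.IsTrivialCone → G.IsSemisimpleCone →
      ∃ S ∈ FlatF.GMinus N, ∃ R ∈ FlatF.GPlus N, ∃ M : GL (Fin N) ℂ,
      ∃ G₁ G₂ : FlatF.GraphGerm N,
        FlatF.IsImage (FlatF.const M) T G₁ ∧ G₁.IsAncestor ∧ G₁.IsSemisimpleCone ∧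
        FlatF.IsImage (FlatF.upper R) G₁ G₂ ∧ G₂.IsAncestor ∧ G₂.IsSemisimpleCone ∧
        FlatF.IsImage (FlatF.lower S) G₂ G) ∧
    (∀ G G' : FlatF.GraphGerm N, G.IsSemisimpleCone → G'.IsSemisimpleCone →
      ∃ S ∈ FlatF.GMinus N, ∃ S' ∈ FlatF.GMinus N, ∃ R ∈ FlatF.GPlus N, ∃ M : GL (Fin N) ℂ,
      ∃ G₁ G₂ G₃ : FlatF.GraphGerm N,
        FlatF.IsImage (FlatF.lower S) G G₁ ∧ G₁.IsAncestor ∧ G₁.IsSemisimpleCone ∧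
        FlatF.IsImage (FlatF.const M) G₁ G₂ ∧ G₂.IsAncestor ∧ G₂.IsSemisimpleCone ∧
        FlatF.IsImage (FlatF.upper R) G₂ G₃ ∧ G₃.IsAncestor ∧ G₃.IsSemisimpleCone ∧
        FlatF.IsImage (FlatF.lower S') G₃ G') := by
  refine ⟨?_, ?_, ?_⟩
  · obtain ⟨T, hT⟩ := (FlatF.trivialCalibration N).exists_isConeOf
    exact ⟨T, (FlatF.isNormalized_trivialCalibration N).isAncestor hT, _, hT⟩
  · rintro T G ⟨hA, Ω₀, hT⟩ ⟨X, Ω, hs, hG⟩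
    obtain ⟨Ω', hN', _, S', _, hS', -, h⟩ := Ω.exists_normalized_calibration
    -- The calibration underlying a trivial cone is not prescribed; the ancestor property forces it
    -- to be normalized.
    obtain ⟨R, hR, M, G₁, G₂, h1, h2, h3, h4, h5, h6, h7⟩ :=
      FlatF.exists_const_upper ⟨_, FlatF.trivial_mulOrig N⟩ hs (hT.isNormalized hA) hN' hT
    exact ⟨_, FlatF.lower_altS_mem hS', R, hR, M, G₁, G₂, h1, h2, h3, h4, h5, h6,
      FlatF.FlatFManifold.Calibration.isImage_of_series_eq h h7 hG⟩
  · rintro G G' ⟨X, Ω, hs, hG⟩ ⟨X', Ω', hs', hG'⟩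
    obtain ⟨Ω₁, hN₁, S, _, hS, _, h, -⟩ := Ω.exists_normalized_calibration
    obtain ⟨Ω₂, hN₂, _, S', _, hS', -, h'⟩ := Ω'.exists_normalized_calibration
    obtain ⟨G₁, hG₁⟩ := Ω₁.exists_isConeOf
    obtain ⟨R, hR, M, G₂, G₃, h1, h2, h3, h4, h5, h6, h7⟩ :=
      FlatF.exists_const_upper hs hs' hN₁ hN₂ hG₁
    exact ⟨_, FlatF.lower_altS_mem hS, _, FlatF.lower_altS_mem hS', R, hR, M, G₁, G₂, G₃,
      FlatF.FlatFManifold.Calibration.isImage_of_series_eq h hG hG₁, hN₁.isAncestor hG₁,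
      ⟨X, Ω₁, hs, hG₁⟩, h1, h2, h3, h4, h5, h6,
      FlatF.FlatFManifold.Calibration.isImage_of_series_eq h' h7 hG'⟩
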